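/- For $X\in\mathbb{R}^{n_1\times n_2}$ let $\|X\|_*$ be the sum of its singular values, $\|X\|_1=\sum_{ij}|X_{ij}|$, and for $\Omega\subset[n_1]\times[n_2]$ let $\mathcal{P}_\Omega X$ be the matrix that agrees with $X$ on $\Omega$ and vanishes off $\Omega$. Put $n_{(1)}=\max(n_1,n_2)$ and $n_{(2)}=\min(n_1,n_2)$. A matrix $L_0\in\mathbb{R}^{n_1\times n_2}$ of rank $r$ with reduced singular value decomposition $L_0=U\Sigma V^*$ is incoherent with parameter $\mu$ if $$\max_i\|U^*e_i\|^2\le\frac{\mu r}{n_1},\qquad \max_j\|V^*e_j\|^2\le\frac{\mu r}{n_2},\qquad \max_{i,j}|(UV^*)_{ij}|\le\sqrt{\frac{\mu r}{n_1n_2}}.$$ There are numerical constants $\rho_r,\tau_s,c>0$ such that the following holds for all $n_1,n_2\ge 1$, all $L_0\in\mathbb{R}^{n_1\times n_2}$ that are incoherent with parameter $\mu$, every fixed matrix $S\in\mathbb{R}^{n_1\times n_2}$ and every $\tau\in[0,1]$. Let $\Omega_{\rm obs}$ be uniformly distributed among all subsets of $[n_1]\times[n_2]$ of cardinality $m$,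 where $m=0.1\,n_1n_2$ up to rounding (that is, $|m-0.1\,n_1n_2|<1$). Let each observed entry be corrupted with probability $\tau$ independently of the others: $S_0=\mathcal{P}_BS$, where $B\subset[n_1]\times[n_2]$ is independent of $\Omega_{\rm obs}$ and contains each entry independently with probability $\tau$. Let $Y=\mathcal{P}_{\Omega_{\rm obs}}(L_0+S_0)$ be the observed data. If $$\operatorname{rank}(L_0)\,\mu\,(\log n_{(1)})^2\le\rho_r\,n_{(2)}\qquad\text{and}\qquad\tau\le\tau_s,$$ then with probability at least $1-c\,n_{(1)}^{-10}$ over $(\Omega_{\rm obs},B)$, Principal Component Pursuit $$\text{minimize }\|L\|_*+\lambda\|S'\|_1\quad\text{subject to}\quad\mathcal{P}_{\Omega_{\rm obs}}(L+S')=Y,\qquad\lambda=\frac{1}{\sqrt{0.1\,n_{(1)}}},$$ is exact: its unique solution is $(\hat L,\hat S)=(L_0,\mathcal{P}_{\Omega_{\rm obs}}S_0)$. In particular, for square matrices ($n_1=n_2=n$) this holds with $m=0.1\,n^2$, $\lambda=1/\sqrt{0.1\,n}$, probability at least $1-c\,n^{-10}$, and the rank condition $\operatorname{rank}(L_0)\le\rho_r\,n\,\mu^{-1}(\log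 n)^{-2}$. -/

import Mathlib

namespace RobustPCA

noncomputable section

open MeasureTheory ProbabilityTheory

variable {n₁ n₂ : ℕ}

/-- The nuclear norm: the sum of the singular values. -/
def nuclearNorm (X : Matrix (Fin n₁) (Fin n₂) ℝ) : ℝ :=
  (Matrix.toEuclideanLin X).singularValues.sum fun _ s => s

/-- The `ℓ₁` norm of a matrix seen as a long vector. -/
def l1Norm (X : Matrix (Fin n₁) (Fin n₂) ℝ) : ℝ :=
  ∑ i, ∑ j, |X i j|

open Classical in
/-- The orthogonal projection onto the space of matrices supported on `Ω`. -/
def proj (Ω : Set (Fin n₁ × Fin n₂)) (X : Matrix (Fin n₁) (Fin n₂) ℝ) :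
    Matrix (Fin n₁) (Fin n₂) ℝ :=
  Matrix.of fun i j => if (i, j) ∈ Ω then X i j else 0

/-- `L = U Σ Vᵀ` is a reduced singular value decomposition with `r` positive singular values. -/
structure IsReducedSVD {r : ℕ} (L : Matrix (Fin n₁) (Fin n₂) ℝ)
    (U : Matrix (Fin n₁) (Fin r) ℝ) (σ : Fin r → ℝ) (V : Matrix (Fin n₂) (Fin r) ℝ) : Prop where
  left_orthonormal : U.transpose * U = 1
  right_orthonormal : V.transpose * V = 1
  pos : ∀ k, 0 < σ k
  eq : L = U * Matrix.diagonal σ * V.transpose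

/-- The incoherence condition with parameter `μ`. The matrices `U Uᵀ`, `V Vᵀ` and `U Vᵀ` are
determined by `L`, so the condition does not depend on the decomposition that is chosen. -/
def IsIncoherent (L : Matrix (Fin n₁) (Fin n₂) ℝ) (μ : ℝ) : Prop :=
  ∃ (U : Matrix (Fin n₁) (Fin L.rank) ℝ) (σ : Fin L.rank → ℝ) (V : Matrix (Fin n₂) (Fin L.rank) ℝ),
    IsReducedSVD L U σ V ∧
    (∀ i, ∑ k, U i k ^ 2 ≤ μ * L.rank / n₁) ∧
    (∀ j, ∑ k, V j k ^ 2 ≤ μ * L.rank / n₂) ∧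
    (∀ i j, |(U * V.transpose) i j| ≤ √(μ * L.rank / (n₁ * n₂)))

/-- `(L, S)` solves: minimize `‖L‖_* + lam ‖S‖₁` subject to `P_Ω (L + S) = Y`. -/
def IsPCPSolution (lam : ℝ) (Ω : Set (Fin n₁ × Fin n₂)) (Y L S : Matrix (Fin n₁) (Fin n₂) ℝ) :
    Prop :=
  proj Ω (L + S) = Y ∧
    ∀ L' S' : Matrix (Fin n₁) (Fin n₂) ℝ, proj Ω (L' + S') = Y →
      nuclearNorm L + lam * l1Norm S ≤ nuclearNorm L' + lam * l1Norm S'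

/-- Principal Component Pursuit with observed set `Ω` and data `P_Ω (L₀ + S₀)` is exact:
the program has exactly one solution, namely `(L₀, P_Ω S₀)`. -/
def IsPCPExact (lam : ℝ) (Ω : Set (Fin n₁ × Fin n₂)) (L₀ S₀ : Matrix (Fin n₁) (Fin n₂) ℝ) : Prop :=
  ∀ L S : Matrix (Fin n₁) (Fin n₂) ℝ,
    IsPCPSolution lam Ω (proj Ω (L₀ + S₀)) L S ↔ L = L₀ ∧ S = proj Ω S₀

/-- The law of the pair (observed set, corrupted set): the observed set is uniformly distributed
among the sets of cardinality `m`, and, independently of it, every entry is put in the corrupted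
set with probability `τ`, independently of the other entries. Corruption of an entry that is not
observed has no effect on the data. -/
def samplingLaw (n₁ n₂ m : ℕ) (τ : unitInterval) :
    Measure (Set (Fin n₁ × Fin n₂) × Set (Fin n₁ × Fin n₂)) :=
  (uniformOn {A : Set (Fin n₁ × Fin n₂) | A.ncard = m}).prod (setBernoulli Set.univ τ)

end

end RobustPCA

/-! Write P_T = 1 - (1 - UUᵀ) ⊗ (1 - VVᵀ) (`tproj`) for the projection onto the tangent space T at
L₀. By convex duality it is enough to find a vector z supported on the observed set such that P_T z
= UVᵀ, the spectral norm of (1 - P_T) z is at most 1/2, |z| ≤ λ everywhere, z = λ sgn S₀ on the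
observed corruptions, and |z| ≤ λ/2 on a clean observed set Γ that is large enough for no nonzero
element of T to vanish on it (`isPCPExact_of_certificate`). Unlike in arguments with an approximate
certificate, P_T z = UVᵀ holds exactly here.

The signs of the corruption are fixed, but they can be replaced by random ones (`ex_derandomize`): Γ
is a Bernoulli set of rate p(1 - 2τ), entries off Γ receive a sparse random sign s, the entries with
s ≠ 0 are also observed, and such an entry is corrupted exactly when s agrees with the sign of S.
The certificate is z = Y + λ(E - Y'), where E is the sign field off Γ and Y, Y' are supported on Γ
with P_T Y = UVᵀ and P_T Y' = P_T E (`isPCPExact_of_interp`).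

Three estimates produce Y and Y'. First, Γ captures a fixed fraction of the energy of every element
of T (`IsProj.pr_lower_le`); this is a matrix Laplace transform bound proved by resampling single
entries and a differential inequality for the expected trace exponential. Secondly, golfing with
about 2 log n independent subsets of Γ makes UVᵀ - P_T Y tiny (`IsProj.pr_golf_le`), and a least
squares correction on Γ removes the remainder (`IsProj.interp_of_golf`). Thirdly, given Γ, the least
squares solution Y' is linear in the signs, so scalar Chernoff bounds control its entries and, with
a net, the spectral norm (`IsProj.pr_signCorr_le`). For small τ the signs are sub-Gaussian with an
arbitrarily small parameter, which beats the cardinality of the net.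

The two logarithms in the rank condition are spent on the golfing rate q, of order 1 / log n: the
contraction of the entries needs incoherence below q / log n, and the Hoeffding bound for spectral
norms loses 1/q, which the bound 1 / (√n log n) on the entries of UVᵀ absorbs.

Finally, the uniform law on sets of size m is at most N + 1 times the Bernoulli law of the same
mean, N = n₁n₂ (`uniformOn_real_singleton_le`), and the failure probability is small enough to pay
for this factor. -/

namespace RobustPCA
noncomputable section
-- Finite product probability: expectations, union bounds, Chernoff's bound.
open Classical in
/-- Expectation of `F` over a field `x : ι → Θ` of independent entries with common weights `w`. -/
def ex {ι Θ : Type*} [Fintype ι] [Fintype Θ] (w : Θ → ℝ) (F : (ι → Θ) → ℝ) : ℝ :=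
  ∑ x : ι → Θ, (∏ e, w (x e)) * F x

/-- A weight function is a probability weight. -/
structure IsWeight {Θ : Type*} [Fintype Θ] (w : Θ → ℝ) : Prop where
  nonneg : ∀ θ, 0 ≤ w θ
  sum_eq : ∑ θ, w θ = 1

open Classical in
/-- Probability of an event under the product weight. -/
def pr {ι Θ : Type*} [Fintype ι] [Fintype Θ] (w : Θ → ℝ) (A : (ι → Θ) → Prop) : ℝ :=
  ex w (fun x => if A x then 1 else 0)

section
variable {ι Θ Θ' : Type*} [Fintype ι] [Fintype Θ] [Fintype Θ'] {w : Θ → ℝ}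

theorem ex_prod (w : Θ → ℝ) (f : ι → Θ → ℝ) :
    ex w (fun x => ∏ e, f e (x e)) = ∏ e, ∑ θ, w θ * f e θ := by
  classical
  unfold ex
  rw [Finset.prod_univ_sum, Fintype.piFinset_univ]
  refine Finset.sum_congr (by congr!) fun x _ => ?_
  rw [← Finset.prod_mul_distrib]

theorem ex_add (F G : (ι → Θ) → ℝ) : ex w (fun x => F x + G x) = ex w F + ex w G := by
  simp [ex, mul_add, Finset.sum_add_distrib]

theorem ex_mul_left (c : ℝ) (F : (ι → Θ) → ℝ) : ex w (fun x => c * F x) = c * ex w F := by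
  simp only [ex, Finset.mul_sum]
  exact Finset.sum_congr rfl fun x _ => by ring

theorem ex_sum {κ : Type*} (s : Finset κ) (F : κ → (ι → Θ) → ℝ) :
    ex w (fun x => ∑ k ∈ s, F k x) = ∑ k ∈ s, ex w (F k) := by
  simp only [ex, Finset.mul_sum]
  exact Finset.sum_comm

theorem weight_prod_nonneg (hw : IsWeight w) (x : ι → Θ) : 0 ≤ ∏ e, w (x e) :=
  Finset.prod_nonneg fun _ _ => hw.nonneg _

theorem ex_mono (hw : IsWeight w) {F G : (ι → Θ) → ℝ} (h : ∀ x, F x ≤ G x) :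
    ex w F ≤ ex w G :=
  Finset.sum_le_sum fun x _ => mul_le_mul_of_nonneg_left (h x) (weight_prod_nonneg hw x)

theorem ex_const (hw : IsWeight w) (c : ℝ) : ex (ι := ι) w (fun _ => c) = c := by
  have := ex_prod (ι := ι) w (fun _ _ => (1 : ℝ))
  simp only [Finset.prod_const_one, mul_one, hw.sum_eq] at this
  have h2 := ex_mul_left (ι := ι) (w := w) c (fun _ => 1)
  simp only [mul_one] at h2
  rw [h2, this, mul_one]

theorem ex_nonneg (hw : IsWeight w) {F : (ι → Θ) → ℝ} (h : ∀ x, 0 ≤ F x) : 0 ≤ ex w F :=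
  Finset.sum_nonneg fun x _ => mul_nonneg (weight_prod_nonneg hw x) (h x)

open Classical in
/-- Push-forward of a field of independent entries under maps acting on each entry. -/
theorem ex_push {w' : Θ' → ℝ} (f : ι → Θ → Θ')
    (hf : ∀ e θ', ∑ θ, (if f e θ = θ' then w θ else 0) = w' θ') (F : (ι → Θ') → ℝ) :
    ex w (fun x => F (fun e => f e (x e))) = ex w' F := by
  have h1 : ∀ y : ι → Θ', ex w (fun x => if (fun e => f e (x e)) = y then 1 else 0) =
      ∏ e, w' (y e) := by
    intro y
    have := ex_prod w (fun e θ => if f e θ = y e then (1 : ℝ) else 0)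
    simp only [mul_ite, mul_one, mul_zero, hf] at this
    rw [← this]
    congr 1
    funext x
    simp only [funext_iff]
    by_cases h : ∀ e, f e (x e) = y e
    · simp [h]
    · push Not at h
      obtain ⟨e, he⟩ := h
      rw [if_neg (fun h => he (h e)), Finset.prod_eq_zero (Finset.mem_univ e)]
      simp [he]
  have h2 : (fun x : ι → Θ => F (fun e => f e (x e))) =
      fun x => ∑ y : ι → Θ', F y * (if (fun e => f e (x e)) = y then 1 else 0) := by
    funext x; simp
  rw [h2, ex_sum]
  unfold ex at h1 ⊢
  refine Finset.sum_congr rfl fun y _ => ?_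
  rw [← h1 y, Finset.sum_mul]
  exact Finset.sum_congr rfl fun x _ => by ring

theorem ex_pair (w : Θ → ℝ) (w' : Θ' → ℝ) (F : (ι → Θ) → (ι → Θ') → ℝ) :
    ex w (fun x => ex w' (fun y => F x y)) =
      ex (fun θ : Θ × Θ' => w θ.1 * w' θ.2) (fun z => F (fun e => (z e).1) (fun e => (z e).2)) := by
  classical
  unfold ex
  rw [← (Equiv.arrowProdEquivProdArrow ι (fun _ => Θ) (fun _ => Θ')).symm.sum_comp,
    Fintype.sum_prod_type]
  refine Finset.sum_congr rfl fun x _ => ?_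
  rw [Finset.mul_sum]
  refine Finset.sum_congr rfl fun y _ => ?_
  simp only [Equiv.arrowProdEquivProdArrow, Equiv.coe_fn_symm_mk, Finset.prod_mul_distrib]
  ring

theorem pr_nonneg (hw : IsWeight w) (A : (ι → Θ) → Prop) : 0 ≤ pr w A :=
  ex_nonneg hw fun x => by split_ifs <;> norm_num

theorem pr_mono (hw : IsWeight w) {A B : (ι → Θ) → Prop} (h : ∀ x, A x → B x) :
    pr w A ≤ pr w B :=
  ex_mono hw fun x => by
    by_cases hA : A x
    · simp [hA, h x hA]
    · simp only [hA, if_false]; split_ifs <;> norm_num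

theorem pr_le_one (hw : IsWeight w) (A : (ι → Θ) → Prop) : pr w A ≤ 1 := by
  rw [← ex_const (ι := ι) hw 1]
  exact ex_mono hw fun x => by split_ifs <;> norm_num

theorem pr_or_le (hw : IsWeight w) (A B : (ι → Θ) → Prop) :
    pr w (fun x => A x ∨ B x) ≤ pr w A + pr w B := by
  unfold pr
  rw [← ex_add]
  refine ex_mono hw fun x => ?_
  by_cases hA : A x <;> by_cases hB : B x <;> simp [hA, hB]

theorem pr_exists_le (hw : IsWeight w) {κ : Type*} (s : Finset κ) (A : κ → (ι → Θ) → Prop) :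
    pr w (fun x => ∃ k ∈ s, A k x) ≤ ∑ k ∈ s, pr w (A k) := by
  unfold pr
  rw [← ex_sum]
  refine ex_mono hw fun x => ?_
  have h0 : ∀ k ∈ s, (0 : ℝ) ≤ @ite ℝ (A k x) (Classical.propDecidable _) 1 0 := fun k _ => by
    split_ifs <;> norm_num
  split_ifs with h
  · obtain ⟨k, hk, hkA⟩ := h
    refine le_trans ?_ (Finset.single_le_sum h0 hk)
    simp [hkA]
  · exact Finset.sum_nonneg h0

/-- Markov's inequality. -/
theorem pr_le_ex (hw : IsWeight w) {A : (ι → Θ) → Prop} {F : (ι → Θ) → ℝ} (h0 : ∀ x, 0 ≤ F x)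
    (h : ∀ x, A x → 1 ≤ F x) : pr w A ≤ ex w F :=
  ex_mono hw fun x => by
    split_ifs with hA
    · exact h x hA
    · exact h0 x

/-- Conditioning: a bound on an average of conditional probabilities. -/
theorem ex_pr_le {w' : Θ' → ℝ} (hw : IsWeight w) (hw' : IsWeight w') {G : (ι → Θ) → Prop}
    {A : (ι → Θ) → (ι → Θ') → Prop} {δ : ℝ} (hδ : 0 ≤ δ) (h : ∀ x, G x → pr w' (A x) ≤ δ) :
    ex w (fun x => pr w' (A x)) ≤ pr w (fun x => ¬ G x) + δ := by
  classical
  rw [← ex_const (ι := ι) hw δ]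
  unfold pr
  rw [← ex_add]
  refine ex_mono hw fun x => ?_
  by_cases hG : G x
  · have := h x hG
    simp only [hG, not_true_eq_false, if_false, zero_add]
    exact this
  · have := pr_le_one hw' (A x)
    simp only [hG, not_false_eq_true, if_true]
    exact this.trans (by linarith)

/-- Chernoff's bound for a linear functional of independent entries. -/
theorem pr_linear_ge_le (hw : IsWeight w) (ξ : Θ → ℝ) (c : ι → ℝ) {s K t : ℝ} (hs : 0 ≤ s)
    (hmgf : ∀ e, ∑ θ, w θ * Real.exp (s * c e * ξ θ) ≤ Real.exp (K * c e ^ 2)) :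
    pr w (fun x : ι → Θ => t ≤ ∑ e, c e * ξ (x e)) ≤
      Real.exp (K * ∑ e, c e ^ 2 - s * t) := by
  have h1 : pr w (fun x : ι → Θ => t ≤ ∑ e, c e * ξ (x e)) ≤
      ex w (fun x => Real.exp (-(s * t)) * ∏ e, Real.exp (s * c e * ξ (x e))) := by
    refine pr_le_ex hw (fun x => by positivity) fun x hx => ?_
    rw [← Real.exp_sum, ← Real.exp_add]
    refine Real.one_le_exp ?_
    have : ∑ e, s * c e * ξ (x e) = s * ∑ e, c e * ξ (x e) := by
      rw [Finset.mul_sum]; exact Finset.sum_congr rfl fun e _ => by ring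
    rw [this]
    nlinarith
  refine h1.trans ?_
  rw [ex_mul_left, ex_prod w (fun e θ => Real.exp (s * c e * ξ θ)), sub_eq_neg_add, Real.exp_add]
  refine mul_le_mul_of_nonneg_left ?_ (Real.exp_pos _).le
  rw [Finset.mul_sum, Real.exp_sum]
  exact Finset.prod_le_prod
    (fun e _ => Finset.sum_nonneg fun θ _ => mul_nonneg (hw.nonneg _) (Real.exp_pos _).le)
    fun e _ => hmgf e

end

/-! ### Moment generating functions of single entries. -/

/-- The Bernoulli weight. -/
def ber (p : ℝ) : Bool → ℝ := fun b => if b then p else 1 - p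

theorem isWeight_ber {p : ℝ} (h0 : 0 ≤ p) (h1 : p ≤ 1) : IsWeight (ber p) where
  nonneg b := by cases b <;> simp [ber, h0, h1]
  sum_eq := by simp [ber]

/-- The weight of a sparse random sign: `±1` with probability `a / 2` each. -/
def sgnW (a : ℝ) : SignType → ℝ := fun s => if s = 0 then 1 - a else a / 2

theorem sum_signType (f : SignType → ℝ) : ∑ s, f s = f 0 + f (-1) + f 1 := by
  have : (Finset.univ : Finset SignType) = {0, -1, 1} := by decide
  rw [this]
  simp
  ring

theorem isWeight_sgnW {a : ℝ} (h0 : 0 ≤ a) (h1 : a ≤ 1) : IsWeight (sgnW a) where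
  nonneg s := by unfold sgnW; split_ifs <;> linarith
  sum_eq := by rw [sum_signType]; simp [sgnW]; ring

/-- The union of independent Bernoulli sets is a Bernoulli set. -/
theorem ex_ber_union {ι : Type*} [Fintype ι] {q g g' : ℝ} (h : 1 - g' = (1 - q) * (1 - g))
    (F : (ι → Bool) → ℝ) :
    ex (ber q) (fun x => ex (ber g) (fun y => F (fun e => x e || y e))) = ex (ber g') F := by
  rw [ex_pair]
  refine ex_push (fun _ (θ : Bool × Bool) => θ.1 || θ.2) (fun e θ' => ?_) F
  have : g' = q + g - q * g := by linarith
  cases θ' <;> simp [ber, Fintype.sum_prod_type] <;> linarith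

/-- The centred and rescaled Bernoulli variable. -/
def ctr (q : ℝ) (b : Bool) : ℝ := (if b then q⁻¹ else 0) - 1

theorem exp_mul_le_chord {b ξ : ℝ} (hb : 0 < b) (h : |ξ| ≤ b) (u : ℝ) :
    Real.exp (u * ξ) ≤ (b + ξ) / (2 * b) * Real.exp (u * b) +
      (b - ξ) / (2 * b) * Real.exp (-(u * b)) := by
  obtain ⟨h1, h2⟩ := abs_le.1 h
  have e1 : 0 ≤ (b + ξ) / (2 * b) := div_nonneg (by linarith) (by linarith)
  have e2 : 0 ≤ (b - ξ) / (2 * b) := div_nonneg (by linarith) (by linarith)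
  have e3 : (b + ξ) / (2 * b) + (b - ξ) / (2 * b) = 1 := by field_simp; ring
  have := convexOn_exp.2 (Set.mem_univ (u * b)) (Set.mem_univ (-(u * b))) e1 e2 e3
  simp only [smul_eq_mul] at this
  refine le_trans (le_of_eq ?_) this
  congr 1
  field_simp
  ring

/-- Averaging the chord bound over a centred variable bounded by q⁻¹ leaves cosh(u/q). The variance
proxy q⁻² is worse than in `bernstein_mgf`, but u is unrestricted, as the net arguments require. -/
theorem hoeffding_mgf {q : ℝ} (h0 : 0 < q) (h1 : q ≤ 1) (u : ℝ) :
    ∑ b, ber q b * Real.exp (u * ctr q b) ≤ Real.exp (q⁻¹ ^ 2 * u ^ 2 / 2) := by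
  have hq : 1 ≤ q⁻¹ := (one_le_inv₀ h0).2 h1
  have hb : ∀ b, |ctr q b| ≤ q⁻¹ := fun b => by
    cases b <;> simp only [ctr] <;> rw [abs_le] <;> constructor <;> simp <;> linarith
  have hq0 : 0 < q⁻¹ := by linarith
  calc ∑ b, ber q b * Real.exp (u * ctr q b)
      ≤ ∑ b, ber q b * ((q⁻¹ + ctr q b) / (2 * q⁻¹) * Real.exp (u * q⁻¹) +
          (q⁻¹ - ctr q b) / (2 * q⁻¹) * Real.exp (-(u * q⁻¹))) :=
        Finset.sum_le_sum fun b _ => mul_le_mul_of_nonneg_left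
          (exp_mul_le_chord hq0 (hb b) u) ((isWeight_ber h0.le h1).nonneg b)
    _ = Real.cosh (u * q⁻¹) := by
        rw [Real.cosh_eq]
        simp [ber, ctr]
        field_simp
        ring
    _ ≤ _ := by
        refine (Real.cosh_le_exp_half_sq _).trans (le_of_eq ?_)
        congr 1
        ring

/-- In the range |u| ≤ q the exponent is at most 1 in absolute value, so eˣ ≤ 1 + x + x² applies,
and only the variance q⁻¹ - 1 enters. -/
theorem bernstein_mgf {q : ℝ} (h0 : 0 < q) (h1 : q ≤ 1) {u : ℝ} (hu : |u| ≤ q) :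
    ∑ b, ber q b * Real.exp (u * ctr q b) ≤ Real.exp (q⁻¹ * u ^ 2) := by
  have hq : 1 ≤ q⁻¹ := (one_le_inv₀ h0).2 h1
  have hb : ∀ b, |ctr q b| ≤ q⁻¹ := fun b => by
    cases b <;> simp only [ctr] <;> rw [abs_le] <;> constructor <;> simp <;> linarith
  have hexp : ∀ b, Real.exp (u * ctr q b) ≤ 1 + u * ctr q b + (u * ctr q b) ^ 2 := fun b => by
    have h : |u * ctr q b| ≤ 1 := by
      rw [abs_mul]
      calc |u| * |ctr q b| ≤ q * q⁻¹ :=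
            mul_le_mul hu (hb b) (abs_nonneg _) h0.le
        _ = 1 := mul_inv_cancel₀ h0.ne'
    have := (abs_le.1 (Real.abs_exp_sub_one_sub_id_le h)).2
    linarith
  calc ∑ b, ber q b * Real.exp (u * ctr q b)
      ≤ ∑ b, ber q b * (1 + u * ctr q b + (u * ctr q b) ^ 2) :=
        Finset.sum_le_sum fun b _ => mul_le_mul_of_nonneg_left
          (hexp b) ((isWeight_ber h0.le h1).nonneg b)
    _ = 1 + (q⁻¹ - 1) * u ^ 2 := by
        simp [ber, ctr]
        field_simp
        ring
    _ ≤ q⁻¹ * u ^ 2 + 1 := by nlinarith [sq_nonneg u]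
    _ ≤ _ := Real.add_one_le_exp _

theorem sum_sgnW_exp (a u : ℝ) :
    ∑ s, sgnW a s * Real.exp (u * (s : ℝ)) = 1 + a * (Real.cosh u - 1) := by
  rw [sum_signType, Real.cosh_eq]
  simp [sgnW]
  ring

theorem cosh_sub_one_le (u : ℝ) : Real.cosh u - 1 ≤ u ^ 2 * Real.exp |u| := by
  have h1 := Real.cosh_le_exp_half_sq u
  have h2 : Real.cosh u = 1 + 2 * Real.sinh (u / 2) ^ 2 := by
    have := Real.cosh_two_mul (u / 2)
    rw [mul_div_cancel₀ u two_ne_zero, Real.cosh_sq] at this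
    linarith
  have h3 : |Real.sinh (u / 2)| ≤ |u / 2| * Real.exp |u / 2| := by
    rw [Real.abs_sinh]
    set v := |u / 2|
    have hv : 0 ≤ v := abs_nonneg _
    have e1 := Real.add_one_le_exp (-(2 * v))
    have e2 : Real.exp (-v) = Real.exp v * Real.exp (-(2 * v)) := by
      rw [← Real.exp_add]; congr 1; ring
    rw [Real.sinh_eq, e2]
    nlinarith [Real.exp_pos v]
  have h4 : Real.sinh (u / 2) ^ 2 ≤ (|u / 2| * Real.exp |u / 2|) ^ 2 := by
    rw [← sq_abs (Real.sinh _)]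
    exact pow_le_pow_left₀ (abs_nonneg _) h3 2
  have h5 : (|u / 2| * Real.exp |u / 2|) ^ 2 = u ^ 2 / 4 * Real.exp |u| := by
    rw [mul_pow, sq_abs, ← Real.exp_nat_mul, abs_div]
    norm_num
    ring_nf
  nlinarith [mul_nonneg (sq_nonneg u) (Real.exp_pos |u|).le]

/-- A sufficiently sparse sign has any prescribed sub-Gaussian parameter κ. For |u| ≤ 1/κ the factor
a compensates e^|u|; for larger u the trivial bound cosh u ≤ e^|u| ≤ e^(κu²) suffices, whatever a
is. -/
theorem sparse_sign_mgf {a κ : ℝ} (hκ : 0 < κ) (h1 : a ≤ 1)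
    (ha : a ≤ κ * Real.exp (-(1 / κ))) (u : ℝ) :
    ∑ s, sgnW a s * Real.exp (u * (s : ℝ)) ≤ Real.exp (κ * u ^ 2) := by
  rw [sum_sgnW_exp]
  have hc := Real.one_le_cosh u
  rcases le_total |u| (1 / κ) with hu | hu
  · refine le_trans ?_ (Real.add_one_le_exp _)
    have h2 : a * (Real.cosh u - 1) ≤ κ * Real.exp (-(1 / κ)) * (u ^ 2 * Real.exp (1 / κ)) :=
      mul_le_mul ha ((cosh_sub_one_le u).trans (by gcongr)) (by linarith) (by positivity)
    have h3 : Real.exp (-(1 / κ)) * Real.exp (1 / κ) = 1 := by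
      rw [← Real.exp_add]; simp
    have h4 : κ * Real.exp (-(1 / κ)) * (u ^ 2 * Real.exp (1 / κ)) = κ * u ^ 2 := by
      linear_combination (κ * u ^ 2) * h3
    linarith
  · have h2 : 1 + a * (Real.cosh u - 1) ≤ Real.cosh u := by nlinarith
    have h3 : Real.cosh u ≤ Real.exp |u| := by
      rw [← Real.cosh_abs, Real.cosh_eq]
      have : Real.exp (-|u|) ≤ Real.exp |u| := Real.exp_le_exp.2 (by linarith [abs_nonneg u])
      linarith
    refine (h2.trans h3).trans (Real.exp_le_exp.2 ?_)
    have h4 : 1 ≤ κ * |u| := by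
      rw [div_le_iff₀ hκ] at hu
      linarith
    rw [← sq_abs u]
    nlinarith [abs_nonneg u]

theorem sign_mgf {a : ℝ} (h1 : a ≤ 1) (u : ℝ) :
    ∑ s, sgnW a s * Real.exp (u * (s : ℝ)) ≤ Real.exp (u ^ 2 / 2) := by
  rw [sum_sgnW_exp]
  have hc := Real.one_le_cosh u
  have h2 : 1 + a * (Real.cosh u - 1) ≤ Real.cosh u := by nlinarith
  exact h2.trans (Real.cosh_le_exp_half_sq u)

end

end RobustPCA

/-! ### Trace exponentials of symmetric matrices. -/

namespace RobustPCA
noncomputable section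
open Matrix
set_option linter.unusedSectionVars false
section
variable {ι : Type*} [Fintype ι] [DecidableEq ι] {A B : Matrix ι ι ℝ}

/-- The eigenvectors of a symmetric matrix as plain functions. -/
def eigv (hA : A.IsHermitian) (k : ι) : ι → ℝ := ⇑(hA.eigenvectorBasis k)

theorem mulVec_eigv (hA : A.IsHermitian) (k : ι) :
    A *ᵥ eigv hA k = hA.eigenvalues k • eigv hA k := hA.mulVec_eigenvectorBasis k

theorem eigv_dot_eigv (hA : A.IsHermitian) (k : ι) : eigv hA k ⬝ᵥ eigv hA k = 1 := by
  have h := hA.eigenvectorBasis.orthonormal.1 k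
  have h2 : inner ℝ (hA.eigenvectorBasis k) (hA.eigenvectorBasis k) = 1 := by
    rw [real_inner_self_eq_norm_sq, h]; norm_num
  rw [EuclideanSpace.inner_eq_star_dotProduct] at h2
  simpa [eigv] using h2

/-- Parseval's identity in an eigenbasis. -/
theorem dot_eq_sum_eigv (hA : A.IsHermitian) (x y : ι → ℝ) :
    x ⬝ᵥ y = ∑ k, (eigv hA k ⬝ᵥ x) * (eigv hA k ⬝ᵥ y) := by
  have h := hA.eigenvectorBasis.sum_inner_mul_inner (WithLp.toLp 2 x) (WithLp.toLp 2 y)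
  simp only [EuclideanSpace.inner_eq_star_dotProduct] at h
  rw [dotProduct_comm]
  simp only [star_trivial] at h
  rw [← h]
  refine Finset.sum_congr rfl fun k _ => ?_
  rw [dotProduct_comm y]
  rfl

theorem dot_mulVec_comm (hA : A.IsHermitian) (x y : ι → ℝ) : x ⬝ᵥ A *ᵥ y = (A *ᵥ x) ⬝ᵥ y := by
  have : Aᵀ = A := by simpa [conjTranspose_eq_transpose_of_trivial] using hA.eq
  rw [dotProduct_mulVec, ← mulVec_transpose, this]

/-- `trE hA θ C` is the trace of `C * exp (θ A)`. -/
def trE (hA : A.IsHermitian) (θ : ℝ) (C : Matrix ι ι ℝ) : ℝ :=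
  ∑ k, Real.exp (θ * hA.eigenvalues k) * (eigv hA k ⬝ᵥ C *ᵥ eigv hA k)

/-- The trapezoidal rule overestimates the integral of the convex function exp. In derivative form
this is 1 - x ≤ e^(-x). -/
theorem exp_sub_one_le_trapezoid {y : ℝ} (hy : 0 ≤ y) :
    Real.exp y - 1 ≤ y / 2 * (Real.exp y + 1) := by
  have hd : ∀ x : ℝ, HasDerivAt (fun y => y / 2 * (Real.exp y + 1) - Real.exp y)
      (1 / 2 * (Real.exp x + 1) + x / 2 * Real.exp x - Real.exp x) x := fun x =>
    (((hasDerivAt_id x).div_const 2).mul ((Real.hasDerivAt_exp x).add_const 1)).sub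
      (Real.hasDerivAt_exp x)
  have hm : MonotoneOn (fun y => y / 2 * (Real.exp y + 1) - Real.exp y) (Set.Ici 0) := by
    refine monotoneOn_of_deriv_nonneg (convex_Ici 0)
      (fun x _ => (hd x).continuousAt.continuousWithinAt)
      (fun x _ => (hd x).differentiableAt.differentiableWithinAt) fun x _ => ?_
    rw [(hd x).deriv]
    have h1 := Real.add_one_le_exp (-x)
    have h2 : Real.exp (-x) * Real.exp x = 1 := by rw [← Real.exp_add]; simp
    nlinarith [Real.exp_pos x]
  have := hm (Set.mem_Ici.2 le_rfl) (Set.mem_Ici.2 hy) hy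
  simp at this
  linarith

theorem mul_exp_sub_exp_le {θ : ℝ} (hθ : 0 ≤ θ) (a b : ℝ) :
    (a - b) * (Real.exp (θ * a) - Real.exp (θ * b)) ≤
      θ / 2 * ((a - b) ^ 2 * (Real.exp (θ * a) + Real.exp (θ * b))) := by
  wlog h : b ≤ a generalizing a b with H
  · have := H b a (le_of_not_ge h)
    nlinarith
  have h1 := exp_sub_one_le_trapezoid (y := θ * (a - b)) (mul_nonneg hθ (by linarith))
  have h2 : Real.exp (θ * a) = Real.exp (θ * b) * Real.exp (θ * (a - b)) := by
    rw [← Real.exp_add]; congr 1; ring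
  rw [h2]
  have h3 := mul_le_mul_of_nonneg_left h1
    (mul_nonneg (sub_nonneg.2 h) (Real.exp_pos (θ * b)).le)
  linarith

theorem eigv_dot_sub_mulVec_eigv (hA : A.IsHermitian) (hB : B.IsHermitian) (k j : ι) :
    eigv hB j ⬝ᵥ (A - B) *ᵥ eigv hA k =
      (hA.eigenvalues k - hB.eigenvalues j) * (eigv hB j ⬝ᵥ eigv hA k) := by
  rw [sub_mulVec, dotProduct_sub, mulVec_eigv, dot_mulVec_comm hB, mulVec_eigv, dotProduct_smul,
    smul_dotProduct, smul_eq_mul, smul_eq_mul]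
  ring

/-- The mean value trace inequality. -/
theorem trE_sub_le (hA : A.IsHermitian) (hB : B.IsHermitian) {θ : ℝ} (hθ : 0 ≤ θ) :
    trE hA θ (A - B) - trE hB θ (A - B) ≤
      θ / 2 * (trE hA θ ((A - B) * (A - B)) + trE hB θ ((A - B) * (A - B))) := by
  have hAB : (A - B).IsHermitian := hA.sub hB
  -- Squared overlaps of the two eigenbases. All four traces become sums over pairs (k, j) with
  -- these common nonnegative weights, so that only the scalar inequality `mul_exp_sub_exp_le` is
  -- left.
  set c : ι → ι → ℝ := fun k j => (eigv hB j ⬝ᵥ eigv hA k) ^ 2 with hc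
  set a := hA.eigenvalues
  set b := hB.eigenvalues
  have h2 : ∀ k j, eigv hA k ⬝ᵥ (A - B) *ᵥ eigv hB j =
      (a k - b j) * (eigv hB j ⬝ᵥ eigv hA k) := fun k j => by
    rw [dot_mulVec_comm hAB, dotProduct_comm]
    exact eigv_dot_sub_mulVec_eigv hA hB k j
  have e1 : ∀ k, eigv hA k ⬝ᵥ (A - B) *ᵥ eigv hA k = ∑ j, c k j * (a k - b j) := fun k => by
    rw [dot_eq_sum_eigv hB]
    refine Finset.sum_congr rfl fun j _ => ?_
    rw [eigv_dot_sub_mulVec_eigv hA hB]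
    simp only [hc, a, b]; ring
  have e2 : ∀ j, eigv hB j ⬝ᵥ (A - B) *ᵥ eigv hB j = ∑ k, c k j * (a k - b j) := fun j => by
    rw [dot_eq_sum_eigv hA]
    refine Finset.sum_congr rfl fun k _ => ?_
    rw [h2, dotProduct_comm (eigv hA k)]
    simp only [hc]; ring
  have e3 : ∀ k, eigv hA k ⬝ᵥ ((A - B) * (A - B)) *ᵥ eigv hA k =
      ∑ j, c k j * (a k - b j) ^ 2 := fun k => by
    rw [← mulVec_mulVec, dot_mulVec_comm hAB, dot_eq_sum_eigv hB]
    refine Finset.sum_congr rfl fun j _ => ?_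
    rw [eigv_dot_sub_mulVec_eigv hA hB]
    simp only [hc, a, b]; ring
  have e4 : ∀ j, eigv hB j ⬝ᵥ ((A - B) * (A - B)) *ᵥ eigv hB j =
      ∑ k, c k j * (a k - b j) ^ 2 := fun j => by
    rw [← mulVec_mulVec, dot_mulVec_comm hAB, dot_eq_sum_eigv hA]
    refine Finset.sum_congr rfl fun k _ => ?_
    rw [h2]
    simp only [hc]; ring
  unfold trE
  simp only [e1, e2, e3, e4, Finset.mul_sum]
  rw [Finset.sum_comm (s := Finset.univ) (f := fun j k => Real.exp (θ * b j) * (c k j * (a k - b j))),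
    Finset.sum_comm (s := Finset.univ)
      (f := fun j k => Real.exp (θ * b j) * (c k j * (a k - b j) ^ 2)),
    ← Finset.sum_sub_distrib, ← Finset.sum_add_distrib, Finset.mul_sum]
  refine Finset.sum_le_sum fun k _ => ?_
  rw [← Finset.sum_sub_distrib, ← Finset.sum_add_distrib, Finset.mul_sum]
  refine Finset.sum_le_sum fun j _ => ?_
  have := mul_le_mul_of_nonneg_left (mul_exp_sub_exp_le hθ (a k) (b j)) (sq_nonneg
    (eigv hB j ⬝ᵥ eigv hA k))
  simp only [hc]
  linarith

theorem trE_self (hA : A.IsHermitian) (θ : ℝ) :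
    trE hA θ A = ∑ k, hA.eigenvalues k * Real.exp (θ * hA.eigenvalues k) := by
  unfold trE
  refine Finset.sum_congr rfl fun k _ => ?_
  rw [mulVec_eigv, dotProduct_smul, eigv_dot_eigv, smul_eq_mul]
  ring

theorem trE_add (hA : A.IsHermitian) (θ : ℝ) (C D : Matrix ι ι ℝ) :
    trE hA θ (C + D) = trE hA θ C + trE hA θ D := by
  simp [trE, add_mulVec, dotProduct_add, mul_add, Finset.sum_add_distrib]

theorem trE_smul (hA : A.IsHermitian) (θ c : ℝ) (C : Matrix ι ι ℝ) :
    trE hA θ (c • C) = c * trE hA θ C := by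
  simp only [trE, smul_mulVec, dotProduct_smul, smul_eq_mul, Finset.mul_sum]
  exact Finset.sum_congr rfl fun k _ => by ring

theorem trE_sum (hA : A.IsHermitian) (θ : ℝ) (C : ι → Matrix ι ι ℝ) :
    trE hA θ (∑ i, C i) = ∑ i, trE hA θ (C i) := by
  simp only [trE, sum_mulVec, dotProduct_sum, Finset.mul_sum]
  exact Finset.sum_comm

theorem trE_vecMulVec_nonneg (hA : A.IsHermitian) (θ : ℝ) (v : ι → ℝ) :
    0 ≤ trE hA θ (vecMulVec v v) := by
  refine Finset.sum_nonneg fun k _ => mul_nonneg (Real.exp_pos _).le ?_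
  rw [vecMulVec_mulVec, op_smul_eq_smul, dotProduct_smul, smul_eq_mul]
  rw [dotProduct_comm]
  exact mul_self_nonneg _

/-- The trace of `exp (θ A)`. -/
def trExp (hA : A.IsHermitian) (θ : ℝ) : ℝ := ∑ k, Real.exp (θ * hA.eigenvalues k)

theorem trE_le_trExp (hA : A.IsHermitian) (θ : ℝ) {C : Matrix ι ι ℝ}
    (hC : ∀ y, y ⬝ᵥ C *ᵥ y ≤ y ⬝ᵥ y) : trE hA θ C ≤ trExp hA θ := by
  refine Finset.sum_le_sum fun k _ => ?_
  have := hC (eigv hA k)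
  rw [eigv_dot_eigv] at this
  nlinarith [Real.exp_pos (θ * hA.eigenvalues k)]

theorem hasDerivAt_trExp (hA : A.IsHermitian) (θ : ℝ) :
    HasDerivAt (fun θ => trExp hA θ) (trE hA θ A) θ := by
  rw [trE_self]
  unfold trExp
  refine HasDerivAt.fun_sum fun k _ => ?_
  have := ((hasDerivAt_id θ).mul_const (hA.eigenvalues k)).exp
  simpa [mul_comm] using this

/-- The Rayleigh quotient is an average of eigenvalues, so one of them reaches t, and its
exponential is one term of the trace. -/
theorem exp_le_trExp (hA : A.IsHermitian) {θ t : ℝ} (hθ : 0 ≤ θ) {y : ι → ℝ}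
    (hy : t * (y ⬝ᵥ y) < y ⬝ᵥ A *ᵥ y) : Real.exp (θ * t) ≤ trExp hA θ := by
  have h1 : y ⬝ᵥ A *ᵥ y = ∑ k, hA.eigenvalues k * (eigv hA k ⬝ᵥ y) ^ 2 := by
    rw [dot_eq_sum_eigv hA]
    refine Finset.sum_congr rfl fun k _ => ?_
    rw [dot_mulVec_comm hA, mulVec_eigv, smul_dotProduct, smul_eq_mul]
    ring
  have h2 : t * (y ⬝ᵥ y) = ∑ k, t * (eigv hA k ⬝ᵥ y) ^ 2 := by
    rw [dot_eq_sum_eigv hA, Finset.mul_sum]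
    exact Finset.sum_congr rfl fun k _ => by ring
  rw [h1, h2] at hy
  obtain ⟨k, -, hk⟩ := Finset.exists_lt_of_sum_lt hy
  have hk' : t ≤ hA.eigenvalues k := by
    by_contra hcon
    nlinarith [sq_nonneg (eigv hA k ⬝ᵥ y)]
  refine le_trans (Real.exp_le_exp.2 (mul_le_mul_of_nonneg_left hk' hθ)) ?_
  exact Finset.single_le_sum (f := fun k => Real.exp (θ * hA.eigenvalues k))
    (fun _ _ => (Real.exp_pos _).le) (Finset.mem_univ k)
end

/-! ### Concentration of a compressed random diagonal matrix by resampling entries. -/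

section
variable {ι Θ : Type*} [Fintype ι] [DecidableEq ι] [Fintype Θ] {w : Θ → ℝ}

theorem ex_coord (hw : IsWeight w) (i : ι) (G : Θ → ℝ) :
    ex w (fun y : ι → Θ => G (y i)) = ∑ θ, w θ * G θ := by
  have h := ex_prod w (fun e θ => if e = i then G θ else 1)
  have h1 : ∀ y : ι → Θ, (∏ e, if e = i then G (y e) else 1) = G (y i) := fun y => by
    simp [Finset.prod_ite_eq']
  simp only [h1] at h
  rw [h, Finset.prod_eq_single i]
  · simp
  · intro b _ hb
    simp [hb, hw.sum_eq]
  · simp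

/-- Resampling one entry. -/
theorem ex_resample (hw : IsWeight w) (i : ι) (F : (ι → Θ) → ℝ) :
    ex w F = ex w (fun x => ∑ θ, w θ * F (Function.update x i θ)) := by
  have h1 : ∀ x : ι → Θ, ∑ θ, w θ * F (Function.update x i θ) =
      ex w (fun y : ι → Θ => F (Function.update x i (y i))) := fun x => by
    rw [ex_coord hw i (fun θ => F (Function.update x i θ))]
  simp only [h1]
  rw [ex_pair]
  symm
  -- Over a pair of independent fields, taking entry i from the second one and the rest from the
  -- first acts entry by entry and has the original law.
  have h2 : ∀ z : ι → Θ × Θ, Function.update (fun e => (z e).1) i (z i).2 =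
      fun e => if e = i then (z e).2 else (z e).1 := fun z => by
    funext e
    by_cases h : e = i
    · subst h; simp
    · simp [h]
  simp only [h2]
  refine ex_push (w := fun θ : Θ × Θ => w θ.1 * w θ.2) (w' := w)
    (fun e θ => if e = i then θ.2 else θ.1) (fun e θ' => ?_) F
  classical
  rw [Fintype.sum_prod_type]
  by_cases h : e = i
  · simp only [h, if_true]
    simp [← Finset.sum_mul, hw.sum_eq]
  · simp only [h, if_false]
    rw [Finset.sum_comm]
    simp [← Finset.mul_sum, hw.sum_eq]
end

section
variable {ι : Type*} [Fintype ι] [DecidableEq ι]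

/-- A symmetric idempotent matrix, that is, an orthogonal projection, whose diagonal entries are at
most `ℓ`. -/
structure IsProj (P : Matrix ι ι ℝ) (ℓ : ℝ) : Prop where
  symm : Pᵀ = P
  idem : P * P = P
  diag_le : ∀ e, P e e ≤ ℓ

/-- The indicator of a random set. -/
def ind (b : Bool) : ℝ := if b then 1 else 0

/-- The centred compression of a random diagonal matrix. -/
def cmp (P : Matrix ι ι ℝ) (g : ℝ) (x : ι → Bool) : Matrix ι ι ℝ :=
  P * diagonal (fun e => g - ind (x e)) * P

variable {P : Matrix ι ι ℝ} {ℓ : ℝ}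

theorem IsProj.apply_comm (hP : IsProj P ℓ) (e f : ι) : P e f = P f e := by
  conv_lhs => rw [← hP.symm]
  rfl

theorem IsProj.dot_row (hP : IsProj P ℓ) (e f : ι) : P e ⬝ᵥ P f = P e f := by
  conv_rhs => rw [← hP.idem]
  rw [mul_apply]
  exact Finset.sum_congr rfl fun k _ => by rw [hP.apply_comm f k]

theorem IsProj.dot_mulVec (hP : IsProj P ℓ) (x y : ι → ℝ) : x ⬝ᵥ P *ᵥ y = (P *ᵥ x) ⬝ᵥ y := by
  rw [dotProduct_mulVec, ← mulVec_transpose, hP.symm]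

theorem IsProj.mulVec_mulVec_self (hP : IsProj P ℓ) (x : ι → ℝ) : P *ᵥ (P *ᵥ x) = P *ᵥ x := by
  rw [mulVec_mulVec, hP.idem]

theorem dot_self_nonneg {κ : Type*} [Fintype κ] (x : κ → ℝ) : 0 ≤ x ⬝ᵥ x :=
  Finset.sum_nonneg fun _ _ => mul_self_nonneg _

theorem IsProj.dot_mulVec_le (hP : IsProj P ℓ) (y : ι → ℝ) : y ⬝ᵥ P *ᵥ y ≤ y ⬝ᵥ y := by
  have h := dot_self_nonneg (y - P *ᵥ y)
  have h2 : (P *ᵥ y) ⬝ᵥ (P *ᵥ y) = y ⬝ᵥ P *ᵥ y := by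
    rw [← hP.dot_mulVec, hP.mulVec_mulVec_self]
  rw [sub_dotProduct, dotProduct_sub, dotProduct_sub, h2, ← hP.dot_mulVec] at h
  linarith

theorem IsProj.isHermitian_cmp (hP : IsProj P ℓ) (g : ℝ) (x : ι → Bool) :
    (cmp P g x).IsHermitian := by
  unfold cmp
  rw [IsHermitian, conjTranspose_eq_transpose_of_trivial, transpose_mul, transpose_mul,
    diagonal_transpose, hP.symm, mul_assoc]

theorem IsProj.mul_diagonal_mul (hP : IsProj P ℓ) (d : ι → ℝ) :
    P * diagonal d * P = ∑ i, d i • vecMulVec (P i) (P i) := by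
  ext a b
  rw [mul_apply, Matrix.sum_apply]
  refine Finset.sum_congr rfl fun i _ => ?_
  rw [mul_diagonal, Matrix.smul_apply, vecMulVec_apply, smul_eq_mul, hP.apply_comm a i]
  ring

theorem IsProj.sum_vecMulVec (hP : IsProj P ℓ) : ∑ i, vecMulVec (P i) (P i) = P := by
  have := hP.mul_diagonal_mul (fun _ => 1)
  simp only [one_smul, diagonal_one, mul_one, hP.idem] at this
  exact this.symm

theorem IsProj.cmp_update_sub (hP : IsProj P ℓ) (g : ℝ) (x : ι → Bool) (i : ι) :
    cmp P g (Function.update x i false) - cmp P g (Function.update x i true) =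
      vecMulVec (P i) (P i) := by
  unfold cmp
  rw [hP.mul_diagonal_mul, hP.mul_diagonal_mul, ← Finset.sum_sub_distrib, Finset.sum_eq_single i]
  · simp [← sub_smul, ind]
  · intro b _ hb
    simp [hb]
  · simp

/-- Averaging over entry i turns the left side into g(1 - g) times a difference of traces for two
matrices that differ by the rank one matrix vvᵀ, v = P i. The mean value trace inequality bounds it
by a sum of traces, since (vvᵀ)² = P i i • vvᵀ with P i i ≤ ℓ. That sum is again an average over
entry i, with the weight g + ind (x i) (1 - 2g). -/
theorem IsProj.resample_le (hP : IsProj P ℓ) {g θ : ℝ} (hg0 : 0 ≤ g) (hg1 : g ≤ 1) (hθ : 0 ≤ θ)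
    (i : ι) :
    ex (ber g) (fun x => (g - ind (x i)) *
        trE (hP.isHermitian_cmp g x) θ (vecMulVec (P i) (P i))) ≤
      θ * ℓ / 2 * ex (ber g) (fun x => (g + ind (x i) * (1 - 2 * g)) *
        trE (hP.isHermitian_cmp g x) θ (vecMulVec (P i) (P i))) := by
  have hw := isWeight_ber hg0 hg1
  rw [ex_resample hw i, ex_resample hw i (F := fun x => (g + ind (x i) * (1 - 2 * g)) * _),
    ← ex_mul_left]
  refine ex_mono hw fun x => ?_
  have hA := hP.isHermitian_cmp g (Function.update x i false)
  have hB := hP.isHermitian_cmp g (Function.update x i true)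
  have h := trE_sub_le hA hB hθ
  have hsq : vecMulVec (P i) (P i) * vecMulVec (P i) (P i) = P i i • vecMulVec (P i) (P i) := by
    rw [vecMulVec_mul_vecMulVec, hP.dot_row]
    ext; simp [vecMulVec_apply]; ring
  rw [hP.cmp_update_sub, hsq, trE_smul, trE_smul] at h
  have ha := trE_vecMulVec_nonneg hA θ (P i)
  have hb := trE_vecMulVec_nonneg hB θ (P i)
  simp only [Fintype.sum_bool, ber, Function.update_self, ind, if_true, if_false,
    Bool.false_eq_true]
  set α := trE hA θ (vecMulVec (P i) (P i))
  set β := trE hB θ (vecMulVec (P i) (P i))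
  have h2 : θ / 2 * (P i i * α + P i i * β) ≤ θ / 2 * (ℓ * (α + β)) := by
    rw [← mul_add]
    exact mul_le_mul_of_nonneg_left
      (mul_le_mul_of_nonneg_right (hP.diag_le i) (by linarith)) (by linarith)
  have h3 := mul_le_mul_of_nonneg_left (h.trans h2) (mul_nonneg hg0 (sub_nonneg.2 hg1))
  change g * ((g - 1) * β) + (1 - g) * ((g - 0) * α) ≤
    θ * ℓ / 2 * (g * ((g + 1 * (1 - 2 * g)) * β) + (1 - g) * ((g + 0 * (1 - 2 * g)) * α))
  nlinarith

/-- Summing `IsProj.resample_le` over all entries, the right side involves 2g(1 - g) P minus (1 -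
2g) times the compression itself. For g ≤ 1/2 the latter may be dropped unless the left side is
already nonpositive. -/
theorem IsProj.ex_trE_le (hP : IsProj P ℓ) (hℓ : 0 ≤ ℓ) {g θ : ℝ} (hg0 : 0 ≤ g) (hg1 : g ≤ 1 / 2)
    (hθ : 0 ≤ θ) :
    ex (ber g) (fun x => trE (hP.isHermitian_cmp g x) θ (cmp P g x)) ≤
      θ * ℓ * g * ex (ber g) (fun x => trExp (hP.isHermitian_cmp g x) θ) := by
  have hw := isWeight_ber hg0 (by linarith : g ≤ 1)
  set D := ex (ber g) (fun x => trE (hP.isHermitian_cmp g x) θ (cmp P g x)) with hD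
  set M := ex (ber g) (fun x => trExp (hP.isHermitian_cmp g x) θ)
  have h1 : D = ∑ i, ex (ber g) (fun x => (g - ind (x i)) *
      trE (hP.isHermitian_cmp g x) θ (vecMulVec (P i) (P i))) := by
    rw [hD, ← ex_sum]
    congr 1
    funext x
    refine (congrArg (trE (hP.isHermitian_cmp g x) θ) (hP.mul_diagonal_mul _)).trans ?_
    rw [trE_sum]
    simp only [trE_smul]
  have h2 : ∀ x, ∑ i, (g + ind (x i) * (1 - 2 * g)) *
      trE (hP.isHermitian_cmp g x) θ (vecMulVec (P i) (P i)) =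
      2 * g * (1 - g) * trE (hP.isHermitian_cmp g x) θ P +
        (-(1 - 2 * g)) * trE (hP.isHermitian_cmp g x) θ (cmp P g x) := fun x => by
    simp only [← trE_smul]
    rw [← trE_sum, ← trE_add]
    congr 1
    have : cmp P g x = ∑ i, (g - ind (x i)) • vecMulVec (P i) (P i) := hP.mul_diagonal_mul _
    conv_rhs => rw [this, ← hP.sum_vecMulVec, Finset.smul_sum, Finset.smul_sum,
      ← Finset.sum_add_distrib]
    refine Finset.sum_congr rfl fun i _ => ?_
    rw [smul_smul, hP.sum_vecMulVec, ← add_smul]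
    congr 1
    ring
  have h3 : D ≤ θ * ℓ / 2 * (2 * g * (1 - g) *
      ex (ber g) (fun x => trE (hP.isHermitian_cmp g x) θ P) + (-(1 - 2 * g)) * D) := by
    rw [hD, ← ex_mul_left, ← ex_mul_left, ← ex_add]
    simp only [← h2]
    rw [ex_sum, Finset.mul_sum, ← hD, h1]
    exact Finset.sum_le_sum fun i _ => hP.resample_le hg0 (by linarith) hθ i
  have h4 : ex (ber g) (fun x => trE (hP.isHermitian_cmp g x) θ P) ≤ M :=
    ex_mono hw fun x => trE_le_trExp _ θ hP.dot_mulVec_le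
  have hM : 0 ≤ M := ex_nonneg hw fun x => Finset.sum_nonneg fun k _ => (Real.exp_pos _).le
  have hθℓ : 0 ≤ θ * ℓ := mul_nonneg hθ hℓ
  have h5 : θ * ℓ * (g * (1 - g)) * ex (ber g) (fun x => trE (hP.isHermitian_cmp g x) θ P) ≤
      θ * ℓ * g * M := by
    calc _ ≤ θ * ℓ * (g * (1 - g)) * M := mul_le_mul_of_nonneg_left h4
          (mul_nonneg hθℓ (mul_nonneg hg0 (by linarith)))
      _ ≤ θ * ℓ * (g * 1) * M := by
          gcongr
          linarith
      _ = _ := by ring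
  rcases le_total D 0 with hD0 | hD0
  · exact hD0.trans (by positivity)
  · have : 0 ≤ θ * ℓ * (1 - 2 * g) * D := mul_nonneg (mul_nonneg hθℓ (by linarith)) hD0
    nlinarith

/-- Grönwall: the expected trace exponential m satisfies m' ≤ θℓg m by `IsProj.ex_trE_le`, and m(0)
is the dimension. -/
theorem IsProj.ex_trExp_le (hP : IsProj P ℓ) (hℓ : 0 ≤ ℓ) {g θ : ℝ} (hg0 : 0 ≤ g)
    (hg1 : g ≤ 1 / 2) (hθ : 0 ≤ θ) :
    ex (ber g) (fun x => trExp (hP.isHermitian_cmp g x) θ) ≤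
      Fintype.card ι * Real.exp (θ ^ 2 * ℓ * g / 2) := by
  have hw := isWeight_ber hg0 (by linarith : g ≤ 1)
  set m : ℝ → ℝ := fun θ => ex (ber g) (fun x => trExp (hP.isHermitian_cmp g x) θ) with hm
  have hd : ∀ θ, HasDerivAt m
      (ex (ber g) (fun x => trE (hP.isHermitian_cmp g x) θ (cmp P g x))) θ := fun θ => by
    unfold m ex
    exact HasDerivAt.fun_sum fun x _ => (hasDerivAt_trExp _ θ).const_mul _
  have he : ∀ θ : ℝ, HasDerivAt (fun θ => Real.exp (-(θ ^ 2 * (ℓ * g / 2))))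
      (Real.exp (-(θ ^ 2 * (ℓ * g / 2))) * (-(2 * θ * (ℓ * g / 2)))) θ := fun θ => by
    have := (((hasDerivAt_pow 2 θ).mul_const (ℓ * g / 2)).neg).exp
    simpa using this
  have hanti : AntitoneOn (fun θ => m θ * Real.exp (-(θ ^ 2 * (ℓ * g / 2)))) (Set.Ici 0) := by
    refine antitoneOn_of_deriv_nonpos (convex_Ici 0)
      (fun x _ => ((hd x).fun_mul (he x)).continuousAt.continuousWithinAt)
      (fun x _ => ((hd x).fun_mul (he x)).differentiableAt.differentiableWithinAt) fun x hx => ?_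
    rw [((hd x).fun_mul (he x)).deriv]
    rw [interior_Ici, Set.mem_Ioi] at hx
    have := hP.ex_trE_le hℓ hg0 hg1 hx.le
    have h2 := mul_le_mul_of_nonneg_right this (Real.exp_pos (-(x ^ 2 * (ℓ * g / 2)))).le
    change _ ≤ x * ℓ * g * m x * _ at h2
    linarith
  have h := hanti (Set.mem_Ici.2 le_rfl) (Set.mem_Ici.2 hθ) hθ
  have h0 : m 0 = Fintype.card ι := by
    simp only [hm, trExp, zero_mul, Real.exp_zero, Finset.sum_const, Finset.card_univ,
      nsmul_eq_mul, mul_one]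
    exact ex_const hw _
  simp only [h0] at h
  norm_num at h
  rw [Real.exp_neg, ← div_eq_mul_inv, div_le_iff₀ (Real.exp_pos _)] at h
  refine h.trans (le_of_eq ?_)
  congr 2
  ring

/-- A Bernoulli set is, with high probability, injective on the range of an incoherent projection,
with a quantitative lower bound. -/
theorem IsProj.pr_lower_le (hP : IsProj P ℓ) (hℓ : 0 < ℓ) {g : ℝ} (hg0 : 0 ≤ g)
    (hg1 : g ≤ 1 / 2) :
    pr (ber g) (fun x => ∃ y : ι → ℝ, P *ᵥ y = y ∧
      ∑ e, ind (x e) * y e ^ 2 < g / 2 * ∑ e, y e ^ 2) ≤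
      Fintype.card ι * Real.exp (-(g / (8 * ℓ))) := by
  have hw := isWeight_ber hg0 (by linarith : g ≤ 1)
  -- The minimizer of θ²ℓg/2 - θg/2.
  set θ : ℝ := 1 / (2 * ℓ) with hθ
  have hθ0 : 0 ≤ θ := by positivity
  have h1 : pr (ber g) (fun x => ∃ y : ι → ℝ, P *ᵥ y = y ∧
      ∑ e, ind (x e) * y e ^ 2 < g / 2 * ∑ e, y e ^ 2) ≤
      ex (ber g) (fun x => Real.exp (-(θ * (g / 2))) * trExp (hP.isHermitian_cmp g x) θ) := by
    refine pr_le_ex hw (fun x => mul_nonneg (Real.exp_pos _).le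
      (Finset.sum_nonneg fun k _ => (Real.exp_pos _).le)) fun x hx => ?_
    obtain ⟨y, hy, hlt⟩ := hx
    have hc : y ⬝ᵥ cmp P g x *ᵥ y = ∑ e, (g - ind (x e)) * y e ^ 2 := by
      unfold cmp
      rw [← mulVec_mulVec, ← mulVec_mulVec, hP.dot_mulVec, hy, dotProduct]
      refine Finset.sum_congr rfl fun e _ => ?_
      rw [mulVec_diagonal]; ring
    have hyy : y ⬝ᵥ y = ∑ e, y e ^ 2 := Finset.sum_congr rfl fun e _ => by ring
    have := exp_le_trExp (hP.isHermitian_cmp g x) (t := g / 2) hθ0 (y := y) (by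
      rw [hc, hyy]
      simp only [sub_mul, Finset.sum_sub_distrib, ← Finset.mul_sum]
      linarith)
    calc (1 : ℝ) = Real.exp (-(θ * (g / 2))) * Real.exp (θ * (g / 2)) := by
          rw [← Real.exp_add]; simp
      _ ≤ _ := mul_le_mul_of_nonneg_left this (Real.exp_pos _).le
  refine h1.trans ?_
  rw [ex_mul_left]
  refine (mul_le_mul_of_nonneg_left (hP.ex_trExp_le hℓ.le hg0 hg1 hθ0)
    (Real.exp_pos _).le).trans (le_of_eq ?_)
  rw [mul_left_comm, ← Real.exp_add, hθ]
  congr 2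
  field_simp
  ring
end
end
end RobustPCA

/-! ### Nets of the unit ball and spectral norms. -/

namespace RobustPCA
noncomputable section
open Matrix

/-- The spectral norm of `A` is at most `t`. -/
def SpecLE {n₁ n₂ : ℕ} (A : Matrix (Fin n₁) (Fin n₂) ℝ) (t : ℝ) : Prop :=
  ∀ x y, x ⬝ᵥ x ≤ 1 → y ⬝ᵥ y ≤ 1 → x ⬝ᵥ A *ᵥ y ≤ t

/-- Integer vectors of square norm at most `16 d`. -/
def net (d : ℕ) : Finset (Fin d → ℤ) :=
  (Fintype.piFinset fun _ => Finset.Icc (-(16 * d : ℤ)) (16 * d)).filter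
    fun z => ∑ i, z i ^ 2 ≤ 16 * d

/-- The rescaled integer vectors form a net of the unit ball. -/
def netPt {d : ℕ} (z : Fin d → ℤ) : Fin d → ℝ := fun i => z i / (4 * √d)

theorem sum_half_pow_natAbs_le (D : ℕ) :
    ∑ k ∈ Finset.Icc (-(D : ℤ)) D, (1 / 2 : ℝ) ^ k.natAbs ≤ 3 - 2 * (1 / 2) ^ D := by
  induction D with
  | zero => simp; norm_num
  | succ D ih =>
    have h : Finset.Icc (-((D + 1 : ℕ) : ℤ)) ((D + 1 : ℕ) : ℤ) =
        insert ((D + 1 : ℕ) : ℤ) (insert (-((D + 1 : ℕ) : ℤ)) (Finset.Icc (-(D : ℤ)) D)) := by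
      ext k
      simp only [Finset.mem_Icc, Finset.mem_insert]
      push_cast
      omega
    rw [h, Finset.sum_insert, Finset.sum_insert]
    · rw [Int.natAbs_neg, Int.natAbs_natCast, pow_succ]
      linarith
    · simp
    · simp only [Finset.mem_insert, Finset.mem_Icc]
      push_cast
      omega

/-- Give z the weight ∏ 2^(-|zᵢ|). The total weight is at most 3^d, while |zᵢ| ≤ zᵢ² makes every net
point weigh at least 2^(-16d). -/
theorem card_net_le (d : ℕ) : ((net d).card : ℝ) ≤ (3 * 2 ^ 16) ^ d := by
  have h1 : ∑ z ∈ net d, ∏ i, (1 / 2 : ℝ) ^ (z i).natAbs ≤ 3 ^ d := by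
    calc ∑ z ∈ net d, ∏ i, (1 / 2 : ℝ) ^ (z i).natAbs
        ≤ ∑ z ∈ Fintype.piFinset fun _ : Fin d => Finset.Icc (-(16 * d : ℤ)) (16 * d),
            ∏ i, (1 / 2 : ℝ) ^ (z i).natAbs :=
          Finset.sum_le_sum_of_subset_of_nonneg (Finset.filter_subset _ _)
            fun z _ _ => by positivity
      _ = ∏ _i : Fin d, ∑ k ∈ Finset.Icc (-(16 * d : ℤ)) (16 * d), (1 / 2 : ℝ) ^ k.natAbs := by
          rw [Finset.prod_univ_sum]
      _ ≤ ∏ _i : Fin d, 3 := by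
          refine Finset.prod_le_prod (fun i _ => by positivity) fun i _ => ?_
          have := sum_half_pow_natAbs_le (16 * d)
          push_cast at this
          refine this.trans ?_
          have : (0 : ℝ) ≤ 2 * (1 / 2) ^ (16 * d) := by positivity
          linarith
      _ = 3 ^ d := by simp
  have h2 : ∀ z ∈ net d, (1 / 2 : ℝ) ^ (16 * d) ≤ ∏ i, (1 / 2 : ℝ) ^ (z i).natAbs := by
    intro z hz
    rw [Finset.prod_pow_eq_pow_sum]
    refine pow_le_pow_of_le_one (by norm_num) (by norm_num) ?_
    have h3 := (Finset.mem_filter.1 hz).2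
    have h4 : ((∑ i, (z i).natAbs : ℕ) : ℤ) ≤ 16 * d := by
      refine le_trans ?_ h3
      push_cast
      refine Finset.sum_le_sum fun i _ => ?_
      have : |z i| ≤ |z i| ^ 2 := by
        rcases eq_or_ne (z i) 0 with h | h
        · simp [h]
        · have := Int.one_le_abs h
          nlinarith
      rwa [sq_abs] at this
    exact_mod_cast h4
  have h3 := (Finset.card_nsmul_le_sum _ _ _ h2).trans h1
  rw [nsmul_eq_mul] at h3
  have h4 : (1 / 2 : ℝ) ^ (16 * d) * (2 ^ 16) ^ d = 1 := by
    rw [← pow_mul, ← mul_pow]; norm_num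
  calc ((net d).card : ℝ) = (net d).card * ((1 / 2 : ℝ) ^ (16 * d) * (2 ^ 16) ^ d) := by
        rw [h4, mul_one]
    _ = (net d).card * (1 / 2 : ℝ) ^ (16 * d) * (2 ^ 16) ^ d := by ring
    _ ≤ 3 ^ d * (2 ^ 16) ^ d := by gcongr
    _ = _ := by rw [mul_pow]

/-- Rounding towards zero, so that the approximating point stays inside the unit ball. -/
theorem exists_trunc (y : ℝ) : ∃ z : ℤ, (z : ℝ) ^ 2 ≤ y ^ 2 ∧ (y - z) ^ 2 ≤ 1 := by
  rcases le_total 0 y with h | h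
  · refine ⟨⌊y⌋, ?_, ?_⟩
    · have h1 : (0 : ℝ) ≤ ⌊y⌋ := by exact_mod_cast Int.floor_nonneg.2 h
      exact pow_le_pow_left₀ h1 (Int.floor_le y) 2
    · nlinarith [Int.floor_le y, Int.lt_floor_add_one y]
  · refine ⟨⌈y⌉, ?_, ?_⟩
    · have h1 : (⌈y⌉ : ℝ) ≤ 0 := by exact_mod_cast Int.ceil_le.2 (by simpa using h)
      nlinarith [Int.le_ceil y]
    · nlinarith [Int.le_ceil y, Int.ceil_lt_add_one y]

theorem exists_net_approx {d : ℕ} (x : Fin d → ℝ) (hx : x ⬝ᵥ x ≤ 1) :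
    ∃ z ∈ net d, netPt z ⬝ᵥ netPt z ≤ 1 ∧ (x - netPt z) ⬝ᵥ (x - netPt z) ≤ 1 / 16 := by
  choose z hz1 hz2 using fun i => exists_trunc (4 * √d * x i)
  rcases Nat.eq_zero_or_pos d with rfl | hd
  · exact ⟨0, Finset.mem_filter.2 ⟨Fintype.mem_piFinset.2 fun i => i.elim0, by simp⟩, by simp, by simp⟩
  have hd' : (0 : ℝ) < d := by exact_mod_cast hd
  have hs : 0 < 4 * √(d : ℝ) := by positivity
  have hs2 : (4 * √(d : ℝ)) ^ 2 = 16 * d := by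
    rw [mul_pow, Real.sq_sqrt hd'.le]; norm_num
  have hxx : ∑ i, x i ^ 2 ≤ 1 := by
    simpa [dotProduct, sq] using hx
  have hsum : (∑ i, (z i : ℝ) ^ 2) ≤ 16 * d := by
    calc (∑ i, (z i : ℝ) ^ 2) ≤ ∑ i, (4 * √d * x i) ^ 2 := Finset.sum_le_sum fun i _ => hz1 i
      _ = 16 * d * ∑ i, x i ^ 2 := by
          rw [Finset.mul_sum]
          exact Finset.sum_congr rfl fun i _ => by rw [mul_pow, hs2]
      _ ≤ 16 * d * 1 := by gcongr
      _ = _ := mul_one _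
  have hsumZ : (∑ i, z i ^ 2) ≤ 16 * (d : ℤ) := by exact_mod_cast hsum
  refine ⟨z, ?_, ?_, ?_⟩
  · refine Finset.mem_filter.2 ⟨Fintype.mem_piFinset.2 fun i => Finset.mem_Icc.2 ?_, hsumZ⟩
    have h1 : z i ^ 2 ≤ 16 * d :=
      (Finset.single_le_sum (f := fun i => z i ^ 2) (fun _ _ => sq_nonneg _)
        (Finset.mem_univ i)).trans hsumZ
    have h2 : |z i| ≤ |z i| ^ 2 := by
      rcases eq_or_ne (z i) 0 with h | h
      · simp [h]
      · have := Int.one_le_abs h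
        nlinarith
    rw [sq_abs] at h2
    exact abs_le.1 (h2.trans h1)
  · have : netPt z ⬝ᵥ netPt z = (∑ i, (z i : ℝ) ^ 2) / (16 * d) := by
      rw [dotProduct, Finset.sum_div]
      refine Finset.sum_congr rfl fun i _ => ?_
      rw [netPt, ← hs2, ← div_pow, sq]
    rw [this, div_le_one (by positivity)]
    exact hsum
  · have : ∀ i, (x - netPt z) i * (x - netPt z) i ≤ 1 / (16 * d) := fun i => by
      have : (x - netPt z) i * (x - netPt z) i = (4 * √d * x i - z i) ^ 2 / (16 * d) := by
        rw [← hs2, ← div_pow, sub_div, mul_div_cancel_left₀ _ hs.ne', sq]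
        rfl
      rw [this]
      gcongr
      exact hz2 i
    refine (Finset.sum_le_sum fun i _ => this i).trans (le_of_eq ?_)
    simp
    field_simp

theorem isCompact_unitBall (d : ℕ) : IsCompact {x : Fin d → ℝ | x ⬝ᵥ x ≤ 1} := by
  refine Metric.isCompact_of_isClosed_isBounded
    (isClosed_le (by unfold dotProduct; fun_prop) continuous_const)
    ((Metric.isBounded_closedBall (x := (0 : Fin d → ℝ)) (r := 1)).subset fun x hx => ?_)
  rw [mem_closedBall_zero_iff, pi_norm_le_iff_of_nonneg zero_le_one]
  intro i
  have h1 : x i * x i ≤ 1 :=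
    (Finset.single_le_sum (f := fun i => x i * x i) (fun _ _ => mul_self_nonneg _)
      (Finset.mem_univ i)).trans hx
  rw [Real.norm_eq_abs]
  exact abs_le_one_iff_mul_self_le_one.2 h1

/-- At a maximizing pair with value M, moving each vector to a net point at distance at most 1/4
costs at most M/4. Hence M ≤ t + M/2. -/
theorem specLE_of_net {n₁ n₂ : ℕ} {A : Matrix (Fin n₁) (Fin n₂) ℝ} {t : ℝ}
    (h : ∀ z ∈ net n₁, ∀ w ∈ net n₂, netPt z ⬝ᵥ netPt z ≤ 1 → netPt w ⬝ᵥ netPt w ≤ 1 →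
      netPt z ⬝ᵥ A *ᵥ netPt w ≤ t) : SpecLE A (2 * t) := by
  have hc : Continuous fun p : (Fin n₁ → ℝ) × (Fin n₂ → ℝ) => p.1 ⬝ᵥ A *ᵥ p.2 := by
    unfold mulVec dotProduct; fun_prop
  obtain ⟨⟨x₀, y₀⟩, ⟨hx₀, hy₀⟩, hmax⟩ := ((isCompact_unitBall n₁).prod
    (isCompact_unitBall n₂)).exists_isMaxOn ⟨(0, 0), by simp⟩ hc.continuousOn
  have hm : ∀ x y, x ⬝ᵥ x ≤ 1 → y ⬝ᵥ y ≤ 1 → x ⬝ᵥ A *ᵥ y ≤ x₀ ⬝ᵥ A *ᵥ y₀ :=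
    fun x y hx hy => hmax (a := (x, y)) ⟨hx, hy⟩
  obtain ⟨z, hz, hz1, hz2⟩ := exists_net_approx x₀ hx₀
  obtain ⟨w, hw, hw1, hw2⟩ := exists_net_approx y₀ hy₀
  have e1 := h z hz w hw hz1 hw1
  have e2 := hm (netPt z) ((4 : ℝ) • (y₀ - netPt w)) hz1 (by
    rw [smul_dotProduct, dotProduct_smul, smul_eq_mul, smul_eq_mul]; linarith)
  have e3 := hm ((4 : ℝ) • (x₀ - netPt z)) y₀ (by
    rw [smul_dotProduct, dotProduct_smul, smul_eq_mul, smul_eq_mul]; linarith) hy₀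
  rw [mulVec_smul, dotProduct_smul, smul_eq_mul, mulVec_sub, dotProduct_sub] at e2
  rw [smul_dotProduct, smul_eq_mul, sub_dotProduct] at e3
  intro x y hx hy
  have := hm x y hx hy
  linarith

theorem pr_not_specLE_le {n₁ n₂ : ℕ} {ι Θ : Type*} [Fintype ι] [Fintype Θ] {w : Θ → ℝ}
    (hw : IsWeight w) (W : (ι → Θ) → Matrix (Fin n₁) (Fin n₂) ℝ) {t δ : ℝ} (hδ : 0 ≤ δ)
    (h : ∀ x y, x ⬝ᵥ x ≤ 1 → y ⬝ᵥ y ≤ 1 → pr w (fun ω => t ≤ x ⬝ᵥ W ω *ᵥ y) ≤ δ) :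
    pr w (fun ω => ¬ SpecLE (W ω) (2 * t)) ≤ (3 * 2 ^ 16) ^ (n₁ + n₂) * δ := by
  classical
  set s := (net n₁ ×ˢ net n₂).filter
    fun p => netPt p.1 ⬝ᵥ netPt p.1 ≤ 1 ∧ netPt p.2 ⬝ᵥ netPt p.2 ≤ 1
  have h1 : pr w (fun ω => ¬ SpecLE (W ω) (2 * t)) ≤
      pr w (fun ω => ∃ p ∈ s, t ≤ netPt p.1 ⬝ᵥ W ω *ᵥ netPt p.2) := by
    refine pr_mono hw fun ω hω => ?_
    by_contra hcon
    push Not at hcon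
    refine hω (specLE_of_net fun z hz w hw hz1 hw1 => (hcon (z, w) ?_).le)
    exact Finset.mem_filter.2 ⟨Finset.mem_product.2 ⟨hz, hw⟩, hz1, hw1⟩
  refine h1.trans ((pr_exists_le hw s _).trans ?_)
  have h2 : ∑ p ∈ s, pr w (fun ω => t ≤ netPt p.1 ⬝ᵥ W ω *ᵥ netPt p.2) ≤ s.card • δ :=
    Finset.sum_le_card_nsmul _ _ _ fun p hp =>
      h _ _ (Finset.mem_filter.1 hp).2.1 (Finset.mem_filter.1 hp).2.2
  refine h2.trans ?_
  rw [nsmul_eq_mul]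
  refine mul_le_mul_of_nonneg_right ?_ hδ
  calc (s.card : ℝ) ≤ ((net n₁ ×ˢ net n₂).card : ℝ) := by
        exact_mod_cast Finset.card_filter_le _ _
    _ = (net n₁).card * (net n₂).card := by rw [Finset.card_product]; push_cast; rfl
    _ ≤ (3 * 2 ^ 16) ^ n₁ * (3 * 2 ^ 16) ^ n₂ := by
        gcongr
        · exact card_net_le n₁
        · exact card_net_le n₂
    _ = _ := by rw [pow_add]

end

end RobustPCA

/-! ### The golfing scheme. -/

namespace RobustPCA
noncomputable section
open Matrix
variable {n₁ n₂ : ℕ}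

/-- A vector indexed by the entries, seen as a matrix. -/
def mat (v : Fin n₁ × Fin n₂ → ℝ) : Matrix (Fin n₁) (Fin n₂) ℝ := of fun i j => v (i, j)

/-- The rank one matrix `x yᵀ` as a vector indexed by the entries. -/
def outer (x : Fin n₁ → ℝ) (y : Fin n₂ → ℝ) : Fin n₁ × Fin n₂ → ℝ := fun e => x e.1 * y e.2

theorem dot_mat_mulVec (x : Fin n₁ → ℝ) (y : Fin n₂ → ℝ) (v : Fin n₁ × Fin n₂ → ℝ) :
    x ⬝ᵥ mat v *ᵥ y = outer x y ⬝ᵥ v := by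
  simp only [dotProduct, mulVec, outer, Fintype.sum_prod_type, Finset.mul_sum, mat, of_apply]
  exact Finset.sum_congr rfl fun i _ => Finset.sum_congr rfl fun j _ => by ring

theorem mat_add (u v : Fin n₁ × Fin n₂ → ℝ) : mat (u + v) = mat u + mat v := rfl

theorem mat_smul (c : ℝ) (v : Fin n₁ × Fin n₂ → ℝ) : mat (c • v) = c • mat v := rfl

theorem outer_dot_outer (x : Fin n₁ → ℝ) (y : Fin n₂ → ℝ) :
    outer x y ⬝ᵥ outer x y = (x ⬝ᵥ x) * (y ⬝ᵥ y) := by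
  simp only [dotProduct, outer, Fintype.sum_prod_type, Finset.sum_mul_sum]
  exact Finset.sum_congr rfl fun i _ => Finset.sum_congr rfl fun j _ => by ring

theorem outer_dot_outer_le {x : Fin n₁ → ℝ} {y : Fin n₂ → ℝ} (hx : x ⬝ᵥ x ≤ 1)
    (hy : y ⬝ᵥ y ≤ 1) : outer x y ⬝ᵥ outer x y ≤ 1 := by
  rw [outer_dot_outer]
  exact mul_le_one₀ hx (dot_self_nonneg y) hy

theorem SpecLE.mono {A : Matrix (Fin n₁) (Fin n₂) ℝ} {s t : ℝ} (h : SpecLE A s) (hst : s ≤ t) :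
    SpecLE A t := fun x y hx hy => (h x y hx hy).trans hst

theorem SpecLE.add {A B : Matrix (Fin n₁) (Fin n₂) ℝ} {s t : ℝ} (hA : SpecLE A s)
    (hB : SpecLE B t) : SpecLE (A + B) (s + t) := fun x y hx hy => by
  rw [add_mulVec, dotProduct_add]
  exact add_le_add (hA x y hx hy) (hB x y hx hy)

theorem SpecLE.smul {A : Matrix (Fin n₁) (Fin n₂) ℝ} {c t : ℝ} (hA : SpecLE A t) (hc : 0 ≤ c) :
    SpecLE (c • A) (c * t) := fun x y hx hy => by
  rw [smul_mulVec, dotProduct_smul, smul_eq_mul]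
  exact mul_le_mul_of_nonneg_left (hA x y hx hy) hc

section
variable {ι : Type*} [Fintype ι] {P : Matrix ι ι ℝ} {ℓ : ℝ}

theorem IsProj.dot_sub_mulVec [DecidableEq ι] (hP : IsProj P ℓ) (c v : ι → ℝ) :
    c ⬝ᵥ (v - P *ᵥ v) = (c - P *ᵥ c) ⬝ᵥ v := by
  rw [dotProduct_sub, sub_dotProduct, hP.dot_mulVec]

theorem IsProj.sub_mulVec_dot_le [DecidableEq ι] (hP : IsProj P ℓ) (c : ι → ℝ) :
    (c - P *ᵥ c) ⬝ᵥ (c - P *ᵥ c) ≤ c ⬝ᵥ c := by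
  have h2 : (P *ᵥ c) ⬝ᵥ (P *ᵥ c) = c ⬝ᵥ P *ᵥ c := by
    rw [← hP.dot_mulVec, hP.mulVec_mulVec_self]
  have h3 := dot_self_nonneg (P *ᵥ c)
  rw [sub_dotProduct, dotProduct_sub, dotProduct_sub, h2, ← hP.dot_mulVec]
  linarith

/-- The rows have Gram matrix P; expand the squared norms of P e ± P f. -/
theorem IsProj.abs_apply_le [DecidableEq ι] (hP : IsProj P ℓ) (e f : ι) : |P e f| ≤ ℓ := by
  have h1 := dot_self_nonneg (P e - P f)
  have h2 := dot_self_nonneg (P e + P f)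
  simp only [sub_dotProduct, dotProduct_sub, add_dotProduct, dotProduct_add, hP.dot_row] at h1 h2
  rw [hP.apply_comm f e] at h1 h2
  rw [abs_le]
  constructor <;> linarith [hP.diag_le e, hP.diag_le f]

theorem IsProj.sum_sq_row [DecidableEq ι] (hP : IsProj P ℓ) (e : ι) : ∑ f, P e f ^ 2 ≤ ℓ := by
  have := hP.dot_row e e
  calc ∑ f, P e f ^ 2 = P e ⬝ᵥ P e := Finset.sum_congr rfl fun f _ => by ring
    _ ≤ ℓ := this.trans_le (hP.diag_le e)

/-- One step of the golfing scheme contracts the entries, tail of a single entry. -/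
theorem IsProj.pr_contract_le [DecidableEq ι] (hP : IsProj P ℓ) (hℓ : 0 < ℓ) {q z : ℝ}
    (hq0 : 0 < q) (hq1 : q ≤ 1) (hz : 0 < z) {Z : ι → ℝ} (hZ : ∀ e, |Z e| ≤ z) (e : ι) (σ : ℝ)
    (hσ : |σ| = 1) :
    pr (ber q) (fun x => z / 2 ≤ ∑ f, (σ * (P e f * Z f)) * ctr q (x f)) ≤
      Real.exp (-(q / (16 * ℓ))) := by
  -- Optimal for the quadratic exponent, and s ℓ z = q/4 lies in the range of `bernstein_mgf`.
  set s : ℝ := q / (4 * z * ℓ) with hs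
  have hs0 : 0 < s := by positivity
  have hσ2 : σ ^ 2 = 1 := by rw [← sq_abs, hσ]; norm_num
  have hb : ∀ f, |σ * (P e f * Z f)| ≤ ℓ * z := fun f => by
    rw [abs_mul, hσ, one_mul, abs_mul]
    exact mul_le_mul (hP.abs_apply_le e f) (hZ f) (abs_nonneg _) hℓ.le
  refine (pr_linear_ge_le (isWeight_ber hq0.le hq1) (ctr q) _ (s := s) (K := q⁻¹ * s ^ 2) hs0.le
    fun f => ?_).trans (Real.exp_le_exp.2 ?_)
  · refine (bernstein_mgf hq0 hq1 ?_).trans (le_of_eq (by ring_nf))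
    rw [abs_mul, abs_of_pos hs0]
    calc s * |σ * (P e f * Z f)| ≤ s * (ℓ * z) := by gcongr; exact hb f
      _ = q / 4 := by rw [hs]; field_simp
      _ ≤ q := by linarith
  · have h1 : ∑ f, (σ * (P e f * Z f)) ^ 2 ≤ ℓ * z ^ 2 := by
      calc ∑ f, (σ * (P e f * Z f)) ^ 2 ≤ ∑ f, P e f ^ 2 * z ^ 2 := by
            refine Finset.sum_le_sum fun f _ => ?_
            rw [mul_pow, hσ2, one_mul, mul_pow]
            exact mul_le_mul_of_nonneg_left
              (sq_le_sq' (neg_le_of_abs_le (hZ f)) (le_of_abs_le (hZ f))) (sq_nonneg _)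
        _ = (∑ f, P e f ^ 2) * z ^ 2 := by rw [Finset.sum_mul]
        _ ≤ ℓ * z ^ 2 := by gcongr; exact hP.sum_sq_row e
    calc q⁻¹ * s ^ 2 * ∑ f, (σ * (P e f * Z f)) ^ 2 - s * (z / 2)
        ≤ q⁻¹ * s ^ 2 * (ℓ * z ^ 2) - s * (z / 2) := by gcongr
      _ = _ := by rw [hs]; field_simp; ring
end

variable {P : Matrix (Fin n₁ × Fin n₂) (Fin n₁ × Fin n₂) ℝ} {ℓ : ℝ}

/-- The rescaled restriction of `Z` to a random set. -/
def sampled {ι : Type*} (q : ℝ) (Z : ι → ℝ) (x : ι → Bool) : ι → ℝ :=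
  fun e => q⁻¹ * ind (x e) * Z e

theorem sampled_eq {ι : Type*} (q : ℝ) (Z : ι → ℝ) (x : ι → Bool) (e : ι) :
    sampled q Z x e = Z e * ctr q (x e) + Z e := by
  unfold sampled ctr ind
  split_ifs <;> ring

/-- Testing against x yᵀ amounts to pairing the sample with c = (1 - P)(x yᵀ), of norm at most 1. As
c is orthogonal to Z, the pairing is a centred sum, to which Hoeffding's bound and the net apply. -/
theorem IsProj.pr_spec_sampled_le (hP : IsProj P ℓ) {q z β : ℝ} (hq0 : 0 < q) (hq1 : q ≤ 1)
    (hz : 0 < z) (hβ : 0 ≤ β) {Z : Fin n₁ × Fin n₂ → ℝ} (hPZ : P *ᵥ Z = Z) (hZ : ∀ e, |Z e| ≤ z) :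
    pr (ber q) (fun x => ¬ SpecLE (mat (sampled q Z x - P *ᵥ sampled q Z x)) (2 * (β * z / q))) ≤
      (3 * 2 ^ 16) ^ (n₁ + n₂) * Real.exp (-(β ^ 2 / 2)) := by
  refine pr_not_specLE_le (isWeight_ber hq0.le hq1) _ (Real.exp_pos _).le fun x y hx hy => ?_
  set c := outer x y - P *ᵥ outer x y with hc
  have hcc : c ⬝ᵥ c ≤ 1 := (hP.sub_mulVec_dot_le _).trans (outer_dot_outer_le hx hy)
  have hcZ : c ⬝ᵥ Z = 0 := by
    rw [hc, ← hP.dot_sub_mulVec, hPZ, sub_self, dotProduct_zero]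
  have heq : ∀ ω, x ⬝ᵥ mat (sampled q Z ω - P *ᵥ sampled q Z ω) *ᵥ y =
      ∑ e, (c e * Z e) * ctr q (ω e) := fun ω => by
    rw [dot_mat_mulVec, hP.dot_sub_mulVec, ← hc, ← add_zero (∑ e, _), ← hcZ, dotProduct,
      dotProduct, ← Finset.sum_add_distrib]
    exact Finset.sum_congr rfl fun e _ => by rw [sampled_eq]; ring
  simp only [heq]
  set s : ℝ := β * q / z with hs
  have hs0 : 0 ≤ s := by positivity
  refine (pr_linear_ge_le (isWeight_ber hq0.le hq1) (ctr q) _ (s := s)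
    (K := q⁻¹ ^ 2 * s ^ 2 / 2) hs0 fun f => ?_).trans (Real.exp_le_exp.2 ?_)
  · exact (hoeffding_mgf hq0 hq1 _).trans (le_of_eq (by ring_nf))
  · have h1 : ∑ f, (c f * Z f) ^ 2 ≤ z ^ 2 := by
      calc ∑ f, (c f * Z f) ^ 2 ≤ ∑ f, c f * c f * z ^ 2 := by
            refine Finset.sum_le_sum fun f _ => ?_
            rw [mul_pow, ← sq]
            exact mul_le_mul_of_nonneg_left
              (sq_le_sq' (neg_le_of_abs_le (hZ f)) (le_of_abs_le (hZ f))) (sq_nonneg _)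
        _ = (c ⬝ᵥ c) * z ^ 2 := by rw [dotProduct, Finset.sum_mul]
        _ ≤ 1 * z ^ 2 := by gcongr
        _ = z ^ 2 := one_mul _
    calc q⁻¹ ^ 2 * s ^ 2 / 2 * ∑ f, (c f * Z f) ^ 2 - s * (β * z / q)
        ≤ q⁻¹ ^ 2 * s ^ 2 / 2 * z ^ 2 - s * (β * z / q) := by gcongr
      _ = _ := by rw [hs]; field_simp; ring

/-- The failure probability of one step of the golfing scheme. -/
def golfδ (n₁ n₂ : ℕ) (q ℓ β : ℝ) : ℝ :=
  2 * (n₁ * n₂) * Real.exp (-(q / (16 * ℓ))) + (3 * 2 ^ 16) ^ (n₁ + n₂) * Real.exp (-(β ^ 2 / 2))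

theorem golfδ_nonneg (n₁ n₂ : ℕ) (q ℓ β : ℝ) : 0 ≤ golfδ n₁ n₂ q ℓ β := by
  unfold golfδ; positivity

theorem IsProj.pr_golf_step_le (hP : IsProj P ℓ) (hℓ : 0 < ℓ) {q z β : ℝ} (hq0 : 0 < q)
    (hq1 : q ≤ 1) (hz : 0 < z) (hβ : 0 ≤ β) {Z : Fin n₁ × Fin n₂ → ℝ} (hPZ : P *ᵥ Z = Z)
    (hZ : ∀ e, |Z e| ≤ z) :
    pr (ber q) (fun x => ¬ ((∀ e, |(Z - P *ᵥ sampled q Z x) e| ≤ z / 2) ∧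
      SpecLE (mat (sampled q Z x - P *ᵥ sampled q Z x)) (2 * (β * z / q)))) ≤
      golfδ n₁ n₂ q ℓ β := by
  have hw := isWeight_ber hq0.le hq1
  have hres : ∀ x e, (Z - P *ᵥ sampled q Z x) e = - ∑ f, (P e f * Z f) * ctr q (x f) := by
    intro x e
    have h1 : (P *ᵥ sampled q Z x) e = ∑ f, (P e f * Z f) * ctr q (x f) + (P *ᵥ Z) e := by
      simp only [mulVec, dotProduct]
      rw [← Finset.sum_add_distrib]
      exact Finset.sum_congr rfl fun f _ => by rw [sampled_eq]; ring
    rw [Pi.sub_apply, h1, hPZ]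
    ring
  have h1 : pr (ber q) (fun x => ¬ ((∀ e, |(Z - P *ᵥ sampled q Z x) e| ≤ z / 2) ∧
      SpecLE (mat (sampled q Z x - P *ᵥ sampled q Z x)) (2 * (β * z / q)))) ≤
      pr (ber q) (fun x => (∃ p ∈ (Finset.univ : Finset (Fin n₁ × Fin n₂)) ×ˢ
          ({1, -1} : Finset ℝ), z / 2 ≤ ∑ f, (p.2 * (P p.1 f * Z f)) * ctr q (x f)) ∨
        ¬ SpecLE (mat (sampled q Z x - P *ᵥ sampled q Z x)) (2 * (β * z / q))) := by
    refine pr_mono hw fun x hx => ?_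
    by_contra hcon
    push Not at hcon
    refine hx ⟨fun e => ?_, hcon.2⟩
    have e1 := hcon.1 (e, 1) (by simp)
    have e2 := hcon.1 (e, -1) (by simp)
    simp only [one_mul, neg_mul, Finset.sum_neg_distrib] at e1 e2
    rw [hres, abs_neg, abs_le]
    constructor <;> linarith
  refine h1.trans ((pr_or_le hw _ _).trans (add_le_add ?_
    (hP.pr_spec_sampled_le hq0 hq1 hz hβ hPZ hZ)))
  refine (pr_exists_le hw _ _).trans ?_
  refine (Finset.sum_le_card_nsmul _ _ (Real.exp (-(q / (16 * ℓ)))) fun p hp => ?_).trans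
    (le_of_eq ?_)
  · refine hP.pr_contract_le hℓ hq0 hq1 hz hZ p.1 p.2 ?_
    have := (Finset.mem_product.1 hp).2
    simp only [Finset.mem_insert, Finset.mem_singleton] at this
    rcases this with h | h <;> simp [h]
  · rw [Finset.card_product, Finset.card_pair (by norm_num), nsmul_eq_mul]
    simp
    ring

/-- The outcome of the golfing scheme on the set `x`. -/
def Golf (P : Matrix (Fin n₁ × Fin n₂) (Fin n₁ × Fin n₂) ℝ) (q β : ℝ) (K : ℕ)
    (Z : Fin n₁ × Fin n₂ → ℝ) (z : ℝ) (x : Fin n₁ × Fin n₂ → Bool) : Prop :=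
  ∃ Y : Fin n₁ × Fin n₂ → ℝ, (∀ e, x e = false → Y e = 0) ∧
    (∀ e, |(Z - P *ᵥ Y) e| ≤ z / 2 ^ K) ∧ (∀ e, |Y e| ≤ 2 * z / q) ∧
    SpecLE (mat (Y - P *ᵥ Y)) (4 * (β * z / q))

/-- A Bernoulli set of rate 1 - (1 - q)^(K+1) is the union of a rate q set and an independent set of
rate 1 - (1 - q)^K. The first is used for one step, the second for the residual, whose entries are
at most z/2. The bounds on Y and on its spectral part are sums of geometric series. -/
theorem IsProj.pr_golf_le (hP : IsProj P ℓ) (hℓ : 0 < ℓ) {q β : ℝ} (hq0 : 0 < q) (hq1 : q ≤ 1)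
    (hβ : 0 ≤ β) (K : ℕ) : ∀ {z : ℝ} {Z : Fin n₁ × Fin n₂ → ℝ}, 0 < z → P *ᵥ Z = Z →
    (∀ e, |Z e| ≤ z) →
    pr (ber (1 - (1 - q) ^ K)) (fun x => ¬ Golf P q β K Z z x) ≤ K * golfδ n₁ n₂ q ℓ β := by
  have hgw : ∀ K : ℕ, IsWeight (ber (1 - (1 - q) ^ K)) := fun K =>
    isWeight_ber (sub_nonneg.2 (pow_le_one₀ (by linarith) (by linarith)))
      (by linarith [pow_nonneg (by linarith : (0 : ℝ) ≤ 1 - q) K])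
  induction K with
  | zero =>
    intro z Z hz hPZ hZ
    have : ∀ x, Golf P q β 0 Z z x := fun x => ⟨0, by simp, by simpa using hZ, fun e => by
      simp; positivity, fun x y _ _ => by
        rw [dot_mat_mulVec]; simp; positivity⟩
    simp only [this, not_true_eq_false]
    have h0 : pr (ι := Fin n₁ × Fin n₂) (ber (1 - (1 - q) ^ 0)) (fun _ => False) = 0 := by
      simp [pr, ex]
    rw [h0]
    simp
  | succ K ih =>
    intro z Z hz hPZ hZ
    have hw := isWeight_ber hq0.le hq1
    have h1 : pr (ber (1 - (1 - q) ^ (K + 1))) (fun x => ¬ Golf P q β (K + 1) Z z x) =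
        ex (ber q) (fun x => pr (ber (1 - (1 - q) ^ K))
          (fun y => ¬ Golf P q β (K + 1) Z z (fun e => x e || y e))) := by
      unfold pr
      rw [← ex_ber_union (q := q) (g := 1 - (1 - q) ^ K) (by ring)]
    rw [h1]
    refine (ex_pr_le hw (hgw K) (G := fun x => (∀ e, |(Z - P *ᵥ sampled q Z x) e| ≤ z / 2) ∧
      SpecLE (mat (sampled q Z x - P *ᵥ sampled q Z x)) (2 * (β * z / q)))
      (δ := K * golfδ n₁ n₂ q ℓ β) (mul_nonneg K.cast_nonneg (golfδ_nonneg _ _ _ _ _))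
      fun x hx => ?_).trans ?_
    · refine le_trans (pr_mono (hgw K) fun y hy => ?_)
        (ih (z := z / 2) (Z := Z - P *ᵥ sampled q Z x) (by linarith) (by
          rw [mulVec_sub, hPZ, hP.mulVec_mulVec_self]) hx.1)
      contrapose! hy
      obtain ⟨Y, hY1, hY2, hY3, hY4⟩ := hy
      refine ⟨sampled q Z x + Y, fun e he => ?_, fun e => ?_, fun e => ?_, ?_⟩
      · rw [Bool.or_eq_false_iff] at he
        simp [sampled, ind, he.1, hY1 e he.2]
      · have := hY2 e
        rw [mulVec_add, ← sub_sub]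
        refine this.trans (le_of_eq ?_)
        rw [pow_succ]
        field_simp
      · have e1 : |sampled q Z x e| ≤ z / q := by
          unfold sampled ind
          split_ifs
          · rw [mul_one, abs_mul, abs_of_pos (inv_pos.2 hq0), div_eq_inv_mul]
            exact mul_le_mul_of_nonneg_left (hZ e) (inv_pos.2 hq0).le
          · simp; positivity
        refine (abs_add_le _ _).trans ((add_le_add e1 (hY3 e)).trans (le_of_eq ?_))
        field_simp
        ring
      · have e1 := hx.2.add hY4
        have e2 : mat (sampled q Z x - P *ᵥ sampled q Z x) + mat (Y - P *ᵥ Y) =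
            mat (sampled q Z x + Y - P *ᵥ (sampled q Z x + Y)) := by
          rw [← mat_add, mulVec_add]
          congr 1
          abel
        rw [e2] at e1
        refine e1.mono (le_of_eq ?_)
        field_simp
        ring
    · have := hP.pr_golf_step_le hℓ hq0 hq1 hz hβ hPZ hZ
      push_cast
      linarith

end

end RobustPCA

/-! ### Singular values and duality for the nuclear norm. -/

namespace RobustPCA
noncomputable section
open Matrix
variable {n₁ n₂ : ℕ}

/-- A matrix as a vector indexed by the entries. -/
def vec (X : Matrix (Fin n₁) (Fin n₂) ℝ) : Fin n₁ × Fin n₂ → ℝ := fun e => X e.1 e.2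

theorem mat_vec (X : Matrix (Fin n₁) (Fin n₂) ℝ) : mat (vec X) = X := rfl

theorem vec_add (X Y : Matrix (Fin n₁) (Fin n₂) ℝ) : vec (X + Y) = vec X + vec Y := rfl

theorem vec_sub (X Y : Matrix (Fin n₁) (Fin n₂) ℝ) : vec (X - Y) = vec X - vec Y := rfl

theorem dot_le_of_sq {ι : Type*} [Fintype ι] {u v : ι → ℝ} {s t : ℝ} (hs : 0 ≤ s) (ht : 0 ≤ t)
    (hu : u ⬝ᵥ u ≤ s ^ 2) (hv : v ⬝ᵥ v ≤ t ^ 2) : u ⬝ᵥ v ≤ s * t := by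
  refine le_of_abs_le (abs_le_of_sq_le_sq ?_ (by positivity))
  calc (u ⬝ᵥ v) ^ 2 ≤ (∑ i, u i ^ 2) * ∑ i, v i ^ 2 := Finset.sum_mul_sq_le_sq_mul_sq _ _ _
    _ = (u ⬝ᵥ u) * (v ⬝ᵥ v) := by simp [dotProduct, sq]
    _ ≤ s ^ 2 * t ^ 2 := mul_le_mul hu hv (dot_self_nonneg v) (sq_nonneg _)
    _ = (s * t) ^ 2 := by ring

theorem specLE_mat_of_dot_le {v : Fin n₁ × Fin n₂ → ℝ} {t : ℝ} (ht : 0 ≤ t)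
    (hv : v ⬝ᵥ v ≤ t ^ 2) : SpecLE (mat v) t := fun x y hx hy => by
  rw [dot_mat_mulVec]
  have := dot_le_of_sq zero_le_one ht
    (by simpa using outer_dot_outer_le hx hy : outer x y ⬝ᵥ outer x y ≤ 1 ^ 2) hv
  rwa [one_mul] at this

theorem dot_self_eq_zero {κ : Type*} [Fintype κ] {x : κ → ℝ} : x ⬝ᵥ x = 0 ↔ x = 0 :=
  dotProduct_self_eq_zero

theorem SpecLE.dot_le {A : Matrix (Fin n₁) (Fin n₂) ℝ} (hA : SpecLE A 1)
    (x : Fin n₁ → ℝ) (y : Fin n₂ → ℝ) : x ⬝ᵥ A *ᵥ y ≤ √(x ⬝ᵥ x) * √(y ⬝ᵥ y) := by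
  rcases eq_or_ne x 0 with rfl | hx
  · simp
  rcases eq_or_ne y 0 with rfl | hy
  · simp
  have hx0 : 0 < x ⬝ᵥ x := lt_of_le_of_ne (dot_self_nonneg x) (Ne.symm (mt dot_self_eq_zero.1 hx))
  have hy0 : 0 < y ⬝ᵥ y := lt_of_le_of_ne (dot_self_nonneg y) (Ne.symm (mt dot_self_eq_zero.1 hy))
  have h := hA ((√(x ⬝ᵥ x))⁻¹ • x) ((√(y ⬝ᵥ y))⁻¹ • y)
    (by
      rw [smul_dotProduct, dotProduct_smul, smul_eq_mul, smul_eq_mul, ← mul_assoc, ← mul_inv,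
        Real.mul_self_sqrt hx0.le, inv_mul_cancel₀ hx0.ne'])
    (by
      rw [smul_dotProduct, dotProduct_smul, smul_eq_mul, smul_eq_mul, ← mul_assoc, ← mul_inv,
        Real.mul_self_sqrt hy0.le, inv_mul_cancel₀ hy0.ne'])
  rw [mulVec_smul, smul_dotProduct, dotProduct_smul, smul_eq_mul, smul_eq_mul] at h
  have h1 := Real.sqrt_pos.2 hx0
  have h2 := Real.sqrt_pos.2 hy0
  rw [← mul_assoc, ← mul_inv, inv_mul_le_iff₀ (by positivity), mul_one] at h
  exact h

/-- The right singular vectors and the singular values of a matrix. -/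
theorem exists_svd (X : Matrix (Fin n₁) (Fin n₂) ℝ) :
    ∃ (v : Fin n₂ → Fin n₂ → ℝ) (σ : Fin n₂ → ℝ),
      (∀ k, 0 ≤ σ k) ∧ (∀ x y, x ⬝ᵥ y = ∑ k, (v k ⬝ᵥ x) * (v k ⬝ᵥ y)) ∧
      (∀ k, v k ⬝ᵥ v k = 1) ∧ (∀ k l, k ≠ l → v k ⬝ᵥ v l = 0) ∧
      (∀ k l, (X *ᵥ v k) ⬝ᵥ (X *ᵥ v l) = if k = l then σ k ^ 2 else 0) ∧
      nuclearNorm X = ∑ k, σ k := by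
  set T := Matrix.toEuclideanLin X with hT
  have hn : Module.finrank ℝ (EuclideanSpace ℝ (Fin n₂)) = n₂ := by simp
  set hs := T.isSymmetric_adjoint_comp_self
  set b := hs.eigenvectorBasis hn with hb
  have hinner : ∀ x y : EuclideanSpace ℝ (Fin n₂), inner ℝ x y = (x : Fin n₂ → ℝ) ⬝ᵥ y := by
    intro x y
    rw [EuclideanSpace.inner_eq_star_dotProduct, dotProduct_comm]
    simp
  have hTv : ∀ k, (T (b k) : Fin n₁ → ℝ) = X *ᵥ (b k : Fin n₂ → ℝ) := fun k => rfl
  have horth : ∀ k l, (b k : Fin n₂ → ℝ) ⬝ᵥ b l = if k = l then 1 else 0 := fun k l => by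
    rw [← hinner]
    exact orthonormal_iff_ite.1 b.orthonormal k l
  refine ⟨fun k => b k, fun k => T.singularValues k, fun k => T.singularValues_nonneg k,
    fun x y => ?_, fun k => by simp [horth], fun k l hkl => by simp [horth, hkl],
    fun k l => ?_, ?_⟩
  · have h := b.sum_inner_mul_inner (WithLp.toLp 2 x) (WithLp.toLp 2 y)
    simp only [hinner] at h
    change x ⬝ᵥ y = _
    refine h.symm.trans (Finset.sum_congr rfl fun k _ => ?_)
    rw [dotProduct_comm (WithLp.toLp 2 x).ofLp]
  · have h1 : inner ℝ (T (b k)) (T (b l)) = T.singularValues k ^ 2 * inner ℝ (b k) (b l) := by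
      rw [← LinearMap.adjoint_inner_left]
      have := hs.apply_eigenvectorBasis hn k
      rw [LinearMap.comp_apply] at this
      rw [this, T.sq_singularValues_fin hn, real_inner_smul_left]
      rfl
    rw [hinner, horth] at h1
    rw [← hTv, ← hTv, dotProduct_comm]
    rw [EuclideanSpace.inner_eq_star_dotProduct] at h1
    simp only [star_trivial] at h1
    rw [h1]
    simp
  · unfold nuclearNorm
    rw [← hT, Finsupp.sum_of_support_subset (s := Finset.range n₂)]
    · rw [Finset.sum_range]
    · intro i hi
      rw [Finset.mem_range]
      by_contra hcon
      exact (Finsupp.mem_support_iff.1 hi) (T.singularValues_of_finrank_le (by omega))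
    · simp

theorem vec_dot_eq_sum {v : Fin n₂ → Fin n₂ → ℝ}
    (hv : ∀ x y, x ⬝ᵥ y = ∑ k, (v k ⬝ᵥ x) * (v k ⬝ᵥ y)) (M X : Matrix (Fin n₁) (Fin n₂) ℝ) :
    vec M ⬝ᵥ vec X = ∑ k, (M *ᵥ v k) ⬝ᵥ (X *ᵥ v k) := by
  simp only [dotProduct, vec, Fintype.sum_prod_type]
  rw [Finset.sum_comm (s := (Finset.univ : Finset (Fin n₂)))]
  refine Finset.sum_congr rfl fun i _ => ?_
  refine (hv (M i) (X i)).trans (Finset.sum_congr rfl fun k _ => ?_)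
  rw [dotProduct_comm, dotProduct_comm (v k)]
  rfl

/-- The nuclear norm dominates the pairing with contractions. -/
theorem dot_le_nuclearNorm {M : Matrix (Fin n₁) (Fin n₂) ℝ} (hM : SpecLE M 1)
    (X : Matrix (Fin n₁) (Fin n₂) ℝ) : vec M ⬝ᵥ vec X ≤ nuclearNorm X := by
  obtain ⟨v, σ, hσ, hv, hv1, -, hX, hnuc⟩ := exists_svd X
  rw [vec_dot_eq_sum hv, hnuc]
  refine Finset.sum_le_sum fun k _ => ?_
  have := hM.dot_le (X *ᵥ v k) (v k)
  rw [hX, hv1, if_pos rfl, Real.sqrt_sq (hσ k), Real.sqrt_one, mul_one] at this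
  rwa [dotProduct_comm]

/-- Bessel's inequality for orthogonal vectors of norm at most one. -/
theorem bessel_le {κ ι : Type*} [Fintype κ] [DecidableEq κ] [Fintype ι] {p : κ → ι → ℝ}
    (h1 : ∀ k, p k ⬝ᵥ p k ≤ 1) (h0 : ∀ k l, k ≠ l → p k ⬝ᵥ p l = 0) (x : ι → ℝ) :
    ∑ k, (x ⬝ᵥ p k) ^ 2 ≤ x ⬝ᵥ x := by
  set w := ∑ k, (x ⬝ᵥ p k) • p k with hw
  have hxw : x ⬝ᵥ w = ∑ k, (x ⬝ᵥ p k) ^ 2 := by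
    rw [hw, dotProduct_sum]
    exact Finset.sum_congr rfl fun k _ => by rw [dotProduct_smul, smul_eq_mul, sq]
  have hww : w ⬝ᵥ w ≤ ∑ k, (x ⬝ᵥ p k) ^ 2 := by
    conv_lhs => rw [hw, sum_dotProduct]
    refine Finset.sum_le_sum fun k _ => ?_
    rw [dotProduct_sum, Finset.sum_eq_single k]
    · rw [smul_dotProduct, dotProduct_smul, smul_eq_mul, smul_eq_mul]
      nlinarith [h1 k, sq_nonneg (x ⬝ᵥ p k)]
    · intro l _ hl
      rw [smul_dotProduct, dotProduct_smul, h0 k l hl.symm]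
      simp
    · simp
  have := dot_self_nonneg (x - w)
  rw [sub_dotProduct, dotProduct_sub, dotProduct_sub, dotProduct_comm w x, hxw] at this
  linarith

/-- The polar part of X attains the supremum in the duality between the nuclear and the spectral
norm. -/
theorem exists_dot_eq_nuclearNorm (X : Matrix (Fin n₁) (Fin n₂) ℝ) :
    ∃ W : Matrix (Fin n₁) (Fin n₂) ℝ, SpecLE W 1 ∧ vec W ⬝ᵥ vec X = nuclearNorm X := by
  obtain ⟨v, σ, hσ, hv, hv1, hv0, hX, hnuc⟩ := exists_svd X
  -- Left singular vectors. The convention 0⁻¹ = 0 makes p k vanish for a zero singular value, so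
  -- these vectors are orthogonal of norm 0 or 1, as `bessel_le` allows.
  set p : Fin n₂ → Fin n₁ → ℝ := fun k => (σ k)⁻¹ • (X *ᵥ v k) with hp
  have hpp : ∀ k l, p k ⬝ᵥ p l = (σ k)⁻¹ * (σ l)⁻¹ * if k = l then σ k ^ 2 else 0 := fun k l => by
    rw [hp, smul_dotProduct, dotProduct_smul, hX, smul_eq_mul, smul_eq_mul, mul_assoc]
  set W : Matrix (Fin n₁) (Fin n₂) ℝ := ∑ k, vecMulVec (p k) (v k) with hW
  have hWy : ∀ y, W *ᵥ y = ∑ k, (v k ⬝ᵥ y) • p k := fun y => by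
    rw [hW, sum_mulVec]
    exact Finset.sum_congr rfl fun k _ => by rw [vecMulVec_mulVec, op_smul_eq_smul]
  refine ⟨W, fun x y hx hy => ?_, ?_⟩
  · have e1 : ∑ k, (x ⬝ᵥ p k) ^ 2 ≤ x ⬝ᵥ x := by
      refine bessel_le (fun k => ?_) (fun k l hkl => by rw [hpp, if_neg hkl, mul_zero]) x
      rw [hpp, if_pos rfl]
      rcases eq_or_ne (σ k) 0 with h | h
      · simp [h]
      · refine le_of_eq ?_
        field_simp
    have e2 : ∑ k, (v k ⬝ᵥ y) ^ 2 = y ⬝ᵥ y := by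
      rw [hv y y]
      exact Finset.sum_congr rfl fun k _ => by ring
    rw [hWy, dotProduct_sum]
    calc ∑ k, x ⬝ᵥ (v k ⬝ᵥ y) • p k ≤ ∑ k, ((x ⬝ᵥ p k) ^ 2 + (v k ⬝ᵥ y) ^ 2) / 2 := by
          refine Finset.sum_le_sum fun k _ => ?_
          rw [dotProduct_smul, smul_eq_mul]
          nlinarith [sq_nonneg (x ⬝ᵥ p k - v k ⬝ᵥ y)]
      _ = (∑ k, (x ⬝ᵥ p k) ^ 2 + ∑ k, (v k ⬝ᵥ y) ^ 2) / 2 := by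
          rw [← Finset.sum_div, Finset.sum_add_distrib]
      _ ≤ 1 := by linarith
  · rw [vec_dot_eq_sum hv, hnuc]
    refine Finset.sum_congr rfl fun k _ => ?_
    rw [hWy, Finset.sum_eq_single k]
    · rw [hv1, one_smul, hp, smul_dotProduct, hX, if_pos rfl, smul_eq_mul]
      rcases eq_or_ne (σ k) 0 with h | h
      · simp [h]
      · field_simp
    · intro l _ hl
      rw [hv0 l k hl, zero_smul]
    · simp

theorem nuclearNorm_nonneg (X : Matrix (Fin n₁) (Fin n₂) ℝ) : 0 ≤ nuclearNorm X := by
  obtain ⟨v, σ, hσ, -, -, -, -, hnuc⟩ := exists_svd X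
  rw [hnuc]
  exact Finset.sum_nonneg fun k _ => hσ k

theorem eq_zero_of_nuclearNorm_eq_zero {X : Matrix (Fin n₁) (Fin n₂) ℝ}
    (h : nuclearNorm X = 0) : X = 0 := by
  obtain ⟨v, σ, hσ, hv, -, -, hX, hnuc⟩ := exists_svd X
  rw [hnuc, Finset.sum_eq_zero_iff_of_nonneg fun k _ => hσ k] at h
  have h0 : vec X ⬝ᵥ vec X = 0 := by
    rw [vec_dot_eq_sum hv]
    refine Finset.sum_eq_zero fun k hk => ?_
    rw [hX, if_pos rfl, h k hk]
    norm_num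
  have := dot_self_eq_zero.1 h0
  rw [← mat_vec X, this]
  rfl

end

end RobustPCA

/-! ### The tangent space, subgradients and dual certificates. -/

namespace RobustPCA
noncomputable section
open Matrix
open scoped Kronecker
variable {n₁ n₂ r : ℕ} {U : Matrix (Fin n₁) (Fin r) ℝ} {V : Matrix (Fin n₂) (Fin r) ℝ}

/-- The projection onto the orthogonal complement of the column space of `U`. -/
def cproj {n r : ℕ} (U : Matrix (Fin n) (Fin r) ℝ) : Matrix (Fin n) (Fin n) ℝ := 1 - U * Uᵀ

/-- The orthogonal projection onto the tangent space of the matrices with given column and row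
space. -/
def tproj (U : Matrix (Fin n₁) (Fin r) ℝ) (V : Matrix (Fin n₂) (Fin r) ℝ) :
    Matrix (Fin n₁ × Fin n₂) (Fin n₁ × Fin n₂) ℝ := 1 - cproj U ⊗ₖ cproj V

theorem cproj_transpose {n : ℕ} (U : Matrix (Fin n) (Fin r) ℝ) : (cproj U)ᵀ = cproj U := by
  simp [cproj, transpose_sub, transpose_mul]

theorem cproj_mul_self {n : ℕ} {U : Matrix (Fin n) (Fin r) ℝ} (hU : Uᵀ * U = 1) :
    cproj U * cproj U = cproj U := by
  have : U * Uᵀ * (U * Uᵀ) = U * Uᵀ := by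
    rw [Matrix.mul_assoc, ← Matrix.mul_assoc Uᵀ, hU, Matrix.one_mul]
  rw [cproj, sub_mul, mul_sub, mul_sub, this]
  simp

theorem cproj_mul {n : ℕ} {U : Matrix (Fin n) (Fin r) ℝ} (hU : Uᵀ * U = 1) :
    cproj U * U = 0 := by
  rw [cproj, Matrix.sub_mul, Matrix.mul_assoc, hU]
  simp

theorem cproj_diag {n : ℕ} (U : Matrix (Fin n) (Fin r) ℝ) (i : Fin n) :
    cproj U i i = 1 - ∑ k, U i k ^ 2 := by
  simp [cproj, mul_apply, sq]

/-- A diagonal entry is 1 - (1 - u)(1 - v) ≤ u + v, where u and v are the squared row norms of U and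
V; this is how incoherence enters. -/
theorem isProj_tproj (hU : Uᵀ * U = 1) (hV : Vᵀ * V = 1) {a b : ℝ}
    (ha : ∀ i, ∑ k, U i k ^ 2 ≤ a) (hb : ∀ j, ∑ k, V j k ^ 2 ≤ b) :
    IsProj (tproj U V) (a + b) where
  symm := by
    rw [tproj, transpose_sub, transpose_one, ← kroneckerMap_transpose, cproj_transpose,
      cproj_transpose]
  idem := by
    rw [tproj, sub_mul, mul_sub, mul_sub, ← mul_kronecker_mul, cproj_mul_self hU,
      cproj_mul_self hV]
    simp
  diag_le e := by
    rw [tproj, Matrix.sub_apply, kronecker_apply, one_apply_eq, cproj_diag, cproj_diag]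
    have h1 : 0 ≤ ∑ k, U e.1 k ^ 2 := Finset.sum_nonneg fun _ _ => sq_nonneg _
    have h2 : 0 ≤ ∑ k, V e.2 k ^ 2 := Finset.sum_nonneg fun _ _ => sq_nonneg _
    nlinarith [ha e.1, hb e.2, mul_nonneg h1 h2]

theorem sub_tproj_mulVec (X : Matrix (Fin n₁) (Fin n₂) ℝ) :
    vec X - tproj U V *ᵥ vec X = vec (cproj U * X * cproj V) := by
  rw [tproj, sub_mulVec, one_mulVec, sub_sub_cancel]
  funext e
  simp only [mulVec, dotProduct, vec, mul_apply, Fintype.sum_prod_type, Finset.sum_mul]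
  rw [Finset.sum_comm]
  refine Finset.sum_congr rfl fun b _ => Finset.sum_congr rfl fun a _ => ?_
  have : cproj V e.2 b = cproj V b e.2 := by
    conv_lhs => rw [← cproj_transpose]
    rfl
  change cproj U e.1 a * cproj V e.2 b * X a b = _
  rw [this]; ring

theorem tproj_mulVec_eq {X : Matrix (Fin n₁) (Fin n₂) ℝ} (h : cproj U * X = 0) :
    tproj U V *ᵥ vec X = vec X := by
  have := sub_tproj_mulVec (U := U) (V := V) X
  rw [h, Matrix.zero_mul] at this
  exact (sub_eq_zero.1 this).symm

theorem cproj_dot {n : ℕ} {U : Matrix (Fin n) (Fin r) ℝ} (hU : Uᵀ * U = 1) (x : Fin n → ℝ) :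
    (cproj U *ᵥ x) ⬝ᵥ (cproj U *ᵥ x) + (Uᵀ *ᵥ x) ⬝ᵥ (Uᵀ *ᵥ x) = x ⬝ᵥ x := by
  have h1 : (cproj U *ᵥ x) ⬝ᵥ (cproj U *ᵥ x) = x ⬝ᵥ cproj U *ᵥ x := by
    rw [dotProduct_comm, dotProduct_mulVec, ← mulVec_transpose, cproj_transpose,
      mulVec_mulVec, cproj_mul_self hU, dotProduct_comm]
  have h2 : (Uᵀ *ᵥ x) ⬝ᵥ (Uᵀ *ᵥ x) = x ⬝ᵥ (U * Uᵀ) *ᵥ x := by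
    rw [← mulVec_mulVec, dotProduct_mulVec x, ← mulVec_transpose]
  rw [h1, h2, cproj, sub_mulVec, one_mulVec, dotProduct_sub]
  ring

/-- The subgradients of the nuclear norm are contractions. -/
theorem specLE_add_cproj (hU : Uᵀ * U = 1) (hV : Vᵀ * V = 1)
    {W : Matrix (Fin n₁) (Fin n₂) ℝ} (hW : SpecLE W 1) :
    SpecLE (U * Vᵀ + cproj U * W * cproj V) 1 := fun x y hx hy => by
  have e1 : x ⬝ᵥ (U * Vᵀ) *ᵥ y = (Uᵀ *ᵥ x) ⬝ᵥ (Vᵀ *ᵥ y) := by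
    rw [← mulVec_mulVec, dotProduct_mulVec, ← mulVec_transpose]
  have e2 : x ⬝ᵥ (cproj U * W * cproj V) *ᵥ y = (cproj U *ᵥ x) ⬝ᵥ W *ᵥ (cproj V *ᵥ y) := by
    rw [← mulVec_mulVec, ← mulVec_mulVec, dotProduct_mulVec, ← mulVec_transpose, cproj_transpose]
  rw [add_mulVec, dotProduct_add, e1, e2]
  have h1 := cproj_dot hU x
  have h2 := cproj_dot hV y
  have h3 := hW.dot_le (cproj U *ᵥ x) (cproj V *ᵥ y)
  -- Each of the two pairings is bounded by half a sum of squares; `cproj_dot` recombines the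
  -- squares into x ⬝ᵥ x and y ⬝ᵥ y.
  have h4 := dot_self_nonneg (Uᵀ *ᵥ x - Vᵀ *ᵥ y)
  rw [sub_dotProduct, dotProduct_sub, dotProduct_sub, dotProduct_comm (Vᵀ *ᵥ y)] at h4
  have s1 := Real.sq_sqrt (dot_self_nonneg (cproj U *ᵥ x))
  have s2 := Real.sq_sqrt (dot_self_nonneg (cproj V *ᵥ y))
  nlinarith [sq_nonneg (√((cproj U *ᵥ x) ⬝ᵥ (cproj U *ᵥ x)) -
    √((cproj V *ᵥ y) ⬝ᵥ (cproj V *ᵥ y)))]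

theorem vec_dot_svd (M : Matrix (Fin n₁) (Fin n₂) ℝ) (σ : Fin r → ℝ) :
    vec M ⬝ᵥ vec (U * diagonal σ * Vᵀ) = ∑ k, σ k * ((fun i => U i k) ⬝ᵥ M *ᵥ fun j => V j k) := by
  have h : ∀ e, vec (U * diagonal σ * Vᵀ) e = ∑ k, σ k * (U e.1 k * V e.2 k) := fun e => by
    rw [vec, mul_apply]
    exact Finset.sum_congr rfl fun k _ => by rw [mul_diagonal, transpose_apply]; ring
  simp only [dotProduct, h, Finset.mul_sum]
  rw [Finset.sum_comm]
  refine Finset.sum_congr rfl fun k _ => ?_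
  simp only [Fintype.sum_prod_type, mulVec, dotProduct, Finset.mul_sum, vec]
  exact Finset.sum_congr rfl fun i _ => Finset.sum_congr rfl fun j _ => by ring

/-- Pairing L with a norming contraction W gives ∑ σₖ uₖᵀWvₖ ≤ ∑ σₖ, and UVᵀ attains the right side.
The given σ need not be matched with the singular values that define `nuclearNorm`. -/
theorem nuclearNorm_le_of_svd {L : Matrix (Fin n₁) (Fin n₂) ℝ} {σ : Fin r → ℝ}
    (h : IsReducedSVD L U σ V) : nuclearNorm L ≤ vec (U * Vᵀ) ⬝ᵥ vec L := by
  obtain ⟨W, hW, hWL⟩ := exists_dot_eq_nuclearNorm L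
  rw [← hWL, h.eq, vec_dot_svd, vec_dot_svd]
  refine Finset.sum_le_sum fun k _ => mul_le_mul_of_nonneg_left ?_ (h.pos k).le
  have hu : ∀ k l, (fun i => U i k) ⬝ᵥ (fun i => U i l) = if k = l then 1 else 0 := fun k l => by
    have := congrFun (congrFun h.left_orthonormal k) l
    rw [mul_apply, one_apply] at this
    exact this
  have hv : ∀ k l, (fun i => V i k) ⬝ᵥ (fun i => V i l) = if k = l then 1 else 0 := fun k l => by
    have := congrFun (congrFun h.right_orthonormal k) l
    rw [mul_apply, one_apply] at this
    exact this
  have h1 : Vᵀ *ᵥ (fun j => V j k) = Pi.single k 1 := by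
    funext l
    rw [Pi.single_apply]
    exact hv l k
  have h2 : U *ᵥ Pi.single k 1 = fun i => U i k := by
    funext i; simp
  rw [← mulVec_mulVec, h1, h2, hu, if_pos rfl]
  exact hW _ _ (by rw [hu, if_pos rfl]) (by rw [hv, if_pos rfl])

/-- The subgradient inequality for the nuclear norm. -/
theorem nuclearNorm_add_ge {L : Matrix (Fin n₁) (Fin n₂) ℝ} {σ : Fin r → ℝ}
    (h : IsReducedSVD L U σ V) (H : Matrix (Fin n₁) (Fin n₂) ℝ) :
    nuclearNorm L + vec (U * Vᵀ) ⬝ᵥ vec H + nuclearNorm (cproj U * H * cproj V) ≤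
      nuclearNorm (L + H) := by
  have hP : IsProj (tproj U V) _ := isProj_tproj h.left_orthonormal h.right_orthonormal
    (a := ∑ i, ∑ k, U i k ^ 2) (b := ∑ j, ∑ k, V j k ^ 2)
    (fun i => Finset.single_le_sum (f := fun i => ∑ k, U i k ^ 2)
      (fun _ _ => Finset.sum_nonneg fun _ _ => sq_nonneg _) (Finset.mem_univ i))
    (fun i => Finset.single_le_sum (f := fun i => ∑ k, V i k ^ 2)
      (fun _ _ => Finset.sum_nonneg fun _ _ => sq_nonneg _) (Finset.mem_univ i))
  -- Test L + H against UVᵀ plus the normal part of W, where W norms the normal part of H.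
  obtain ⟨W, hW, hWH⟩ := exists_dot_eq_nuclearNorm (cproj U * H * cproj V)
  have h1 := dot_le_nuclearNorm (specLE_add_cproj h.left_orthonormal h.right_orthonormal hW)
    (L + H)
  have hL : tproj U V *ᵥ vec L = vec L := tproj_mulVec_eq (by
    rw [h.eq, ← Matrix.mul_assoc, ← Matrix.mul_assoc, cproj_mul h.left_orthonormal]
    simp)
  have h2 : vec (cproj U * W * cproj V) ⬝ᵥ vec L = 0 := by
    rw [← sub_tproj_mulVec, ← hP.dot_sub_mulVec, hL, sub_self, dotProduct_zero]
  have h3 : vec (cproj U * W * cproj V) ⬝ᵥ vec H = nuclearNorm (cproj U * H * cproj V) := by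
    rw [← hWH, ← sub_tproj_mulVec, ← sub_tproj_mulVec, ← hP.dot_sub_mulVec]
  rw [vec_add, vec_add, add_dotProduct, dotProduct_add, dotProduct_add, h2, h3] at h1
  linarith [nuclearNorm_le_of_svd h]

theorem l1Norm_eq (X : Matrix (Fin n₁) (Fin n₂) ℝ) : l1Norm X = ∑ e, |vec X e| := by
  rw [Fintype.sum_prod_type]
  rfl

open Classical in
theorem vec_proj (Ω : Set (Fin n₁ × Fin n₂)) (X : Matrix (Fin n₁) (Fin n₂) ℝ)
    (e : Fin n₁ × Fin n₂) : vec (proj Ω X) e = if e ∈ Ω then vec X e else 0 := rfl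

/-- A dual certificate implies that Principal Component Pursuit is exact. -/
theorem isPCPExact_of_certificate {lam : ℝ} (hlam : 0 < lam) {Ω Γ : Set (Fin n₁ × Fin n₂)}
    {L₀ S₀ : Matrix (Fin n₁) (Fin n₂) ℝ} {σ : Fin r → ℝ} (hsvd : IsReducedSVD L₀ U σ V)
    {z : Fin n₁ × Fin n₂ → ℝ} (hΓΩ : Γ ⊆ Ω) (hΓS : ∀ e ∈ Γ, vec S₀ e = 0)
    (hz_off : ∀ e, e ∉ Ω → z e = 0) (hz_le : ∀ e, |z e| ≤ lam)
    (hz_sgn : ∀ e ∈ Ω, vec S₀ e ≠ 0 → z e * vec S₀ e = lam * |vec S₀ e|)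
    (hz_Γ : ∀ e ∈ Γ, |z e| ≤ lam / 2) (hPz : tproj U V *ᵥ z = vec (U * Vᵀ))
    (hspec : SpecLE (mat (z - tproj U V *ᵥ z)) (1 / 2))
    (hinj : ∀ y, tproj U V *ᵥ y = y → (∀ e ∈ Γ, y e = 0) → y = 0) :
    IsPCPExact lam Ω L₀ S₀ := by
  classical
  have hP : IsProj (tproj U V) _ := isProj_tproj hsvd.left_orthonormal hsvd.right_orthonormal
    (a := ∑ i, ∑ k, U i k ^ 2) (b := ∑ j, ∑ k, V j k ^ 2)
    (fun i => Finset.single_le_sum (f := fun i => ∑ k, U i k ^ 2)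
      (fun _ _ => Finset.sum_nonneg fun _ _ => sq_nonneg _) (Finset.mem_univ i))
    (fun i => Finset.single_le_sum (f := fun i => ∑ k, V i k ^ 2)
      (fun _ _ => Finset.sum_nonneg fun _ _ => sq_nonneg _) (Finset.mem_univ i))
  set S₁ := proj Ω S₀ with hS₁
  -- A quantitative gap. The slack in the bounds on z leaves half the nuclear norm of the normal
  -- part of L' - L₀, and a multiple of |S' - S₁| on Γ and off Ω. For a minimizer all these terms
  -- vanish; then L' - L₀ lies in T and vanishes on Γ, so it is zero.
  have key : ∀ L' S' : Matrix (Fin n₁) (Fin n₂) ℝ, proj Ω (L' + S') = proj Ω (L₀ + S₀) →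
      nuclearNorm L₀ + lam * l1Norm S₁ +
        (nuclearNorm (cproj U * (L' - L₀) * cproj V) / 2 +
          ∑ e, ((if e ∈ Γ then lam / 2 * |vec (S' - S₁) e| else 0) +
            if e ∈ Ω then 0 else lam * |vec (S' - S₁) e|)) ≤
      nuclearNorm L' + lam * l1Norm S' := by
    intro L' S' hfeas
    set h := vec (L' - L₀) with hh
    set k := vec (S' - S₁) with hk
    have hkh : ∀ e ∈ Ω, k e = - h e := fun e he => by
      have h1 : vec (proj Ω (L' + S')) e = vec (proj Ω (L₀ + S₀)) e := by rw [hfeas]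
      rw [vec_proj, vec_proj, if_pos he, if_pos he, vec_add, vec_add, Pi.add_apply,
        Pi.add_apply] at h1
      rw [hk, hh, vec_sub, vec_sub, Pi.sub_apply, Pi.sub_apply, hS₁, vec_proj, if_pos he]
      linarith
    have hnuc := nuclearNorm_add_ge hsvd (L' - L₀)
    rw [add_sub_cancel] at hnuc
    have hl1 : ∀ e, lam * |vec S₁ e| + z e * k e +
        ((if e ∈ Γ then lam / 2 * |k e| else 0) + if e ∈ Ω then 0 else lam * |k e|) ≤
          lam * |vec S' e| := fun e => by
      have hS' : vec S' e = vec S₁ e + k e := by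
        rw [hk, vec_sub, Pi.sub_apply]; ring
      have hzk : z e * k e ≤ |z e| * |k e| := by rw [← abs_mul]; exact le_abs_self _
      by_cases heΩ : e ∈ Ω
      · have hs1 : vec S₁ e = vec S₀ e := by rw [hS₁, vec_proj, if_pos heΩ]
        rw [if_pos heΩ, add_zero]
        by_cases heΓ : e ∈ Γ
        · rw [if_pos heΓ, hS', hs1, hΓS e heΓ, zero_add, abs_zero, mul_zero, zero_add]
          have := mul_le_mul_of_nonneg_right (hz_Γ e heΓ) (abs_nonneg (k e))
          linarith
        · rw [if_neg heΓ, add_zero]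
          by_cases hs0 : vec S₀ e = 0
          · rw [hS', hs1, hs0, zero_add, abs_zero, mul_zero, zero_add]
            exact hzk.trans (mul_le_mul_of_nonneg_right (hz_le e) (abs_nonneg _))
          · have h1 := hz_sgn e heΩ hs0
            have h2 : z e * vec S' e ≤ lam * |vec S' e| := by
              refine (le_abs_self _).trans ?_
              rw [abs_mul]
              exact mul_le_mul_of_nonneg_right (hz_le e) (abs_nonneg _)
            rw [hs1, ← h1]
            rw [hS', hs1] at h2 ⊢
            linarith
      · have heΓ : e ∉ Γ := fun hc => heΩ (hΓΩ hc)
        have hs1 : vec S₁ e = 0 := by rw [hS₁, vec_proj, if_neg heΩ]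
        rw [if_neg heΩ, if_neg heΓ, hz_off e heΩ, hS', hs1]
        simp
    have hsum := Finset.sum_le_sum fun e (_ : e ∈ Finset.univ) => hl1 e
    rw [Finset.sum_add_distrib, Finset.sum_add_distrib, ← Finset.mul_sum, ← Finset.mul_sum,
      ← l1Norm_eq, ← l1Norm_eq] at hsum
    have hzk : ∑ e, z e * k e = -(z ⬝ᵥ h) := by
      rw [dotProduct, ← Finset.sum_neg_distrib]
      refine Finset.sum_congr rfl fun e _ => ?_
      by_cases he : e ∈ Ω
      · rw [hkh e he]; ring
      · rw [hz_off e he]; ring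
    have hdual : (z - tproj U V *ᵥ z) ⬝ᵥ h ≤ nuclearNorm (cproj U * (L' - L₀) * cproj V) / 2 := by
      have e1 := dot_le_nuclearNorm (M := (2 : ℝ) • mat (z - tproj U V *ᵥ z))
        ((hspec.smul (c := 2) (by norm_num)).mono (by norm_num)) (cproj U * (L' - L₀) * cproj V)
      have e2 : vec ((2 : ℝ) • mat (z - tproj U V *ᵥ z)) = (2 : ℝ) • (z - tproj U V *ᵥ z) := rfl
      rw [e2, ← sub_tproj_mulVec, ← hh, smul_dotProduct, smul_eq_mul, hP.dot_sub_mulVec,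
        mulVec_sub, hP.mulVec_mulVec_self, sub_self, sub_zero] at e1
      linarith
    rw [sub_dotProduct, hPz] at hdual
    rw [hzk] at hsum
    linarith
  have hterm : ∀ S', ∀ e : Fin n₁ × Fin n₂,
      0 ≤ (if e ∈ Γ then lam / 2 * |vec (S' - S₁) e| else 0) +
        if e ∈ Ω then 0 else lam * |vec (S' - S₁) e| := fun S' e => by
    have h1 : 0 ≤ lam / 2 * |vec (S' - S₁) e| := mul_nonneg (by linarith) (abs_nonneg _)
    have h2 : 0 ≤ lam * |vec (S' - S₁) e| := mul_nonneg hlam.le (abs_nonneg _)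
    split_ifs <;> linarith
  have hfeas₀ : proj Ω (L₀ + S₁) = proj Ω (L₀ + S₀) := by
    ext i j
    by_cases h : (i, j) ∈ Ω <;> simp [hS₁, proj, h]
  have hsol : IsPCPSolution lam Ω (proj Ω (L₀ + S₀)) L₀ S₁ := by
    refine ⟨hfeas₀, fun L' S' hf => ?_⟩
    have h1 := key L' S' hf
    have h2 := Finset.sum_nonneg fun e (_ : e ∈ Finset.univ) => hterm S' e
    linarith [nuclearNorm_nonneg (cproj U * (L' - L₀) * cproj V)]
  intro L S
  constructor
  · rintro ⟨hf, hmin⟩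
    have h1 := key L S hf
    have h2 := hmin L₀ S₁ hfeas₀
    have h3 := nuclearNorm_nonneg (cproj U * (L - L₀) * cproj V)
    have h4 := Finset.sum_nonneg fun e (_ : e ∈ Finset.univ) => hterm S e
    have h5 : nuclearNorm (cproj U * (L - L₀) * cproj V) = 0 := by linarith
    have h6 : ∑ e, ((if e ∈ Γ then lam / 2 * |vec (S - S₁) e| else 0) +
        if e ∈ Ω then 0 else lam * |vec (S - S₁) e|) = 0 := by linarith
    rw [Finset.sum_eq_zero_iff_of_nonneg fun e _ => hterm S e] at h6
    have hkh : ∀ e ∈ Ω, vec (S - S₁) e = - vec (L - L₀) e := fun e he => by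
      have h1 : vec (proj Ω (L + S)) e = vec (proj Ω (L₀ + S₀)) e := by rw [hf]
      rw [vec_proj, vec_proj, if_pos he, if_pos he, vec_add, vec_add, Pi.add_apply,
        Pi.add_apply] at h1
      rw [vec_sub, vec_sub, Pi.sub_apply, Pi.sub_apply, hS₁, vec_proj, if_pos he]
      linarith
    have hH : vec (L - L₀) = 0 := by
      refine hinj _ ?_ fun e he => ?_
      · have := sub_tproj_mulVec (U := U) (V := V) (L - L₀)
        rw [eq_zero_of_nuclearNorm_eq_zero h5] at this
        exact (sub_eq_zero.1 this).symm
      · have := h6 e (Finset.mem_univ e)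
        rw [if_pos he, if_pos (hΓΩ he), add_zero, mul_eq_zero, abs_eq_zero] at this
        have h7 := this.resolve_left (by linarith)
        rw [hkh e (hΓΩ he)] at h7
        linarith
    have hK : vec (S - S₁) = 0 := by
      funext e
      by_cases he : e ∈ Ω
      · rw [hkh e he, hH]; simp
      · have := h6 e (Finset.mem_univ e)
        rw [if_neg he, if_neg fun hc => he (hΓΩ hc), zero_add, mul_eq_zero, abs_eq_zero] at this
        exact this.resolve_left hlam.ne'
    constructor
    · have : L - L₀ = 0 := by rw [← mat_vec (L - L₀), hH]; rfl
      exact sub_eq_zero.1 this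
    · have : S - S₁ = 0 := by rw [← mat_vec (S - S₁), hK]; rfl
      exact sub_eq_zero.1 this
  · rintro ⟨rfl, rfl⟩
    exact hsol

end

end RobustPCA

/-! ### Least squares on the clean set and construction of the certificate. -/

namespace RobustPCA
noncomputable section
open Matrix
set_option linter.unusedSectionVars false
variable {n₁ n₂ : ℕ}

section
variable {ι : Type*} [Fintype ι] [DecidableEq ι] {P : Matrix ι ι ℝ} {ℓ g : ℝ} {x : ι → Bool}

/-- Restriction of a vector to a set. -/
def restr {ι : Type*} (x : ι → Bool) (v : ι → ℝ) : ι → ℝ := fun e => ind (x e) * v e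

/-- The set `x` sees every vector in the range of `P`. -/
def Lower (P : Matrix ι ι ℝ) (g : ℝ) (x : ι → Bool) : Prop :=
  ∀ y : ι → ℝ, P *ᵥ y = y → g / 2 * (y ⬝ᵥ y) ≤ restr x y ⬝ᵥ restr x y

theorem ind_mul_ind (b : Bool) : ind b * ind b = ind b := by cases b <;> simp [ind]

theorem restr_eq_mulVec (x : ι → Bool) (v : ι → ℝ) :
    restr x v = diagonal (fun e => ind (x e)) *ᵥ v := by
  funext e; rw [mulVec_diagonal]; rfl

theorem dot_restr (x : ι → Bool) (u v : ι → ℝ) : u ⬝ᵥ restr x v = restr x u ⬝ᵥ v :=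
  Finset.sum_congr rfl fun e _ => by simp only [restr]; ring

theorem restr_restr (x : ι → Bool) (v : ι → ℝ) : restr x (restr x v) = restr x v := by
  funext e; simp only [restr]; rw [← mul_assoc, ind_mul_ind]

theorem restr_dot_restr (x : ι → Bool) (u v : ι → ℝ) :
    restr x u ⬝ᵥ restr x v = u ⬝ᵥ restr x v := by
  rw [dot_restr, restr_restr, ← dot_restr]

/-- Inversion of the restricted projection. -/
theorem IsProj.exists_inverse (hP : IsProj P ℓ) (hg : 0 < g) (hx : Lower P g x) :
    ∃ J : Matrix ι ι ℝ, Jᵀ = J ∧ P * J = J * P ∧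
      ∀ v, P *ᵥ restr x (P *ᵥ (J *ᵥ v)) = P *ᵥ v := by
  set D := diagonal (fun e => ind (x e)) with hD
  -- The compression of D is injective on the range of P by `Lower`; adding 1 - P makes it
  -- invertible on the whole space without mixing the two subspaces.
  set A := P * D * P + (1 - P) with hA
  have hPA : P * A = P * D * P := by
    rw [hA, mul_add, mul_sub, mul_one, hP.idem, sub_self, add_zero, ← mul_assoc, ← mul_assoc,
      hP.idem]
  have hAP : A * P = P * D * P := by
    rw [hA, add_mul, sub_mul, one_mul, hP.idem, sub_self, add_zero, mul_assoc, hP.idem]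
  have hAT : Aᵀ = A := by
    rw [hA, transpose_add, transpose_sub, transpose_one, transpose_mul, transpose_mul, hP.symm,
      hD, diagonal_transpose, mul_assoc]
  have hinj : Function.Injective A.mulVec := by
    refine (injective_iff_map_eq_zero (Matrix.mulVecLin A)).2 fun y hy => ?_
    rw [mulVecLin_apply] at hy
    have h1 : P *ᵥ (D *ᵥ (P *ᵥ y)) = 0 := by
      rw [mulVec_mulVec, mulVec_mulVec, ← hPA, ← mulVec_mulVec, hy, mulVec_zero]
    have h2 : P *ᵥ y = y := by
      rw [hA, add_mulVec, ← mulVec_mulVec, ← mulVec_mulVec, h1, zero_add, sub_mulVec,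
        one_mulVec, sub_eq_zero] at hy
      exact hy.symm
    have h3 := hx y h2
    have h4 : restr x y ⬝ᵥ restr x y = 0 := by
      rw [restr_dot_restr, restr_eq_mulVec, ← hD]
      conv_lhs => rw [← h2]
      rw [← hP.dot_mulVec, ← h2]
      rw [hP.mulVec_mulVec_self, h1, dotProduct_zero]
    rw [h4] at h3
    have h5 := dot_self_nonneg y
    exact dot_self_eq_zero.1 (le_antisymm (by nlinarith) h5)
  have hu : IsUnit A := mulVec_injective_iff_isUnit.1 hinj
  have hdet : IsUnit A.det := (isUnit_iff_isUnit_det A).1 hu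
  have h1 := mul_nonsing_inv A hdet
  have h2 := nonsing_inv_mul A hdet
  have hcomm : P * A⁻¹ = A⁻¹ * P := by
    calc P * A⁻¹ = A⁻¹ * A * (P * A⁻¹) := by rw [h2, one_mul]
      _ = A⁻¹ * (A * P) * A⁻¹ := by simp only [mul_assoc]
      _ = A⁻¹ * (P * A) * A⁻¹ := by rw [hAP, hPA]
      _ = A⁻¹ * P * (A * A⁻¹) := by simp only [mul_assoc]
      _ = A⁻¹ * P := by rw [h1, mul_one]
  refine ⟨A⁻¹, by rw [transpose_nonsing_inv, hAT], hcomm, fun v => ?_⟩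
  rw [restr_eq_mulVec, mulVec_mulVec, mulVec_mulVec, mulVec_mulVec, ← hD, ← hPA, mul_assoc,
    h1, mul_one]

/-- Least squares: the functionals `c ↦ h` dual to the minimal solution `Y` supported on `x` of
`P Y = P E`. -/
theorem IsProj.exists_leastSquares (hP : IsProj P ℓ) (hg : 0 < g) (hx : Lower P g x) :
    ∃ (Y : (ι → ℝ) → ι → ℝ) (h : (ι → ℝ) → ι → ℝ),
      (∀ E e, x e = false → Y E e = 0) ∧ (∀ E, P *ᵥ Y E = P *ᵥ E) ∧
      (∀ c E, c ⬝ᵥ Y E = h c ⬝ᵥ E) ∧ (∀ c, P *ᵥ h c = h c) ∧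
      (∀ c, P *ᵥ restr x (h c) = P *ᵥ restr x c) := by
  obtain ⟨J, hJT, hPJ, hJ⟩ := hP.exists_inverse hg hx
  refine ⟨fun E => restr x (P *ᵥ (J *ᵥ E)), fun c => P *ᵥ (J *ᵥ restr x c), fun E e he => ?_,
    fun E => hJ E, fun c E => ?_, fun c => hP.mulVec_mulVec_self _, fun c => hJ _⟩
  · simp [restr, ind, he]
  · change c ⬝ᵥ restr x (P *ᵥ (J *ᵥ E)) = (P *ᵥ (J *ᵥ restr x c)) ⬝ᵥ E
    rw [dot_restr, mulVec_mulVec, mulVec_mulVec, dotProduct_mulVec, ← mulVec_transpose,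
      transpose_mul, hJT, hP.symm, hPJ]

/-- On x, h is the least squares fit of c from the range of P, so its restriction is no longer than
c; `Lower` recovers all of h from that restriction. -/
theorem IsProj.leastSquares_dot_le (hP : IsProj P ℓ) (hg : 0 < g) (hx : Lower P g x)
    {h c : ι → ℝ} (h1 : P *ᵥ h = h) (h2 : P *ᵥ restr x h = P *ᵥ restr x c) :
    h ⬝ᵥ h ≤ 2 / g * (c ⬝ᵥ c) := by
  have e1 := hx h h1
  have e2 : restr x h ⬝ᵥ restr x h = restr x h ⬝ᵥ c := by
    rw [restr_dot_restr]
    conv_lhs => rw [← h1, ← hP.dot_mulVec, h1, h2, hP.dot_mulVec, h1, dot_restr]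
  set a := restr x h ⬝ᵥ restr x h with ha
  have e3 : a ≤ c ⬝ᵥ c := by
    have := dot_self_nonneg (restr x h - c)
    rw [sub_dotProduct, dotProduct_sub, dotProduct_sub, ← ha, dotProduct_comm c, ← e2] at this
    linarith
  rw [div_mul_eq_mul_div, le_div_iff₀ hg]
  linarith

/-- For a unit vector, the squared norm of h on x is at most |h i| ≤ √ℓ ‖h‖, because row i of P has
norm at most √ℓ. This gains a factor of order ℓ over `IsProj.leastSquares_dot_le`, and makes single
entries of the correction concentrate. -/
theorem IsProj.leastSquares_single_le (hP : IsProj P ℓ) (hg : 0 < g) (hx : Lower P g x)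
    {h : ι → ℝ} {i : ι} (h1 : P *ᵥ h = h) (h2 : P *ᵥ restr x h = P *ᵥ restr x (Pi.single i 1)) :
    h ⬝ᵥ h ≤ 4 * ℓ / g ^ 2 := by
  have e1 := hx h h1
  have e2 : restr x h ⬝ᵥ restr x h = restr x h ⬝ᵥ Pi.single i 1 := by
    rw [restr_dot_restr]
    conv_lhs => rw [← h1, ← hP.dot_mulVec, h1, h2, hP.dot_mulVec, h1, dot_restr]
  have e3 : restr x h ⬝ᵥ Pi.single i 1 ≤ |h i| := by
    rw [dotProduct_single, mul_one, restr]
    unfold ind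
    split_ifs
    · rw [one_mul]; exact le_abs_self _
    · simp
  have e4 : h i ^ 2 ≤ ℓ * (h ⬝ᵥ h) := by
    have : h i = P i ⬝ᵥ h := congrFun h1.symm i
    rw [this]
    calc (P i ⬝ᵥ h) ^ 2 ≤ (∑ f, P i f ^ 2) * ∑ f, h f ^ 2 := Finset.sum_mul_sq_le_sq_mul_sq _ _ _
      _ ≤ ℓ * ∑ f, h f ^ 2 := by
          gcongr
          exact hP.sum_sq_row i
      _ = _ := by simp [dotProduct, sq]
  have hh := dot_self_nonneg h
  have e5 : (g / 2 * (h ⬝ᵥ h)) ^ 2 ≤ ℓ * (h ⬝ᵥ h) := by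
    refine le_trans ?_ e4
    rw [← sq_abs (h i)]
    exact pow_le_pow_left₀ (by positivity) (by linarith) 2
  rcases hh.eq_or_lt with h0 | h0
  · rw [← h0]
    have : 0 ≤ ℓ := (abs_nonneg _).trans (hP.abs_apply_le i i)
    positivity
  · rw [le_div_iff₀ (by positivity)]
    nlinarith

/-- A small vector in the range of `P` is the projection of a small vector supported on `x`. -/
theorem IsProj.exists_correction (hP : IsProj P ℓ) (hg : 0 < g) (hx : Lower P g x)
    {d : ι → ℝ} (hd : P *ᵥ d = d) :
    ∃ Y : ι → ℝ, (∀ e, x e = false → Y e = 0) ∧ P *ᵥ Y = d ∧ Y ⬝ᵥ Y ≤ 2 / g * (d ⬝ᵥ d) := by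
  obtain ⟨Y, h, hY0, hPY, hYh, hh1, hh2⟩ := hP.exists_leastSquares hg hx
  refine ⟨Y d, hY0 d, by rw [hPY, hd], ?_⟩
  -- Apply the duality with c = Y d itself: ‖Y d‖² is the pairing of h (Y d) with d.
  have e1 := hYh (Y d) d
  have e2 := hP.leastSquares_dot_le hg hx (hh1 (Y d)) (hh2 (Y d))
  set a := Y d ⬝ᵥ Y d
  have ha : 0 ≤ a := dot_self_nonneg _
  have e3 : a ^ 2 ≤ 2 / g * a * (d ⬝ᵥ d) := by
    rw [e1]
    calc (h (Y d) ⬝ᵥ d) ^ 2 ≤ (∑ f, h (Y d) f ^ 2) * ∑ f, d f ^ 2 :=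
          Finset.sum_mul_sq_le_sq_mul_sq _ _ _
      _ = (h (Y d) ⬝ᵥ h (Y d)) * (d ⬝ᵥ d) := by simp [dotProduct, sq]
      _ ≤ _ := by
          rw [← e1]
          exact mul_le_mul_of_nonneg_right e2 (dot_self_nonneg _)
  rcases ha.eq_or_lt with h0 | h0
  · rw [← h0]
    exact mul_nonneg (by positivity) (dot_self_nonneg _)
  · nlinarith
end

variable {P : Matrix (Fin n₁ × Fin n₂) (Fin n₁ × Fin n₂) ℝ} {ℓ g : ℝ}

/-- The sign field off the set `x`. -/
def signOff {ι : Type*} (x : ι → Bool) (s : ι → SignType) : ι → ℝ :=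
  fun e => (1 - ind (x e)) * (s e : ℝ)

/-- A correction of the sign field, supported on `x`. -/
def SignCorr (P : Matrix (Fin n₁ × Fin n₂) (Fin n₁ × Fin n₂) ℝ) (t : ℝ)
    (x : Fin n₁ × Fin n₂ → Bool) (s : Fin n₁ × Fin n₂ → SignType) : Prop :=
  ∃ Y : Fin n₁ × Fin n₂ → ℝ, (∀ e, x e = false → Y e = 0) ∧ P *ᵥ Y = P *ᵥ signOff x s ∧
    (∀ e, |Y e| ≤ 1 / 4) ∧
    SpecLE (mat (signOff x s - Y - P *ᵥ (signOff x s - Y))) (2 * t)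

/-- Chernoff's bound for a linear functional of the sign field. -/
theorem pr_sign_le {ι : Type*} [Fintype ι] {a κ M t : ℝ} (h0 : 0 ≤ a) (h1 : a ≤ 1) (hκ : 0 < κ)
    (hmgf : ∀ u : ℝ, ∑ s, sgnW a s * Real.exp (u * (s : ℝ)) ≤ Real.exp (κ * u ^ 2))
    (hM : 0 < M) (ht : 0 ≤ t) (x : ι → Bool) {c : ι → ℝ} (hc : c ⬝ᵥ c ≤ M) :
    pr (sgnW a) (fun s => t ≤ c ⬝ᵥ signOff x s) ≤ Real.exp (-(t ^ 2 / (4 * κ * M))) := by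
  set c' : ι → ℝ := fun e => c e * (1 - ind (x e))
  have hc' : ∑ e, c' e ^ 2 ≤ M := by
    refine le_trans (Finset.sum_le_sum fun e _ => ?_) hc
    simp only [c', ind]
    split_ifs
    · simp; exact mul_self_nonneg _
    · simp [sq]
  have heq : ∀ s, c ⬝ᵥ signOff x s = ∑ e, c' e * ((s e : SignType) : ℝ) := fun s =>
    Finset.sum_congr rfl fun e _ => by simp only [c', signOff]; ring
  simp only [heq]
  set u : ℝ := t / (2 * κ * M) with hu
  have hu0 : 0 ≤ u := by positivity
  refine (pr_linear_ge_le (isWeight_sgnW h0 h1) (fun s : SignType => (s : ℝ)) c' (s := u)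
    (K := κ * u ^ 2) hu0 fun e => ?_).trans (Real.exp_le_exp.2 ?_)
  · exact (hmgf _).trans (le_of_eq (by ring_nf))
  · calc κ * u ^ 2 * ∑ e, c' e ^ 2 - u * t ≤ κ * u ^ 2 * M - u * t := by gcongr
      _ = _ := by rw [hu]; field_simp; ring

/-- Given x, the least squares correction is linear in the signs. Its entries are functionals with
coefficients of squared norm at most 4ℓ/g², for which the general sign bound is enough; the spectral
norm needs the small parameter κ to survive the union over the net. -/
theorem IsProj.pr_signCorr_le (hP : IsProj P ℓ) (hℓ : 0 < ℓ) (hg : 0 < g)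
    {x : Fin n₁ × Fin n₂ → Bool} (hx : Lower P g x) {a κ t : ℝ} (h0 : 0 ≤ a) (h1 : a ≤ 1)
    (hκ : 0 < κ) (ha : a ≤ κ * Real.exp (-(1 / κ))) (ht : 0 ≤ t) :
    pr (sgnW a) (fun s => ¬ SignCorr P t x s) ≤
      2 * (n₁ * n₂) * Real.exp (-(g ^ 2 / (128 * ℓ))) +
        (3 * 2 ^ 16) ^ (n₁ + n₂) * Real.exp (-(t ^ 2 / (4 * κ * (2 * (1 + 2 / g))))) := by
  have hw := isWeight_sgnW h0 h1
  obtain ⟨Y, h, hY0, hPY, hYh, hh1, hh2⟩ := hP.exists_leastSquares hg hx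
  have hY : ∀ e E, Y E e = h (Pi.single e 1) ⬝ᵥ E := fun e E => by
    rw [← hYh, single_dotProduct, one_mul]
  have key : pr (sgnW a) (fun s => ¬ SignCorr P t x s) ≤
      pr (sgnW a) (fun s => (∃ p ∈ (Finset.univ : Finset (Fin n₁ × Fin n₂)) ×ˢ
          ({1, -1} : Finset ℝ), 1 / 4 ≤ (p.2 • h (Pi.single p.1 1)) ⬝ᵥ signOff x s) ∨
        ¬ SpecLE (mat (signOff x s - Y (signOff x s) -
          P *ᵥ (signOff x s - Y (signOff x s)))) (2 * t)) := by
    refine pr_mono hw fun s hs => ?_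
    by_contra hcon
    push Not at hcon
    refine hs ⟨Y (signOff x s), hY0 _, hPY _, fun e => ?_, hcon.2⟩
    have e1 := hcon.1 (e, 1) (by simp)
    have e2 := hcon.1 (e, -1) (by simp)
    simp only [smul_dotProduct, smul_eq_mul, one_mul, neg_mul] at e1 e2
    rw [hY, abs_le]
    constructor <;> linarith
  refine key.trans ((pr_or_le hw _ _).trans (add_le_add ?_ ?_))
  · refine (pr_exists_le hw _ _).trans ?_
    refine (Finset.sum_le_card_nsmul _ _ (Real.exp (-(g ^ 2 / (128 * ℓ)))) fun p hp => ?_).trans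
      (le_of_eq ?_)
    · have hp2 : p.2 * p.2 = 1 := by
        have := (Finset.mem_product.1 hp).2
        simp only [Finset.mem_insert, Finset.mem_singleton] at this
        rcases this with h | h <;> simp [h]
      have hB : (p.2 • h (Pi.single p.1 1)) ⬝ᵥ (p.2 • h (Pi.single p.1 1)) ≤ 4 * ℓ / g ^ 2 := by
        rw [smul_dotProduct, dotProduct_smul, smul_eq_mul, smul_eq_mul, ← mul_assoc, hp2, one_mul]
        exact hP.leastSquares_single_le hg hx (hh1 _) (hh2 _)
      refine (pr_sign_le h0 h1 (κ := 1 / 2) (by norm_num)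
        (fun u => (sign_mgf h1 u).trans (le_of_eq (by ring_nf))) (by positivity) (by norm_num) x
        hB).trans (le_of_eq ?_)
      congr 2
      field_simp
      norm_num
    · rw [Finset.card_product, Finset.card_pair (by norm_num), nsmul_eq_mul]
      simp
      ring
  · refine pr_not_specLE_le hw _ (Real.exp_pos _).le fun u v hu hv => ?_
    set c := outer u v - P *ᵥ outer u v with hc
    have hcc : c ⬝ᵥ c ≤ 1 := (hP.sub_mulVec_dot_le _).trans (outer_dot_outer_le hu hv)
    have heq : ∀ s, u ⬝ᵥ mat (signOff x s - Y (signOff x s) -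
        P *ᵥ (signOff x s - Y (signOff x s))) *ᵥ v = (c - h c) ⬝ᵥ signOff x s := fun s => by
      rw [dot_mat_mulVec, hP.dot_sub_mulVec, ← hc, dotProduct_sub, hYh, ← sub_dotProduct]
    simp only [heq]
    refine pr_sign_le h0 h1 hκ (sparse_sign_mgf hκ h1 ha) (by positivity) ht x ?_
    have e1 := hP.leastSquares_dot_le hg hx (hh1 c) (hh2 c)
    -- Gives ‖c - h c‖² ≤ 2‖c‖² + 2‖h c‖², at most 2(1 + 2/g).
    have e2 := dot_self_nonneg (c + h c)
    rw [add_dotProduct, dotProduct_add, dotProduct_add] at e2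
    have e4 : (c - h c) ⬝ᵥ (c - h c) = c ⬝ᵥ c - c ⬝ᵥ h c - (h c ⬝ᵥ c - h c ⬝ᵥ h c) := by
      generalize h c = w
      generalize c = c
      rw [sub_dotProduct, dotProduct_sub, dotProduct_sub]
    rw [e4]
    have e3 : 2 / g * (c ⬝ᵥ c) ≤ 2 / g * 1 := by gcongr
    linarith

/-- An interpolation of `u` by a vector supported on `x`. -/
def Interp (P : Matrix (Fin n₁ × Fin n₂) (Fin n₁ × Fin n₂) ℝ) (lam : ℝ)
    (u : Fin n₁ × Fin n₂ → ℝ) (x : Fin n₁ × Fin n₂ → Bool) : Prop :=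
  ∃ Y : Fin n₁ × Fin n₂ → ℝ, (∀ e, x e = false → Y e = 0) ∧ P *ᵥ Y = u ∧
    (∀ e, |Y e| ≤ lam / 4) ∧ SpecLE (mat (Y - P *ᵥ Y)) (1 / 4)

/-- The residual of golfing has Euclidean norm so small that `IsProj.exists_correction` removes it
exactly by a vector of norm at most ε. That norm bounds both the entries and the spectral norm of
the correction. -/
theorem IsProj.interp_of_golf (hP : IsProj P ℓ) (hg : 0 < g) {x : Fin n₁ × Fin n₂ → Bool}
    (hx : Lower P g x) {q β z lam : ℝ} {K : ℕ} {u : Fin n₁ × Fin n₂ → ℝ} (hu : P *ᵥ u = u)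
    (hG : Golf P q β K u z x) (h1 : 2 * z / q ≤ lam / 8) (h2 : 4 * (β * z / q) ≤ 1 / 8)
    {ε : ℝ} (hε : 0 ≤ ε) (h3 : 2 / g * (n₁ * n₂ * (z / 2 ^ K) ^ 2) ≤ ε ^ 2) (h4 : ε ≤ lam / 8)
    (h5 : ε ≤ 1 / 8) : Interp P lam u x := by
  obtain ⟨Y, hY0, hYr, hYs, hYspec⟩ := hG
  obtain ⟨Y', hY'0, hPY', hY'n⟩ := hP.exists_correction hg hx (d := u - P *ᵥ Y) (by
    rw [mulVec_sub, hu, hP.mulVec_mulVec_self])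
  have hd : (u - P *ᵥ Y) ⬝ᵥ (u - P *ᵥ Y) ≤ n₁ * n₂ * (z / 2 ^ K) ^ 2 := by
    calc (u - P *ᵥ Y) ⬝ᵥ (u - P *ᵥ Y) ≤ ∑ _e : Fin n₁ × Fin n₂, (z / 2 ^ K) ^ 2 := by
          refine Finset.sum_le_sum fun e _ => ?_
          rw [← sq, ← sq_abs]
          exact pow_le_pow_left₀ (abs_nonneg _) (hYr e) 2
      _ = _ := by simp
  have hY'ε : Y' ⬝ᵥ Y' ≤ ε ^ 2 :=
    hY'n.trans ((mul_le_mul_of_nonneg_left hd (by positivity)).trans h3)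
  refine ⟨Y + Y', fun e he => by simp [hY0 e he, hY'0 e he], ?_, fun e => ?_, ?_⟩
  · rw [mulVec_add, hPY']; abel
  · have e1 : |Y' e| ≤ ε := by
      refine abs_le_of_sq_le_sq ?_ hε
      refine le_trans ?_ hY'ε
      rw [sq]
      exact Finset.single_le_sum (f := fun e => Y' e * Y' e) (fun _ _ => mul_self_nonneg _)
        (Finset.mem_univ e)
    refine (abs_add_le _ _).trans ?_
    linarith [hYs e]
  · have e1 : SpecLE (mat (Y' - P *ᵥ Y')) ε :=
      specLE_mat_of_dot_le hε ((hP.sub_mulVec_dot_le _).trans hY'ε)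
    have e2 := hYspec.add e1
    rw [← mat_add] at e2
    have e3 : Y + Y' - P *ᵥ (Y + Y') = Y - P *ᵥ Y + (Y' - P *ᵥ Y') := by
      rw [mulVec_add]; abel
    rw [e3]
    exact e2.mono (by linarith)

/-- The observed set, the clean part being `x`. -/
def obsSet {ι : Type*} (x : ι → Bool) (s : ι → SignType) : Set ι := {e | x e = true ∨ s e ≠ 0}

/-- The certificate is Y + λ(E - Y'). Off x it equals λ times the sign field. Where the sign is
nonzero but the entry is not corrupted, only |z| ≤ λ is needed, so a sign that disagrees with S does
no harm. -/
theorem isPCPExact_of_interp {r : ℕ} {U : Matrix (Fin n₁) (Fin r) ℝ} {V : Matrix (Fin n₂) (Fin r) ℝ}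
    {σ : Fin r → ℝ} {L₀ S₀ : Matrix (Fin n₁) (Fin n₂) ℝ} (hsvd : IsReducedSVD L₀ U σ V)
    (hg : 0 < g) {x : Fin n₁ × Fin n₂ → Bool}
    {s : Fin n₁ × Fin n₂ → SignType} {lam t : ℝ} (hlam : 0 < lam)
    (hx : Lower (tproj U V) g x) (hI : Interp (tproj U V) lam (vec (U * Vᵀ)) x)
    (hs : SignCorr (tproj U V) t x s) (ht : lam * (2 * t) ≤ 1 / 4)
    (hS1 : ∀ e, x e = true → vec S₀ e = 0)
    (hS2 : ∀ e, x e = false → vec S₀ e ≠ 0 → (s e : ℝ) * vec S₀ e = |vec S₀ e| ∨ s e = 0) :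
    IsPCPExact lam (obsSet x s) L₀ S₀ := by
  obtain ⟨Y, hY0, hPY, hYs, hYspec⟩ := hI
  obtain ⟨Y', hY'0, hPY', hY's, hY'spec⟩ := hs
  set P := tproj U V with hPdef
  set E := signOff x s with hE
  have hEx : ∀ e, x e = true → E e = 0 := fun e he => by simp [hE, signOff, ind, he]
  have hEx' : ∀ e, x e = false → E e = (s e : ℝ) := fun e he => by simp [hE, signOff, ind, he]
  have hz : P *ᵥ (Y + lam • (E - Y')) = vec (U * Vᵀ) := by
    rw [mulVec_add, mulVec_smul, mulVec_sub, hPY', sub_self, smul_zero, add_zero, hPY]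
  have hoff : ∀ e, x e = false → (Y + lam • (E - Y')) e = lam * (s e : ℝ) := fun e he => by
    simp [hY0 e he, hY'0 e he, hEx' e he]
  have hon : ∀ e, x e = true → |(Y + lam • (E - Y')) e| ≤ lam / 2 := fun e he => by
    have e1 : (Y + lam • (E - Y')) e = Y e - lam * Y' e := by
      simp [hEx e he]; ring
    rw [e1]
    refine (abs_sub _ _).trans ?_
    rw [abs_mul, abs_of_pos hlam]
    have := mul_le_mul_of_nonneg_left (hY's e) hlam.le
    linarith [hYs e]
  have hsle : ∀ σ : SignType, |(σ : ℝ)| ≤ 1 := fun σ => by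
    rcases σ with _ | _ | _ <;> simp
  refine isPCPExact_of_certificate (Γ := {e | x e = true}) (z := Y + lam • (E - Y')) hlam hsvd
    (fun e he => Or.inl he) hS1 (fun e he => ?_) (fun e => ?_) (fun e he h0 => ?_) hon hz ?_ ?_
  · simp only [obsSet, Set.mem_ofPred_eq, not_or, not_not] at he
    rw [hoff e (by simpa using he.1), he.2]
    simp
  · cases he : x e
    · rw [hoff e he, abs_mul, abs_of_pos hlam]
      exact mul_le_of_le_one_right hlam.le (hsle _)
    · exact (hon e he).trans (by linarith)
  · have hxe : x e = false := by
      by_contra hcon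
      exact h0 (hS1 e (by simpa using hcon))
    have hse : s e ≠ 0 := by
      rcases he with h | h
      · rw [hxe] at h; cases h
      · exact h
    rw [hoff e hxe, mul_assoc, (hS2 e hxe h0).resolve_right hse]
  · have e1 := hYspec.add (hY'spec.smul hlam.le)
    rw [← mat_smul, ← mat_add] at e1
    have e2 : Y + lam • (E - Y') - P *ᵥ (Y + lam • (E - Y')) =
        Y - P *ᵥ Y + lam • (E - Y' - P *ᵥ (E - Y')) := by
      rw [mulVec_add, mulVec_smul, smul_sub lam (E - Y')]; abel
    rw [e2]
    exact e1.mono (by linarith)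
  · intro y hy hy0
    have e1 := hx y hy
    have e2 : restr x y = 0 := by
      funext e
      cases he : x e
      · simp [restr, ind, he]
      · simp [restr, hy0 e he]
    rw [e2, dotProduct_zero] at e1
    exact dot_self_eq_zero.1 (le_antisymm (by nlinarith) (dot_self_nonneg y))

end

end RobustPCA

/-! ### Random signs from fixed signs, and the mode of the binomial law. -/

namespace RobustPCA
noncomputable section
open Matrix
variable {n₁ n₂ : ℕ}

/-- The corrupted set in the model with random signs: a clean entry is never corrupted, an entry
with a random sign is corrupted if that sign is `sg e`. -/
def corr {ι : Type*} (sg : ι → SignType) (x : ι → Bool) (s : ι → SignType) (b : ι → Bool) :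
    ι → Bool :=
  fun e => if x e = true then false else if s e = 0 then b e else decide (s e = sg e)

/-- Derandomization of the signs. -/
theorem ex_derandomize {ι : Type*} [Fintype ι] {p τ g a : ℝ} (hg : g = p * (1 - 2 * τ))
    (ha : (1 - g) * a = 2 * p * τ) {sg : ι → SignType} (hsg : ∀ e, sg e ≠ 0)
    (F : (ι → Bool) → (ι → Bool) → ℝ) :
    ex (ber p) (fun o => ex (ber τ) (fun b => F o b)) =
      ex (ber g) (fun x => ex (sgnW a) (fun s => ex (ber τ) (fun b =>
        F (fun e => x e || decide (s e ≠ 0)) (corr sg x s b)))) := by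
  classical
  rw [ex_pair]
  have h1 : ∀ x : ι → Bool, ex (sgnW a) (fun s => ex (ber τ) (fun b =>
        F (fun e => x e || decide (s e ≠ 0)) (corr sg x s b))) = _ := fun x =>
    ex_pair (sgnW a) (ber τ) (fun s b => F (fun e => x e || decide (s e ≠ 0)) (corr sg x s b))
  simp only [h1]
  rw [ex_pair (ber g) (fun θ : SignType × Bool => sgnW a θ.1 * ber τ θ.2)
    (fun x z => F (fun e => x e || decide ((z e).1 ≠ 0))
      (corr sg x (fun e => (z e).1) (fun e => (z e).2)))]
  symm
  refine ex_push (w := fun θ : Bool × SignType × Bool => ber g θ.1 * (sgnW a θ.2.1 * ber τ θ.2.2))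
    (w' := fun θ : Bool × Bool => ber p θ.1 * ber τ θ.2)
    (fun e (θ : Bool × SignType × Bool) => ((θ.1 || decide (θ.2.1 ≠ 0)),
      (if θ.1 = true then false else if θ.2.1 = 0 then θ.2.2 else decide (θ.2.1 = sg e))))
    (fun e θ' => ?_) (fun z => F (fun e => (z e).1) (fun e => (z e).2))
  have h3 : sg e = 1 ∨ sg e = -1 := by
    have := hsg e
    revert this
    cases sg e <;> decide
  have d1 : ¬ ((-1 : SignType) = 0) := by decide
  have d2 : ¬ ((1 : SignType) = 0) := by decide
  have d3 : ¬ ((-1 : SignType) = 1) := by decide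
  have d4 : ¬ ((1 : SignType) = -1) := by decide
  -- The probability of being unobserved. An observed entry is corrupted with probability (1 - g) a
  -- / 2 = pτ; an unobserved one takes its corruption from the independent b.
  have hk : (1 - g) * (1 - a) = 1 - p := by linear_combination -ha - hg
  obtain ⟨o, c⟩ := θ'
  rcases h3 with h3 | h3 <;> cases o <;> cases c <;>
    simp [Fintype.sum_prod_type, sum_signType, ber, sgnW, h3, d1, d2, d3, d4] <;>
    first
    | linear_combination (1 - τ) * hk
    | linear_combination τ * hk
    | nlinarith

/-- The sign of the corruption, with an arbitrary choice where it vanishes. -/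
def sgnS (S : Matrix (Fin n₁) (Fin n₂) ℝ) (e : Fin n₁ × Fin n₂) : SignType :=
  if vec S e = 0 then 1 else SignType.sign (vec S e)

theorem sgnS_ne_zero (S : Matrix (Fin n₁) (Fin n₂) ℝ) (e : Fin n₁ × Fin n₂) : sgnS S e ≠ 0 := by
  unfold sgnS
  split_ifs with h
  · decide
  · exact sign_ne_zero.2 h

/-- Failure of Principal Component Pursuit, as an event on the observed and the corrupted set. -/
def Fails (lam : ℝ) (L₀ S : Matrix (Fin n₁) (Fin n₂) ℝ) (o b : Fin n₁ × Fin n₂ → Bool) : Prop :=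
  ¬ IsPCPExact lam {e | o e = true} L₀ (proj {e | b e = true} S)

/-- The failure probability for a Bernoulli observed set, in terms of the good events. -/
theorem ex_fails_le {r : ℕ} {U : Matrix (Fin n₁) (Fin r) ℝ} {V : Matrix (Fin n₂) (Fin r) ℝ}
    {σ : Fin r → ℝ} {L₀ S : Matrix (Fin n₁) (Fin n₂) ℝ} (hsvd : IsReducedSVD L₀ U σ V)
    {p τ g a lam t δ : ℝ} (hg0 : 0 < g) (hg1 : g ≤ 1) (ha0 : 0 ≤ a) (ha1 : a ≤ 1) (hτ0 : 0 ≤ τ)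
    (hτ1 : τ ≤ 1) (hg : g = p * (1 - 2 * τ)) (ha : (1 - g) * a = 2 * p * τ) (hlam : 0 < lam)
    (ht : lam * (2 * t) ≤ 1 / 4) (hδ : 0 ≤ δ)
    (hs : ∀ x, Lower (tproj U V) g x →
      pr (sgnW a) (fun s => ¬ SignCorr (tproj U V) t x s) ≤ δ) :
    ex (ber p) (fun o => pr (ber τ) (Fails lam L₀ S o)) ≤
      pr (ber g) (fun x => ¬ (Lower (tproj U V) g x ∧
        Interp (tproj U V) lam (vec (U * Vᵀ)) x)) + δ := by
  classical
  have hwτ := isWeight_ber hτ0 hτ1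
  have hws := isWeight_sgnW ha0 ha1
  have h1 : ex (ber p) (fun o => pr (ber τ) (Fails lam L₀ S o)) = _ :=
    ex_derandomize hg ha (sgnS_ne_zero S)
      (fun o b => @ite ℝ (Fails lam L₀ S o b) (Classical.propDecidable _) 1 0)
  rw [h1]
  refine le_trans (ex_mono (isWeight_ber hg0.le hg1) (G := fun x => pr (sgnW a)
    (fun s => ¬ (Lower (tproj U V) g x ∧ Interp (tproj U V) lam (vec (U * Vᵀ)) x ∧
      SignCorr (tproj U V) t x s))) fun x => ?_) ?_
  · refine ex_mono hws fun s => ?_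
    by_cases hgood : Lower (tproj U V) g x ∧ Interp (tproj U V) lam (vec (U * Vᵀ)) x ∧
      SignCorr (tproj U V) t x s
    · refine le_trans (b := 0) ?_ (by split_ifs <;> norm_num)
      refine le_of_le_of_eq (ex_mono hwτ (G := fun _ => 0) fun b => ?_) (ex_const hwτ 0)
      have hex : ¬ Fails lam L₀ S (fun e => x e || decide (s e ≠ 0))
          (corr (sgnS S) x s b) := by
        rw [Fails, not_not]
        have hset : {e | (x e || decide (s e ≠ 0)) = true} = obsSet x s := by
          ext e; simp [obsSet]
        rw [hset]
        refine isPCPExact_of_interp hsvd hg0 hlam hgood.1 hgood.2.1 hgood.2.2 ht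
          (fun e he => ?_) fun e he h0 => ?_
        · rw [vec_proj, if_neg]
          simp [corr, he]
        · rw [vec_proj] at h0 ⊢
          have hc : e ∈ {e | corr (sgnS S) x s b e = true} := by
            by_contra hcon
            exact h0 (if_neg hcon)
          rw [if_pos hc] at h0 ⊢
          by_cases hse : s e = 0
          · exact Or.inr hse
          · left
            have hc' : corr (sgnS S) x s b e = true := hc
            simp only [corr, he, hse, if_false, decide_eq_true_eq, Bool.false_eq_true] at hc'
            rw [hc', sgnS, if_neg h0, mul_comm, self_mul_sign]
      rw [if_neg hex]
    · rw [if_pos hgood]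
      refine le_of_le_of_eq (ex_mono hwτ (G := fun _ => 1) fun b => ?_) (ex_const hwτ 1)
      split_ifs <;> norm_num
  · refine ex_pr_le (isWeight_ber hg0.le hg1) hws hδ fun x hx => ?_
    refine le_trans (pr_mono hws fun s hs => ?_) (hs x hx.1)
    exact fun hc => hs ⟨hx.1, hx.2, hc⟩

/-- The binomial weight with mean `m` is largest at `m`. -/
theorem one_le_binomial_mode {N m : ℕ} (hm0 : 0 < m) (hmN : m < N) :
    1 ≤ (N + 1) * ((N.choose m : ℝ) * (m / N : ℝ) ^ m * (1 - m / N : ℝ) ^ (N - m)) := by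
  set p : ℝ := m / N with hp
  have hN : (0 : ℝ) < N := by exact_mod_cast (by omega : 0 < N)
  have hmN' : (m : ℝ) < N := by exact_mod_cast hmN
  have hpN : p * N = m := by rw [hp]; field_simp
  have hp0 : 0 < p := div_pos (by exact_mod_cast hm0) hN
  have hp1 : 0 < 1 - p := by
    rw [sub_pos, hp, div_lt_one hN]; exact hmN'
  set b : ℕ → ℝ := fun k => (N.choose k : ℝ) * p ^ k * (1 - p) ^ (N - k) with hb
  have hb0 : ∀ k, 0 ≤ b k := fun k => by positivity
  -- The ratio of consecutive weights is at least 1 for k < m and at most 1 for k ≥ m, because pN =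
  -- m. So b m is the largest of N + 1 numbers with sum 1.
  have hrec : ∀ k, k < N → b (k + 1) * ((k + 1) * (1 - p)) = b k * ((N - k) * p) := by
    intro k hk
    have h1 : (N.choose (k + 1) : ℝ) * (k + 1) = N.choose k * (N - k) := by
      have := Nat.choose_succ_right_eq N k
      have h2 : ((N - k : ℕ) : ℝ) = N - k := by push_cast [Nat.cast_sub hk.le]; ring
      rw [← h2]
      exact_mod_cast this
    have h2 : (1 - p) ^ (N - k) = (1 - p) ^ (N - (k + 1)) * (1 - p) := by
      rw [← pow_succ]; congr 1; omega
    simp only [hb]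
    rw [h2, pow_succ]
    linear_combination (p ^ k * p * (1 - p) ^ (N - (k + 1)) * (1 - p)) * h1
  have hup : ∀ k, k < m → b k ≤ b (k + 1) := fun k hk => by
    have h1 := hrec k (by omega)
    have hk' : (k : ℝ) + 1 ≤ m := by exact_mod_cast hk
    have hc : 0 < ((k : ℝ) + 1) * (1 - p) := by positivity
    have h2 : ((k : ℝ) + 1) * (1 - p) ≤ (N - k) * p := by nlinarith
    refine le_of_mul_le_mul_right ?_ hc
    rw [h1]
    exact mul_le_mul_of_nonneg_left h2 (hb0 k)
  have hdown : ∀ k, m ≤ k → k < N → b (k + 1) ≤ b k := fun k hk hkN => by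
    have h1 := hrec k hkN
    have hk' : (m : ℝ) ≤ k := by exact_mod_cast hk
    have hc : 0 < ((k : ℝ) + 1) * (1 - p) := by positivity
    have h2 : (N - k) * p ≤ ((k : ℝ) + 1) * (1 - p) := by nlinarith
    refine le_of_mul_le_mul_right ?_ hc
    rw [h1]
    exact mul_le_mul_of_nonneg_left h2 (hb0 k)
  have hlow : ∀ j, j ≤ m → b (m - j) ≤ b m := fun j => by
    induction j with
    | zero => simp
    | succ j ih =>
      intro hj
      have h1 := hup (m - (j + 1)) (by omega)
      rw [show m - (j + 1) + 1 = m - j by omega] at h1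
      exact h1.trans (ih (by omega))
  have hhigh : ∀ j, m + j ≤ N → b (m + j) ≤ b m := fun j => by
    induction j with
    | zero => simp
    | succ j ih =>
      intro hj
      exact (hdown (m + j) (by omega) (by omega)).trans (ih (by omega))
  have hmax : ∀ k ∈ Finset.range (N + 1), b k ≤ b m := fun k hk => by
    rw [Finset.mem_range] at hk
    rcases le_total k m with h | h
    · have := hlow (m - k) (by omega)
      rwa [show m - (m - k) = k by omega] at this
    · have := hhigh (k - m) (by omega)
      rwa [show m + (k - m) = k by omega] at this
  have hsum : ∑ k ∈ Finset.range (N + 1), b k = 1 := by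
    have := add_pow p (1 - p) N
    rw [add_sub_cancel, one_pow] at this
    rw [this]
    exact Finset.sum_congr rfl fun k _ => by simp only [hb]; ring
  have := Finset.sum_le_card_nsmul _ _ _ hmax
  rw [hsum, Finset.card_range, nsmul_eq_mul] at this
  push_cast at this
  exact this

end

end RobustPCA

/-! ### Numerical constants for Bernoulli observed sets. -/

namespace RobustPCA
noncomputable section
open Matrix
variable {n₁ n₂ : ℕ}

/-- The sub-Gaussian parameter of the random signs. -/
def kap : ℝ := 1 / 20000000

/-- The admissible corruption probability. -/
def tauS : ℝ := kap * Real.exp (-(1 / kap))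

theorem kap_pos : 0 < kap := by unfold kap; norm_num

theorem tauS_pos : 0 < tauS := mul_pos kap_pos (Real.exp_pos _)

theorem tauS_le : tauS ≤ 1 / 20 := by
  have h1 : Real.exp (-(1 / kap)) ≤ 1 :=
    Real.exp_le_one_iff.2 (neg_nonpos.2 (by have := kap_pos; positivity))
  have h2 : tauS ≤ kap * 1 := mul_le_mul_of_nonneg_left h1 kap_pos.le
  have h3 : kap ≤ 1 / 20 := by unfold kap; norm_num
  linarith

/-- The number of steps and the sampling rate of the golfing scheme. -/
theorem exists_golf_rate {g : ℝ} (hg0 : 0 < g) (hg1 : g < 1) {K : ℕ} (hK : 0 < K) :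
    ∃ q : ℝ, 0 < q ∧ q ≤ 1 ∧ g / K ≤ q ∧ 1 - (1 - q) ^ K = g := by
  have hK' : (0 : ℝ) < K := by exact_mod_cast hK
  have hK1 : (1 : ℝ) ≤ K := by exact_mod_cast hK
  -- The rate is q = 1 - y, and Bernoulli's inequality for the exponent 1/K gives q ≥ g/K.
  set y : ℝ := (1 - g) ^ (1 / (K : ℝ)) with hy
  have h1 : y ≤ 1 - g / K := by
    have := rpow_one_add_le_one_add_mul_self (s := -g) (p := 1 / (K : ℝ)) (by linarith)
      (by positivity) (by rw [div_le_one hK']; exact hK1)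
    rw [← sub_eq_add_neg] at this
    refine this.trans (le_of_eq ?_)
    ring
  have h2 : y ^ K = 1 - g := by
    rw [hy, ← Real.rpow_natCast, ← Real.rpow_mul (by linarith), one_div,
      inv_mul_cancel₀ hK'.ne', Real.rpow_one]
  have h3 : 0 ≤ y := Real.rpow_nonneg (by linarith) _
  have h4 : 0 < g / K := by positivity
  exact ⟨1 - y, by linarith, by linarith, by linarith, by rw [sub_sub_cancel, h2]; ring⟩

/-- The product of the two nets has at most e^(40n) points, so an exponent 60n leaves e^(-20n),
which is below n^(-20). -/
theorem net_mul_exp_le {n : ℕ} (h1 : n₁ ≤ n) (h2 : n₂ ≤ n) (hn : 0 < n) {c : ℝ}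
    (hc : 60 * n ≤ c) :
    (3 * 2 ^ 16 : ℝ) ^ (n₁ + n₂) * Real.exp (-c) ≤ Real.exp (-(20 * Real.log n)) := by
  have hn' : (0 : ℝ) < n := by exact_mod_cast hn
  have e1 : (3 * 2 ^ 16 : ℝ) ≤ Real.exp 20 := by
    have : (2 : ℝ) ≤ Real.exp 1 := by have := Real.add_one_le_exp (1 : ℝ); linarith
    calc (3 * 2 ^ 16 : ℝ) ≤ 2 ^ 20 := by norm_num
      _ ≤ Real.exp 1 ^ 20 := by gcongr
      _ = Real.exp 20 := by rw [← Real.exp_nat_mul]; norm_num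
  calc (3 * 2 ^ 16 : ℝ) ^ (n₁ + n₂) * Real.exp (-c)
      ≤ (3 * 2 ^ 16 : ℝ) ^ (2 * n) * Real.exp (-c) := by
        gcongr
        · norm_num
        · omega
    _ ≤ Real.exp 20 ^ (2 * n) * Real.exp (-(60 * n)) := by gcongr
    _ = Real.exp (-(20 * n)) := by
        rw [← Real.exp_nat_mul, ← Real.exp_add]; congr 1; push_cast; ring
    _ ≤ _ := by
        refine Real.exp_le_exp.2 ?_
        have := Real.log_le_sub_one_of_pos hn'
        linarith

set_option maxHeartbeats 2000000 in
/-- The failure probability when the observed set is Bernoulli. -/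
theorem ex_fails_le_of_incoherent {r n : ℕ} {U : Matrix (Fin n₁) (Fin r) ℝ}
    {V : Matrix (Fin n₂) (Fin r) ℝ} {σ : Fin r → ℝ} {L₀ : Matrix (Fin n₁) (Fin n₂) ℝ}
    (S : Matrix (Fin n₁) (Fin n₂) ℝ) (hsvd : IsReducedSVD L₀ U σ V) (hn₁ : n₁ ≤ n) (hn₂ : n₂ ≤ n)
    (hn : 100 ≤ n) {p τ : ℝ} (hp0 : 0.09 ≤ p) (hp1 : p ≤ 0.11) (hτ0 : 0 ≤ τ) (hτ1 : τ ≤ tauS)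
    (hU : ∀ i, ∑ k, U i k ^ 2 ≤ (1 / 20000) ^ 2 / Real.log n ^ 2)
    (hV : ∀ j, ∑ k, V j k ^ 2 ≤ (1 / 20000) ^ 2 / Real.log n ^ 2)
    (hUV : ∀ i j, |(U * Vᵀ) i j| ≤ (1 / 20000) / (√n * Real.log n)) :
    ex (ber p) (fun o => pr (ber τ) (Fails (1 / √(0.1 * n)) L₀ S o)) ≤
      13 * (n : ℝ) ^ 3 * Real.exp (-(20 * Real.log n)) := by
  have hnR : (100 : ℝ) ≤ n := by exact_mod_cast hn
  have hn0 : (0 : ℝ) < n := by linarith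
  set L := Real.log n with hLdef
  have hL1 : 1 ≤ L := by
    rw [hLdef, Real.le_log_iff_exp_le hn0]
    linarith [Real.exp_one_lt_d9]
  have hLn : L ≤ n := (Real.log_le_sub_one_of_pos hn0).trans (by linarith)
  set E := Real.exp (-(20 * L)) with hE
  have hE0 : 0 < E := Real.exp_pos _
  set ℓ : ℝ := 2 * (1 / 20000) ^ 2 / L ^ 2 with hℓ
  have hℓ0 : 0 < ℓ := by positivity
  have hℓL : ℓ * L ^ 2 = 2 * (1 / 20000) ^ 2 := by rw [hℓ]; field_simp
  have hP : IsProj (tproj U V) ℓ := by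
    have := isProj_tproj hsvd.left_orthonormal hsvd.right_orthonormal hU hV
    exact ⟨this.symm, this.idem, fun e => (this.diag_le e).trans (le_of_eq (by rw [hℓ]; ring))⟩
  have hτ2 : τ ≤ 1 / 20 := hτ1.trans tauS_le
  set g := p * (1 - 2 * τ) with hg
  have hg0 : 0.08 ≤ g := by rw [hg]; nlinarith
  have hg1 : g ≤ 0.11 := by rw [hg]; nlinarith
  have hgpos : 0 < g := by linarith
  set a := 2 * p * τ / (1 - g) with ha
  have h1g : 0 < 1 - g := by linarith
  have ha' : (1 - g) * a = 2 * p * τ := by rw [ha]; field_simp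
  have ha0 : 0 ≤ a := by rw [ha]; exact div_nonneg (by positivity) h1g.le
  have haτ : a ≤ τ := by
    rw [ha, div_le_iff₀ h1g]; nlinarith
  -- Since 2 log 2 ≥ 1, this many halvings give 2^K ≥ n.
  set K := ⌈2 * L⌉₊ with hK
  have hKL : 2 * L ≤ K := Nat.le_ceil _
  have hKL' : (K : ℝ) ≤ 3 * L := by
    have := Nat.ceil_lt_add_one (by linarith : 0 ≤ 2 * L)
    linarith
  have hK0 : 0 < K := Nat.ceil_pos.2 (by linarith)
  obtain ⟨q, hq0, hq1, hgq, hqK⟩ := exists_golf_rate hgpos (by linarith : g < 1) hK0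
  have hqL : 1 / (40 * L) ≤ q := by
    refine le_trans ?_ hgq
    rw [div_le_div_iff₀ (by positivity) (by exact_mod_cast hK0)]
    nlinarith
  have hqinv : 1 / q ≤ 40 * L := by
    rw [div_le_iff₀ hq0]
    rw [div_le_iff₀ (by positivity)] at hqL
    linarith
  -- the exponential factors
  have x1 : Real.exp (-(q / (16 * ℓ))) ≤ E := by
    refine Real.exp_le_exp.2 (neg_le_neg ?_)
    rw [le_div_iff₀ (by positivity)]
    refine le_trans ?_ hqL
    rw [le_div_iff₀ (by positivity)]
    calc 20 * L * (16 * ℓ) * (40 * L) = 12800 * (ℓ * L ^ 2) := by ring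
      _ ≤ 1 := by rw [hℓL]; norm_num
  have x2 : Real.exp (-(g / (8 * ℓ))) ≤ E := by
    refine Real.exp_le_exp.2 (neg_le_neg ?_)
    rw [le_div_iff₀ (by positivity)]
    calc 20 * L * (8 * ℓ) ≤ 20 * L * (8 * ℓ) * L := le_mul_of_one_le_right (by positivity) hL1
      _ = 160 * (ℓ * L ^ 2) := by ring
      _ ≤ 0.08 := by rw [hℓL]; norm_num
      _ ≤ g := hg0
  have x3 : Real.exp (-(g ^ 2 / (128 * ℓ))) ≤ E := by
    refine Real.exp_le_exp.2 (neg_le_neg ?_)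
    rw [le_div_iff₀ (by positivity)]
    calc 20 * L * (128 * ℓ) ≤ 20 * L * (128 * ℓ) * L :=
          le_mul_of_one_le_right (by positivity) hL1
      _ = 2560 * (ℓ * L ^ 2) := by ring
      _ ≤ 0.08 ^ 2 := by rw [hℓL]; norm_num
      _ ≤ g ^ 2 := by gcongr
  have hsq : √(n : ℝ) ^ 2 = n := Real.sq_sqrt hn0.le
  have hsn : 0 < √(n : ℝ) := Real.sqrt_pos.2 hn0
  have hsn1 : 1 ≤ √(n : ℝ) := by rw [Real.one_le_sqrt]; linarith
  set lam : ℝ := 1 / √(0.1 * n) with hlam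
  have hlam_lo : 3 / √(n : ℝ) ≤ lam := by
    have h1 : √(0.1 * n) ≤ √(n : ℝ) / 3 := by
      refine Real.sqrt_le_iff.2 ⟨by positivity, ?_⟩
      rw [div_pow, hsq]
      norm_num
      linarith
    rw [hlam, div_le_div_iff₀ hsn (Real.sqrt_pos.2 (by positivity))]
    linarith
  have hlam_hi : lam ≤ 4 / √(n : ℝ) := by
    have h1 : √(n : ℝ) / 4 ≤ √(0.1 * n) := by
      refine Real.le_sqrt_of_sq_le ?_
      rw [div_pow, hsq]
      norm_num
      linarith
    rw [hlam, div_le_div_iff₀ (Real.sqrt_pos.2 (by positivity)) hsn]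
    linarith
  have hlam0 : 0 < lam := lt_of_lt_of_le (by positivity) hlam_lo
  set z : ℝ := (1 / 20000) / (√n * L) with hz
  have hz0 : 0 < z := by positivity
  have hzL : z * (√n * L) = 1 / 20000 := by rw [hz]; field_simp
  have hN : (n₁ : ℝ) * n₂ ≤ (n : ℝ) ^ 2 := by
    rw [sq]; exact mul_le_mul (by exact_mod_cast hn₁) (by exact_mod_cast hn₂) (by positivity) hn0.le
  -- the random signs
  have hsign : ∀ x, Lower (tproj U V) g x →
      -- With λ ≤ 4/√n, the level t = √n/32 makes 2λt ≤ 1/4. The net then requires 60 · 208 · 32² κ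
      -- ≤ 1, which dictates the size of `kap`.
      pr (sgnW a) (fun s => ¬ SignCorr (tproj U V) (√n / 32) x s) ≤
        2 * (n : ℝ) ^ 2 * E + E := fun x hx => by
    refine (hP.pr_signCorr_le hℓ0 hgpos hx ha0 (by linarith) kap_pos (haτ.trans hτ1)
      (by positivity)).trans (add_le_add ?_ ?_)
    · gcongr
    · refine net_mul_exp_le hn₁ hn₂ (by omega) ?_
      have hg2 : 2 / g ≤ 25 := by rw [div_le_iff₀ hgpos]; linarith
      have hkp := kap_pos
      have hden : 4 * kap * (2 * (1 + 2 / g)) ≤ 208 * kap := by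
        have := mul_le_mul_of_nonneg_left hg2 hkp.le
        linarith
      rw [le_div_iff₀ (by positivity), div_pow, hsq]
      calc 60 * (n : ℝ) * (4 * kap * (2 * (1 + 2 / g))) ≤ 60 * n * (208 * kap) := by gcongr
        _ ≤ n / 32 ^ 2 := by unfold kap; norm_num; linarith
  have hmain := ex_fails_le (S := S) (t := √n / 32) hsvd hgpos (by linarith) ha0 (by linarith)
    hτ0 (by linarith) rfl ha' hlam0 (by
      calc lam * (2 * (√n / 32)) ≤ 4 / √n * (2 * (√n / 32)) := by gcongr
        _ = 1 / 4 := by field_simp; norm_num) (by positivity) hsign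
  refine hmain.trans ?_
  -- the clean set
  have hwg := isWeight_ber hgpos.le (by linarith : g ≤ 1)
  have hPu : tproj U V *ᵥ vec (U * Vᵀ) = vec (U * Vᵀ) := tproj_mulVec_eq (by
    rw [← Matrix.mul_assoc, cproj_mul hsvd.left_orthonormal, Matrix.zero_mul])
  have hsplit : pr (ber g) (fun x => ¬ (Lower (tproj U V) g x ∧
      Interp (tproj U V) lam (vec (U * Vᵀ)) x)) ≤
      pr (ber g) (fun x => ¬ Lower (tproj U V) g x) +
        -- The choice β = 11√n gives β²/2 = 60.5 n, enough for `net_mul_exp_le`. The spectral bound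
        -- 4βz/q is then at most 1760 / 20000 < 1/8, the reason for the constant 1/20000.
        pr (ber g) (fun x => ¬ Golf (tproj U V) q (11 * √n) K (vec (U * Vᵀ)) z x) := by
    refine le_trans (pr_mono hwg fun x hx => ?_) (pr_or_le hwg _ _)
    by_contra hcon
    push Not at hcon
    refine hx ⟨hcon.1, hP.interp_of_golf (ε := 5 * z) hgpos hcon.1 hPu hcon.2 ?_ ?_
      (by positivity) ?_ ?_ ?_⟩
    · calc 2 * z / q = 2 * z * (1 / q) := by ring
        _ ≤ 2 * z * (40 * L) := by gcongr
        _ = 80 * (z * (√n * L)) / √n := by field_simp; ring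
        _ = (80 / 20000) / √n := by rw [hzL]; ring
        _ ≤ 3 / 8 / √n := div_le_div_of_nonneg_right (by norm_num) hsn.le
        _ = 3 / √n / 8 := by ring
        _ ≤ lam / 8 := by gcongr
    · calc 4 * (11 * √n * z / q) = 44 * √n * z * (1 / q) := by ring
        _ ≤ 44 * √n * z * (40 * L) := by gcongr
        _ = 1760 * (z * (√n * L)) := by ring
        _ ≤ 1 / 8 := by rw [hzL]; norm_num
    -- With 2/g ≤ 25 and 2^K ≥ n, the squared norm of the correction is at most 25z², whence ε = 5z.
    · have h2K : (n : ℝ) ≤ 2 ^ K := by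
        have h1 : (1 : ℝ) ≤ 2 * Real.log 2 := by linarith [Real.log_two_gt_d9]
        have h2 : L ≤ K * Real.log 2 := by nlinarith
        rw [← Real.log_le_log_iff hn0 (by positivity), Real.log_pow]
        exact h2
      have hg2 : 2 / g ≤ 25 := by rw [div_le_iff₀ hgpos]; linarith
      calc 2 / g * (n₁ * n₂ * (z / 2 ^ K) ^ 2) ≤ 25 * ((n : ℝ) ^ 2 * (z / n) ^ 2) := by gcongr
        _ = (5 * z) ^ 2 := by field_simp; norm_num
    · calc 5 * z ≤ 5 * z * L := le_mul_of_one_le_right (by positivity) hL1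
        _ = 5 * (z * (√n * L)) / √n := by field_simp
        _ = (5 / 20000) / √n := by rw [hzL]; ring
        _ ≤ 3 / 8 / √n := div_le_div_of_nonneg_right (by norm_num) hsn.le
        _ = 3 / √n / 8 := by ring
        _ ≤ lam / 8 := by gcongr
    · calc 5 * z ≤ 5 * z * (√n * L) := le_mul_of_one_le_right (by positivity)
            (one_le_mul_of_one_le_of_one_le hsn1 hL1)
        _ = 5 * (z * (√n * L)) := by ring
        _ ≤ 1 / 8 := by rw [hzL]; norm_num
  have hlow : pr (ber g) (fun x => ¬ Lower (tproj U V) g x) ≤ (n : ℝ) ^ 2 * E := by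
    refine le_trans (pr_mono hwg fun x hx => ?_) ((hP.pr_lower_le hℓ0 hgpos.le
      (by linarith : g ≤ 1 / 2)).trans (b := _) (mul_le_mul ?_ x2 (Real.exp_pos _).le
        (by positivity)))
    · unfold Lower at hx
      push Not at hx
      obtain ⟨y, hy, hlt⟩ := hx
      refine ⟨y, hy, ?_⟩
      have e1 : restr x y ⬝ᵥ restr x y = ∑ e, ind (x e) * y e ^ 2 := by
        rw [restr_dot_restr]
        exact Finset.sum_congr rfl fun e _ => by simp only [restr]; ring
      have e2 : y ⬝ᵥ y = ∑ e, y e ^ 2 := Finset.sum_congr rfl fun e _ => by ring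
      rw [← e1, ← e2]
      exact hlt
    · simpa using hN
  have hgolf : pr (ber g) (fun x => ¬ Golf (tproj U V) q (11 * √n) K (vec (U * Vᵀ)) z x) ≤
      3 * n * (2 * (n : ℝ) ^ 2 * E + E) := by
    have h1 := hP.pr_golf_le hℓ0 hq0 hq1 (β := 11 * √n) (by positivity) K (z := z) hz0 hPu
      (fun e => hUV e.1 e.2)
    rw [hqK] at h1
    refine h1.trans (mul_le_mul (by linarith) ?_ (golfδ_nonneg _ _ _ _ _) (by positivity))
    unfold golfδ
    refine add_le_add (by gcongr) (net_mul_exp_le hn₁ hn₂ (by omega) ?_)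
    rw [mul_pow, hsq]
    linarith
  have hn2 : (1 : ℝ) ≤ (n : ℝ) ^ 2 := one_le_pow₀ (by linarith)
  have hn3 : (n : ℝ) ^ 2 * 100 ≤ (n : ℝ) ^ 3 := by
    rw [pow_succ (n : ℝ) 2]; exact mul_le_mul_of_nonneg_left hnR (by positivity)
  have hn31 : (n : ℝ) * 100 ≤ (n : ℝ) ^ 3 := by nlinarith
  calc pr (ber g) (fun x => ¬ (Lower (tproj U V) g x ∧
        Interp (tproj U V) lam (vec (U * Vᵀ)) x)) + (2 * (n : ℝ) ^ 2 * E + E)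
      ≤ (n : ℝ) ^ 2 * E + 3 * n * (2 * (n : ℝ) ^ 2 * E + E) + (2 * (n : ℝ) ^ 2 * E + E) := by
        linarith
    _ = ((n : ℝ) ^ 2 + 6 * (n : ℝ) ^ 3 + 3 * n + 2 * (n : ℝ) ^ 2 + 1) * E := by ring
    _ ≤ 13 * (n : ℝ) ^ 3 * E := by
        refine mul_le_mul_of_nonneg_right ?_ hE0.le
        linarith

end

end RobustPCA

/-! ### Transfer from Bernoulli sets to uniform sets of fixed size. -/

namespace RobustPCA
noncomputable section
open Matrix MeasureTheory ProbabilityTheory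
variable {n₁ n₂ : ℕ}

section Transfer
variable {ι : Type*} [Fintype ι]

theorem ex_eq_sum [DecidableEq ι] {Θ : Type*} [Fintype Θ] (w : Θ → ℝ) (F : (ι → Θ) → ℝ) :
    ex w F = ∑ x : ι → Θ, (∏ e, w (x e)) * F x := by
  unfold ex
  congr!

theorem setOf_bijective {ι : Type*} :
    Function.Bijective (fun x : ι → Bool => ({e | x e = true} : Set ι)) := by
  classical
  refine ⟨fun x y h => funext fun e => ?_, fun A => ⟨fun e => decide (e ∈ A), by ext; simp⟩⟩
  have : e ∈ ({e | x e = true} : Set ι) ↔ e ∈ ({e | y e = true} : Set ι) := by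
    rw [show ({e | x e = true} : Set ι) = {e | y e = true} from h]
  simp only [Set.mem_ofPred_eq] at this
  exact Bool.eq_iff_iff.2 this

theorem setBernoulli_real_setOf (τ : unitInterval) (b : ι → Bool) :
    (setBernoulli Set.univ τ).real {({e | b e = true} : Set ι)} = ∏ e, ber τ (b e) := by
  classical
  have h2 : (Set.univ \ {e | b e = true} : Set ι) = {e | ¬ b e = true} := by ext; simp
  rw [setBernoulli_real_singleton τ (Set.subset_univ _) Set.finite_univ, h2,
    Set.ncard_eq_toFinset_card', Set.ncard_eq_toFinset_card', Set.toFinset_ofPred,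
    Set.toFinset_ofPred]
  simp only [ber]
  rw [Finset.prod_ite, Finset.prod_const, Finset.prod_const]

/-- The uniform law on the sets of size `m` is dominated by the Bernoulli law of the same mean. -/
theorem uniformOn_real_singleton_le {m : ℕ} (hm0 : 0 < m) (hm : m < Fintype.card ι)
    {p : unitInterval} (hp : (p : ℝ) = m / Fintype.card ι) (A : Set ι) :
    (uniformOn {A : Set ι | A.ncard = m}).real {A} ≤
      (Fintype.card ι + 1) * (setBernoulli Set.univ p).real {A} := by
  classical
  set N := Fintype.card ι with hN
  set s : Set (Set ι) := {A | A.ncard = m} with hs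
  have hsm : MeasurableSet s := (Set.toFinite s).measurableSet
  by_cases hA : A ∈ s
  · have hcard : s.ncard = N.choose m := by
      have := Set.ncard_powerset_ncard (s := (Set.univ : Set ι)) Set.finite_univ m
      rw [Set.ncard_univ, Nat.card_eq_fintype_card] at this
      simpa [hs] using this
    have hcount : (uniformOn s).real {A} = ((N.choose m : ℕ) : ℝ)⁻¹ := by
      rw [measureReal_def, uniformOn, cond_apply hsm, Set.inter_eq_right.2
        (Set.singleton_subset_iff.2 hA), Measure.count_singleton, mul_one, ENNReal.toReal_inv,
        Measure.count_apply_finite s (Set.toFinite s), ← Set.ncard_eq_toFinset_card s, hcard]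
      simp
    have hAm : A.ncard = m := hA
    rw [hcount, setBernoulli_real_singleton p (Set.subset_univ _) Set.finite_univ,
      Set.ncard_sdiff (Set.subset_univ _), Set.ncard_univ, Nat.card_eq_fintype_card, ← hN, hAm, hp]
    have hc : (0 : ℝ) < (N.choose m : ℕ) := by exact_mod_cast Nat.choose_pos hm.le
    -- On sets of size m both laws are constant, and their ratio is the reciprocal of the binomial
    -- probability of the value m.
    rw [inv_le_iff_one_le_mul₀ hc]
    refine (one_le_binomial_mode hm0 hm).trans (le_of_eq ?_)
    ring
  · have h0 : (uniformOn s).real {A} = 0 := by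
      rw [measureReal_def, uniformOn, cond_apply hsm,
        Set.inter_singleton_eq_empty.2 hA, measure_empty, mul_zero, ENNReal.toReal_zero]
    rw [h0]
    positivity

end Transfer

/-- Transfer from Bernoulli observed sets to uniform observed sets of fixed size. -/
theorem le_samplingLaw_real {m : ℕ} (hm0 : 0 < m) (hm : m < n₁ * n₂) (τ : unitInterval)
    (lam : ℝ) (L₀ S : Matrix (Fin n₁) (Fin n₂) ℝ) :
    1 - ((n₁ * n₂ : ℝ) + 1) * ex (ber (m / (n₁ * n₂ : ℝ)))
        (fun o => pr (ber τ) (Fails lam L₀ S o)) ≤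
      (samplingLaw n₁ n₂ m τ).real {p | IsPCPExact lam p.1 L₀ (proj p.2 S)} := by
  classical
  set s : Set (Set (Fin n₁ × Fin n₂)) := {A | A.ncard = m} with hs
  have hcard : Fintype.card (Fin n₁ × Fin n₂) = n₁ * n₂ := by simp
  have hcardR : ((Fintype.card (Fin n₁ × Fin n₂) : ℕ) : ℝ) = n₁ * n₂ := by
    rw [hcard]; push_cast; rfl
  have hNR : (m : ℝ) < n₁ * n₂ := by exact_mod_cast hm
  have hN0 : (0 : ℝ) < n₁ * n₂ := lt_of_le_of_lt (by positivity) hNR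
  obtain ⟨p, hp⟩ : ∃ p : unitInterval, (p : ℝ) = m / (n₁ * n₂ : ℝ) :=
    ⟨⟨m / (n₁ * n₂ : ℝ), by positivity, (div_le_one hN0).2 hNR.le⟩, rfl⟩
  have hsne : s.Nonempty := by
    obtain ⟨t, -, ht⟩ := Set.exists_subset_card_eq (s := (Set.univ : Set (Fin n₁ × Fin n₂)))
      (n := m) (by rw [Set.ncard_univ, Nat.card_eq_fintype_card, hcard]; exact hm.le)
    exact ⟨t, ht⟩
  have : IsProbabilityMeasure (uniformOn s) := isProbabilityMeasure_uniformOn (Set.toFinite s) hsne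
  have : IsProbabilityMeasure (samplingLaw n₁ n₂ m τ) := by unfold samplingLaw; infer_instance
  set G : Set (Set (Fin n₁ × Fin n₂) × Set (Fin n₁ × Fin n₂)) :=
    {p | IsPCPExact lam p.1 L₀ (proj p.2 S)} with hG
  have hcompl := probReal_compl_eq_one_sub (μ := samplingLaw n₁ n₂ m τ)
    (Set.toFinite G).measurableSet
  suffices h : (samplingLaw n₁ n₂ m τ).real Gᶜ ≤ ((n₁ * n₂ : ℝ) + 1) *
      ex (ber (m / (n₁ * n₂ : ℝ))) (fun o => pr (ber τ) (Fails lam L₀ S o)) by linarith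
  have hsum : (samplingLaw n₁ n₂ m τ).real Gᶜ = ∑ A, ∑ B,
      (uniformOn s).real {A} * ((setBernoulli Set.univ τ).real {B} *
        if (A, B) ∈ Gᶜ then 1 else 0) := by
    have h1 := sum_measureReal_singleton (μ := samplingLaw n₁ n₂ m τ) (Finset.univ.filter (· ∈ Gᶜ))
    rw [Finset.coe_filter] at h1
    simp only [Finset.mem_univ, true_and, Set.ofPred_mem_eq] at h1
    rw [← h1, Finset.sum_filter, Fintype.sum_prod_type]
    refine Finset.sum_congr rfl fun A _ => Finset.sum_congr rfl fun B _ => ?_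
    split_ifs
    · rw [← Set.singleton_prod_singleton, samplingLaw, measureReal_prod_prod, mul_one]
    · rw [mul_zero, mul_zero]
  rw [hsum, ← (setOf_bijective (ι := Fin n₁ × Fin n₂)).sum_comp]
  rw [ex_eq_sum, Finset.mul_sum]
  refine Finset.sum_le_sum fun o _ => ?_
  rw [← (setOf_bijective (ι := Fin n₁ × Fin n₂)).sum_comp, ← Finset.mul_sum, ← mul_assoc, ← hp,
    ← setBernoulli_real_setOf, ← hcardR]
  refine mul_le_mul (uniformOn_real_singleton_le hm0 (by rw [hcard]; exact hm)
    (by rw [hcardR, hp]) _) (le_of_eq ?_) ?_ (by positivity)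
  · rw [pr, ex_eq_sum]
    refine Finset.sum_congr rfl fun b _ => ?_
    rw [setBernoulli_real_setOf]
    have hiff : ({e | o e = true}, {e | b e = true}) ∈ Gᶜ ↔ Fails lam L₀ S o b := Iff.rfl
    simp only [hiff]
  · exact Finset.sum_nonneg fun b _ => mul_nonneg measureReal_nonneg (by split_ifs <;> norm_num)

end

end RobustPCA

/-! ### The main theorem. -/

/-- Principal Component Pursuit recovers an incoherent matrix of low rank from a tenth of its
entries, a small fraction of which is arbitrarily corrupted. -/
theorem theorem1p2 :
    ∃ ρr τs c : ℝ, 0 < ρr ∧ 0 < τs ∧ 0 < c ∧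
      ∀ (n₁ n₂ m : ℕ) (τ : unitInterval) (μ : ℝ) (L₀ S : Matrix (Fin n₁) (Fin n₂) ℝ),
        0 < n₁ → 0 < n₂ →
        |(m : ℝ) - 0.1 * n₁ * n₂| < 1 →
        RobustPCA.IsIncoherent L₀ μ →
        (L₀.rank : ℝ) * μ * Real.log (max n₁ n₂ : ℕ) ^ 2 ≤ ρr * (min n₁ n₂ : ℕ) →
        (τ : ℝ) ≤ τs →
        1 - c * ((max n₁ n₂ : ℕ) : ℝ) ^ (-10 : ℤ) ≤
          (RobustPCA.samplingLaw n₁ n₂ m τ).real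
            {p | RobustPCA.IsPCPExact (1 / √(0.1 * (max n₁ n₂ : ℕ))) p.1 L₀
              (RobustPCA.proj p.2 S)} := by
  -- The constant 100^10 makes the claim trivial for max n₁ n₂ < 100. Beyond that, n₁n₂ ≥ 100 keeps
  -- m/(n₁n₂) within 0.01 of 0.1.
  refine ⟨(1 / 20000) ^ 2, RobustPCA.tauS, 100 ^ 10, by norm_num, RobustPCA.tauS_pos, by norm_num,
    fun n₁ n₂ m τ μ L₀ S hn₁ hn₂ hm hinc hrank hτ => ?_⟩
  set n := max n₁ n₂ with hn
  have h1n : n₁ ≤ n := le_max_left _ _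
  have h2n : n₂ ≤ n := le_max_right _ _
  have hnpos : (0 : ℝ) < n := by exact_mod_cast hn₁.trans_le h1n
  have hz : (n : ℝ) ^ (-10 : ℤ) = ((n : ℝ) ^ 10)⁻¹ := by
    rw [zpow_neg]; norm_cast
  rw [hz]
  by_cases hbig : 100 ≤ n
  swap
  · have h1 : (n : ℝ) ^ 10 ≤ 100 ^ 10 := by
      gcongr
      exact_mod_cast (by omega : n ≤ 100)
    have h2 : (1 : ℝ) ≤ 100 ^ 10 * ((n : ℝ) ^ 10)⁻¹ := by
      rw [← div_eq_mul_inv, one_le_div (by positivity)]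
      exact h1
    exact le_trans (by linarith) MeasureTheory.measureReal_nonneg
  have hbigR : (100 : ℝ) ≤ n := by exact_mod_cast hbig
  have h1R : (0 : ℝ) < n₁ := by exact_mod_cast hn₁
  have h2R : (0 : ℝ) < n₂ := by exact_mod_cast hn₂
  have hnN : n ≤ n₁ * n₂ := by
    rcases max_cases n₁ n₂ with ⟨h, -⟩ | ⟨h, -⟩ <;> rw [hn, h]
    · exact Nat.le_mul_of_pos_right _ hn₂
    · exact Nat.le_mul_of_pos_left _ hn₁
  have hNR : (100 : ℝ) ≤ n₁ * n₂ := by exact_mod_cast hbig.trans hnN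
  have hNn : (n₁ * n₂ : ℝ) ≤ n ^ 2 := by
    rw [sq]
    exact mul_le_mul (by exact_mod_cast h1n) (by exact_mod_cast h2n) h2R.le hnpos.le
  rw [abs_lt, mul_assoc] at hm
  have hp0 : (0.09 : ℝ) ≤ m / (n₁ * n₂ : ℝ) := by
    rw [le_div_iff₀ (by positivity)]; linarith [hm.1]
  have hp1 : (m : ℝ) / (n₁ * n₂ : ℝ) ≤ 0.11 := by
    rw [div_le_iff₀ (by positivity)]; linarith [hm.2]
  have hm0 : 0 < m := by
    have : (0 : ℝ) < m := by linarith [hm.1]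
    exact_mod_cast this
  have hmN : m < n₁ * n₂ := by
    have : (m : ℝ) < n₁ * n₂ := by linarith [hm.2]
    exact_mod_cast this
  have hlog : 0 < Real.log n := Real.log_pos (by linarith)
  obtain ⟨U, σ, V, hsvd, hU, hV, hUV⟩ := hinc
  set r : ℝ := (L₀.rank : ℝ) with hr
  have hrow : ∀ k : ℕ, 0 < k → min n₁ n₂ ≤ k →
      μ * r / k ≤ (1 / 20000) ^ 2 / Real.log n ^ 2 := fun k hk hmin => by
    have hk' : (0 : ℝ) < k := by exact_mod_cast hk
    have hmin' : ((min n₁ n₂ : ℕ) : ℝ) ≤ k := by exact_mod_cast hmin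
    rw [div_le_div_iff₀ hk' (by positivity)]
    linarith
  have hmm : (n : ℝ) * (min n₁ n₂ : ℕ) = n₁ * n₂ := by
    rw [hn]; exact_mod_cast max_mul_min n₁ n₂
  have hent : √(μ * r / (n₁ * n₂)) ≤ (1 / 20000) / (√n * Real.log n) := by
    refine Real.sqrt_le_iff.2 ⟨by positivity, ?_⟩
    have hsq : √(n : ℝ) ^ 2 = n := Real.sq_sqrt hnpos.le
    rw [div_pow, mul_pow, hsq, div_le_div_iff₀ (by positivity) (by positivity), ← hmm]
    have := mul_le_mul_of_nonneg_left hrank hnpos.le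
    linarith
  have hfail := RobustPCA.ex_fails_le_of_incoherent S hsvd h1n h2n hbig hp0 hp1 τ.2.1 hτ
    (fun i => (hU i).trans (hrow n₁ hn₁ (min_le_left _ _)))
    (fun j => (hV j).trans (hrow n₂ hn₂ (min_le_right _ _)))
    (fun i j => (hUV i j).trans hent)
  refine le_trans ?_ (RobustPCA.le_samplingLaw_real hm0 hmN τ _ L₀ S)
  refine sub_le_sub_left ?_ 1
  have hexp : Real.exp (-(20 * Real.log n)) = ((n : ℝ) ^ 10)⁻¹ * ((n : ℝ) ^ 10)⁻¹ := by
    rw [Real.exp_neg, show (20 : ℝ) * Real.log n = ((20 : ℕ) : ℝ) * Real.log n by norm_num,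
      Real.exp_nat_mul, Real.exp_log hnpos, ← mul_inv, ← pow_add]
  rw [hexp] at hfail
  -- The transfer factor n² + 1 times 13 n³ · n^(-20) is far below n^(-10).
  calc ((n₁ * n₂ : ℝ) + 1) * _
      ≤ (n ^ 2 + 1) * (13 * (n : ℝ) ^ 3 * (((n : ℝ) ^ 10)⁻¹ * ((n : ℝ) ^ 10)⁻¹)) := by
        refine mul_le_mul (by linarith) hfail ?_ (by positivity)
        exact RobustPCA.ex_nonneg (RobustPCA.isWeight_ber (by linarith) (by linarith)) fun o =>
          RobustPCA.pr_nonneg (RobustPCA.isWeight_ber τ.2.1 τ.2.2) _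
    _ = ((n ^ 2 + 1) * (13 * (n : ℝ) ^ 3) * ((n : ℝ) ^ 10)⁻¹) * ((n : ℝ) ^ 10)⁻¹ := by ring
    _ ≤ 100 ^ 10 * ((n : ℝ) ^ 10)⁻¹ := by
        refine mul_le_mul_of_nonneg_right ?_ (by positivity)
        rw [← div_eq_mul_inv, div_le_iff₀ (by positivity)]
        have e1 : (n : ℝ) ^ 2 + 1 ≤ 2 * n ^ 2 := by
          have : (1 : ℝ) ≤ (n : ℝ) ^ 2 := one_le_pow₀ (by linarith)
          linarith
        calc ((n : ℝ) ^ 2 + 1) * (13 * (n : ℝ) ^ 3) ≤ 2 * n ^ 2 * (13 * (n : ℝ) ^ 3) := by gcongr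
          _ = 26 * (n : ℝ) ^ 5 := by ring
          _ ≤ 100 ^ 10 * (n : ℝ) ^ 10 := by
              refine mul_le_mul (by norm_num) ?_ (by positivity) (by norm_num)
              exact pow_le_pow_right₀ (by linarith) (by norm_num)
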